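/- Notation. Let $D=(d_1,\dots,d_n)$ be a sequence of positive integers with $d_1\le\cdots\le d_n$ and put $M=\sum_{i=1}^n d_i$. For $j\in[n]$ let $S_j=\sum_{i=n-d_j}^{n} d_i$ and let $\ell(D)=\max\{j\in[n] : S_j\le M/2\}$. For $\varepsilon,\nu>0$, $D$ is a strict graphic sequence of type $(\varepsilon,\nu)$ if (1) $\sum_{i=n-m+1}^{n} d_i< m(m-1)+\sum_{i=1}^{n-m}\min\{m,d_i\}$ for all $1\le m\le n$; (2) $M$ is even and $M\ge n^{1+\varepsilon}$; (3) $\ell(D)$ exists and $\sqrt{n/M}\,\bigl(d_n-d_{\ell(D)}+1\bigr)<n^{-\nu}$. Let $\mathbb P^D$ be the set of all symmetric arrays $(x_{ij})_{i\ne j\in[n]}$ with $0\le x_{ij}\le 1$ and $\sum_{j\neq i}x_{ij}=d_i$ for all $i$, and let $\widetilde{\mathbf p}=(\widetilde p_{ij})$ be the maximizer on $\mathbb P^D$ of $\sum_{i<j}\bigl(-x_{ij}\ln x_{ij}-(1-x_{ij})\ln(1-x_{ij})\bigr)$. Let $\widetilde{\mathcal G}(D)$ be the random graph on $[n]$ in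 which the edges $\{i,j\}$ are present independently with probabilities $\widetilde p_{ij}$. For $\tfrac12<a<1$ let $\mathcal G_{\mathbf a}(a,D)$ be uniformly distributed on the set $\mathbb G_a^D$ of all simple graphs on $[n]$ whose degrees $\bar d_i$ satisfy $|d_i-\bar d_i|<d_i^{a}$ for all $i$. Let $\mathbb T^k$ be the set of all trees with vertex set $[k]$ and $\mathbb S_n^k$ the set of all injections $s:[k]\to[n]$. For $(s,T)\in\mathbb S_n^k\times\mathbb T^k$ let $\psi(s,T,D)=\prod_{u\in[k]} d_{s(u)}^{\,b_u-1}$, where $b_u$ is the degree of $u$ in $T$, and let $\mathbf p_{\mathbf a}(s,T)$ and $\widetilde{\mathbf p}(s,T)$ be the probabilities that $s$ maps every edge of $T$ to an edge of $\mathcal G_{\mathbf a}(a,D)$ and of $\widetilde{\mathcal G}(D)$, respectively. Put $$L_{\mathbf a}(a,k,D)=\frac1M\sum_{(s,T)\in\mathbb S_n^k\times\mathbb T^k}\frac{1}{\psi(s,T,D)}\bigl|\mathbf p_{\mathbf a}(s,T)-\widetilde{\mathbf p}(s,T)\bigr|.$$ Theorem. For every $k$ there is a constant $c_k>0$, depending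 only on $k$, such that for all $\varepsilon,\nu>0$ and all $a$ with $\tfrac12<a<\tfrac{\nu}{4}+\tfrac12$ there is an $N$ such that, for every $n\ge N$ and every strict graphic sequence $D=(d_1,\dots,d_n)$ of type $(\varepsilon,\nu)$, $$L_{\mathbf a}(a,k,D)\le c_k\, n^{\,a-\frac{\nu+1}{2}},$$ and the right-hand side tends to $0$ as $n\to\infty$. -/

import Mathlib

namespace AlmostDegree

open scoped Classical

noncomputable section

variable {n k : ℕ}

/-- `M`, the sum of the entries of `D`. -/
def total (D : Fin n → ℕ) : ℕ := ∑ i, D i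

/-- The strict Erdős–Gallai conditions for a nondecreasing sequence. The vertex called `i + 1` in
one-based numbering is the element `i` of `Fin n`. -/
def StrictErdosGallai (D : Fin n → ℕ) : Prop :=
  ∀ m : ℕ, 1 ≤ m → m ≤ n →
    ∑ i ∈ Finset.univ.filter (fun i : Fin n => n - m ≤ (i : ℕ)), D i
      < m * (m - 1) +
          ∑ i ∈ Finset.univ.filter (fun i : Fin n => (i : ℕ) < n - m), min m (D i)

/-- `S_j`, the sum of `d_i` over the (one-based) indices `i ∈ {n - d_j, …, n}`. -/
def upperSum (D : Fin n → ℕ) (j : Fin n) : ℕ :=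
  ∑ i ∈ Finset.univ.filter (fun i : Fin n => n ≤ ((i : ℕ) + 1) + D j), D i

/-- `ℓ` is the largest index with `S_ℓ ≤ M / 2`. -/
def IsEll (D : Fin n → ℕ) (ℓ : Fin n) : Prop :=
  IsGreatest {j : Fin n | (upperSum D j : ℝ) ≤ (total D : ℝ) / 2} ℓ

/-- Strict graphic sequences of type `(ε, ν)`. The last condition includes that the index `ℓ`
exists; `last` is the last index, so `D last` is the largest entry. -/
structure IsStrictGraphicOfType (ε ν : ℝ) (D : Fin n → ℕ) : Prop where
  pos : ∀ i, 1 ≤ D i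
  mono : Monotone D
  strictErdosGallai : StrictErdosGallai D
  even_total : Even (total D)
  le_total : (n : ℝ) ^ (1 + ε) ≤ (total D : ℝ)
  gap : ∃ ℓ last : Fin n, (last : ℕ) + 1 = n ∧ IsEll D ℓ ∧
    Real.sqrt ((n : ℝ) / (total D : ℝ)) * ((D last : ℝ) - (D ℓ : ℝ) + 1) < (n : ℝ) ^ (-ν)

/-- The polytope `P^D`: edge weights `x_{ij} = x_{ji} ∈ [0, 1]`, `i ≠ j`, whose sum at each vertex
`i` is `d_i`. The diagonal entries are not coordinates of the polytope and are set to `0`. -/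
def polytope (D : Fin n → ℕ) : Set (Fin n → Fin n → ℝ) :=
  {x | (∀ i j, x i j = x j i) ∧ (∀ i, x i i = 0) ∧ (∀ i j, 0 ≤ x i j ∧ x i j ≤ 1) ∧
    ∀ i, ∑ j with j ≠ i, x i j = D i}

/-- The entropy `H₁(x) = ∑_{i < j} H(x_{ij})`, with
`H(t) = - t ln t - (1 - t) ln (1 - t)`. -/
def entropy (x : Fin n → Fin n → ℝ) : ℝ :=
  ∑ i, ∑ j with i < j, Real.binEntropy (x i j)

/-- `p` maximizes the entropy over the polytope `P^D`. -/
def IsMaxEntropy (D : Fin n → ℕ) (p : Fin n → Fin n → ℝ) : Prop :=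
  p ∈ polytope D ∧ ∀ x ∈ polytope D, entropy x ≤ entropy p

/-- The point of maximum entropy of `P^D` (unique if `P^D` is non-empty). -/
def maxEntropy (D : Fin n → ℕ) : Fin n → Fin n → ℝ :=
  if h : ∃ p, IsMaxEntropy D p then h.choose else 0

/-- The probability of the graph `G` when each edge `{i, j}` is present independently with
probability `p i j`. -/
def bernoulliProb (p : Fin n → Fin n → ℝ) (G : SimpleGraph (Fin n)) : ℝ :=
  ∏ i, ∏ j with i < j, if G.Adj i j then p i j else 1 - p i j

/-- `G^D`: the graphs in which each vertex `i` has degree `d_i`. -/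
def graphsWithDegrees (D : Fin n → ℕ) : Set (SimpleGraph (Fin n)) :=
  {G | ∀ i, G.degree i = D i}

/-- `G_a^D`: the union of the sets `G^{D'}` over all `D'` with `|d_i - d'_i| < d_i ^ a` for
all `i`. -/
def almostGraphs (a : ℝ) (D : Fin n → ℕ) : Set (SimpleGraph (Fin n)) :=
  ⋃ (D' : Fin n → ℕ) (_ : ∀ i, |(D i : ℝ) - (D' i : ℝ)| < (D i : ℝ) ^ a), graphsWithDegrees D'

/-- `1_s(T, G)`: the indicator that `s` maps every edge of `T` to an edge of `G`. -/
def treeIndicator (s : Fin k ↪ Fin n) (T : SimpleGraph (Fin k)) (G : SimpleGraph (Fin n)) : ℝ :=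
  ∏ e ∈ T.edgeFinset, if e.map s ∈ G.edgeSet then 1 else 0

/-- `p_a(s, T)`: the expectation of `1_s(T, G)` for `G` uniform on `G_a^D`. -/
def probAlmost (a : ℝ) (D : Fin n → ℕ) (s : Fin k ↪ Fin n) (T : SimpleGraph (Fin k)) : ℝ :=
  (∑ G ∈ Finset.univ.filter (fun G : SimpleGraph (Fin n) => G ∈ almostGraphs a D),
      treeIndicator s T G) /
    ((Finset.univ.filter fun G : SimpleGraph (Fin n) => G ∈ almostGraphs a D).card : ℝ)

/-- `p̃(s, T)`: the expectation of `1_s(T, G)` for the random graph `G` with independent edges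
whose probabilities are given by the point of maximum entropy. -/
def probIndep (D : Fin n → ℕ) (s : Fin k ↪ Fin n) (T : SimpleGraph (Fin k)) : ℝ :=
  ∑ G : SimpleGraph (Fin n), bernoulliProb (maxEntropy D) G * treeIndicator s T G

/-- The B-function `ψ(s, T, D) = ∏_u d_{s(u)} ^ (b_u - 1)`, where `b_u` is the degree of `u`
in `T`. -/
def bFunction (s : Fin k ↪ Fin n) (T : SimpleGraph (Fin k)) (D : Fin n → ℕ) : ℝ :=
  ∏ u, (D (s u) : ℝ) ^ ((T.degree u : ℤ) - 1)

/-- `L_a(a, k, D)`: the weighted sum over all ordered trees `(s, T)`, where `T` runs over the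
labelled trees on `k` vertices and `s` over the injections of `k` vertices into `n`. -/
def treeError (a : ℝ) (k : ℕ) (D : Fin n → ℕ) : ℝ :=
  1 / (total D : ℝ) *
    ∑ s : Fin k ↪ Fin n, ∑ T : SimpleGraph (Fin k) with T.IsTree,
      1 / bFunction s T D * |probAlmost a D s T - probIndep D s T|

end

end AlmostDegree

/-!
The strict Erdős–Gallai inequalities make the entropy dual coercive, so that it has a minimizer `l`
and the point of maximum entropy is `p̃_{ij} = 1 / (1 + exp (-(l_i + l_j)))`, with
`|l_i| = O((d_n - d_ℓ + 1) log n)`. A graph then has weight proportional to `exp (∑ deg_i l_i)`, so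
the weights of the graphs in `G_a^D` differ by at most a factor
`exp (O(max |l_i|) ∑ d_i ^ a)`.

The independent model gives `G_a^D` a weight that is not too small: at the vertices of degree below
`n ^ ν` all edges are prescribed, by a rounding of `p̃` that keeps these degrees exact and changes
the other ones by a bounded amount, and at the remaining vertices the degrees concentrate. Together,
the uniform weight of a graph in `G_a^D` exceeds its independent weight by a factor of at most
`exp K` with `K ≤ M n ^ (2a - ν - 1)`.

Revealing the edges one by one writes the signed and weighted sum of the tree indicators, minus its
mean, as a sum of predictable multiples of centred edge indicators. Since `∑ ψ⁻¹` over the trees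
through a given edge is bounded in terms of `k` only, this sum has sub-Gaussian exponential moments
with variance proxy `O(M)` under the independent model, and the entropy inequality of Donsker and
Varadhan bounds its mean under the uniform measure on `G_a^D` by
`O(M n ^ (a - (ν + 1) / 2))`.
-/

namespace AlmostDegree

open Finset Function

/-- The weight of the configuration `ω` under the product of Bernoulli measures with
parameters `p e`. -/
def bitWeight {E : Type*} [Fintype E] (p : E → ℝ) (ω : E → Bool) : ℝ :=
  ∏ e, if ω e then p e else 1 - p e

/-- The bit `b` as a real number, `0` or `1`. -/
def bit (b : Bool) : ℝ := if b then 1 else 0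

theorem ite_bit_nonneg {q : ℝ} (hq : q ∈ Set.Icc 0 1) (b : Bool) :
    0 ≤ if b then q else 1 - q := by
  split_ifs
  exacts [hq.1, sub_nonneg.2 hq.2]

theorem bitWeight_nonneg {E : Type*} [Fintype E] {p : E → ℝ} (hp : ∀ e, p e ∈ Set.Icc 0 1)
    (ω : E → Bool) : 0 ≤ bitWeight p ω :=
  prod_nonneg fun e _ => ite_bit_nonneg (hp e) (ω e)

theorem bit_eq_of_bitWeight_ne_zero {E : Type*} [Fintype E] {p : E → ℝ} {ω : E → Bool}
    (hω : bitWeight p ω ≠ 0) {e : E}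
    (he : p e = 0 ∨ p e = 1) : bit (ω e) = p e := by
  have hne := prod_ne_zero_iff.1 hω e (mem_univ e)
  rcases he with he | he <;> cases hb : ω e <;> simp_all [bit]

section ProductMeasure

variable {E α ι : Type*} [Fintype E] [DecidableEq E] [Fintype α]

theorem sum_sum_update {R : Type*} [NonAssocSemiring R] (F : (E → α) → R) (a : E) :
    ∑ ω : E → α, ∑ c, F (update ω a c) = Fintype.card α * ∑ ω, F ω := by
  have hsplit (c : α × ({e // e ≠ a} → α)) (c' : α) :
      update ((Equiv.funSplitAt a α).symm c) a c' = (Equiv.funSplitAt a α).symm (c', c.2) := by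
    ext e
    by_cases h : e = a
    · subst h; simp
    · simp [h]
  simp only [← (Equiv.funSplitAt a α).symm.sum_comp, hsplit]
  rw [Fintype.sum_prod_type_right, Fintype.sum_prod_type_right, Finset.mul_sum]
  simp

/-- The coordinates are summed out in decreasing rank. -/
theorem sum_prod_le_one_of_adapted [Nonempty α] [LinearOrder ι] {r : E → ι}
    {g : E → (E → α) → ℝ} (hg : ∀ e ω, 0 ≤ g e ω)
    (hadapted : ∀ e f, e ≠ f → r e ≤ r f → ∀ ω c, g e (update ω f c) = g e ω)
    (hsum : ∀ e ω, ∑ c, g e (update ω e c) ≤ 1) :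
    ∑ ω, ∏ e, g e ω ≤ 1 := by
  have hcard : (0 : ℝ) < Fintype.card α := by exact_mod_cast Fintype.card_pos
  have key (s : Finset E) : (Fintype.card α : ℝ) ^ #s * ∑ ω, ∏ e ∈ s, g e ω
      ≤ (Fintype.card α : ℝ) ^ Fintype.card E := by
    induction s using Finset.induction_on_max_value r with
    | empty => simp
    | insert a s ha hmax ih =>
      refine le_trans ?_ ih
      have hs (ω c) : ∏ e ∈ s, g e (update ω a c) = ∏ e ∈ s, g e ω :=
        prod_congr rfl fun e he => hadapted e a (ne_of_mem_of_not_mem he ha) (hmax e he) ω c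
      rw [card_insert_of_notMem ha, pow_succ, mul_assoc, ← sum_sum_update _ a]
      simp only [prod_insert ha, hs, ← Finset.sum_mul]
      gcongr with ω
      exact mul_le_of_le_one_left (prod_nonneg fun e _ => hg e ω) (hsum a ω)
  have huniv := key univ
  rw [card_univ] at huniv
  exact le_of_mul_le_mul_left (huniv.trans_eq (mul_one _).symm) (pow_pos hcard _)

theorem sum_bitWeight_mul_prod (p : E → ℝ) (g : E → Bool → ℝ) :
    ∑ ω : E → Bool, bitWeight p ω * ∏ e, g e (ω e)
      = ∏ e, (p e * g e true + (1 - p e) * g e false) := by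
  simp only [bitWeight, ← prod_mul_distrib]
  calc ∑ ω : E → Bool, ∏ e, (if ω e then p e else 1 - p e) * g e (ω e)
      = ∏ e, ∑ b : Bool, (if b then p e else 1 - p e) * g e b := by
        rw [Finset.prod_univ_sum, Fintype.piFinset_univ]
    _ = _ := by simp

end ProductMeasure

/-- Unlike in Hoeffding's lemma, the exponent is of the order of the variance, which matters for
small `p`. -/
theorem bernoulli_exp_le {p b : ℝ} (hp : 0 ≤ p) (hb : |b| ≤ 1) :
    p * Real.exp (b * (1 - p)) + (1 - p) * Real.exp (b * (0 - p)) ≤ Real.exp (b ^ 2 * p) := by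
  have hfactor : p * Real.exp (b * (1 - p)) + (1 - p) * Real.exp (b * (0 - p))
      = Real.exp (-(b * p)) * (p * (Real.exp b - 1) + 1) := by
    rw [show b * (1 - p) = -(b * p) + b by ring, show b * (0 - p) = -(b * p) by ring, Real.exp_add]
    ring
  have hexp : Real.exp b - 1 - b ≤ b ^ 2 := (abs_le.1 (Real.abs_exp_sub_one_sub_id_le hb)).2
  rw [hfactor]
  calc Real.exp (-(b * p)) * (p * (Real.exp b - 1) + 1)
      ≤ Real.exp (-(b * p)) * Real.exp (p * (Real.exp b - 1)) := by
        gcongr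
        exact Real.add_one_le_exp _
    _ = Real.exp (p * (Real.exp b - 1 - b)) := by rw [← Real.exp_add]; ring_nf
    _ ≤ Real.exp (b ^ 2 * p) := by
      rw [mul_comm _ p]
      gcongr

theorem bernoulli_exp_sub_le_one {p b θ : ℝ} (hp : 0 ≤ p) (hb : |b| ≤ θ) (hθ : θ ≤ 1) :
    p * Real.exp (b * (1 - p) - θ ^ 2 * p) + (1 - p) * Real.exp (b * (0 - p) - θ ^ 2 * p) ≤ 1 := by
  simp only [sub_eq_add_neg _ (θ ^ 2 * p), Real.exp_add, ← mul_assoc, ← add_mul]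
  rw [Real.exp_neg, ← div_eq_mul_inv, div_le_one (Real.exp_pos _)]
  refine (bernoulli_exp_le hp (hb.trans hθ)).trans ?_
  have hsq : b ^ 2 ≤ θ ^ 2 := sq_le_sq' (abs_le.1 hb).1 (abs_le.1 hb).2
  gcongr

section Concentration

variable {E : Type*} [Fintype E] [DecidableEq E] {p : E → ℝ}

theorem sum_bitWeight (p : E → ℝ) : ∑ ω : E → Bool, bitWeight p ω = 1 := by
  simpa using sum_bitWeight_mul_prod p fun _ _ => 1

theorem sum_bitWeight_mul_exp_le (hp : ∀ e, p e ∈ Set.Icc 0 1) (A : Finset E) {θ : ℝ}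
    (hθ : |θ| ≤ 1) :
    ∑ ω : E → Bool, bitWeight p ω * Real.exp (θ * ∑ e ∈ A, (bit (ω e) - p e))
      ≤ Real.exp (θ ^ 2 * ∑ e ∈ A, p e) := by
  simp only [Finset.mul_sum, Real.exp_sum, ← Fintype.prod_ite_mem A]
  rw [sum_bitWeight_mul_prod p fun e b => if e ∈ A then Real.exp (θ * (bit b - p e)) else 1]
  refine prod_le_prod (fun e _ => ?_) fun e _ => ?_
  · exact add_nonneg (mul_nonneg (hp e).1 (by positivity))
      (mul_nonneg (sub_nonneg.2 (hp e).2) (by positivity))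
  · split_ifs
    · simpa [bit] using bernoulli_exp_le (hp e).1 hθ
    · simp

theorem sum_bitWeight_le_of_le_abs (hp : ∀ e, p e ∈ Set.Icc 0 1) (A : Finset E) {θ : ℝ}
    (hθ : θ ∈ Set.Icc 0 1) (t : ℝ) :
    ∑ ω : E → Bool with t ≤ |∑ e ∈ A, (bit (ω e) - p e)|, bitWeight p ω
      ≤ 2 * Real.exp (θ ^ 2 * ∑ e ∈ A, p e - θ * t) := by
  let dev (ω : E → Bool) : ℝ := ∑ e ∈ A, (bit (ω e) - p e)
  have hmarkov (ω) (hω : t ≤ |dev ω|) :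
      1 ≤ Real.exp (-(θ * t)) * (Real.exp (θ * dev ω) + Real.exp (-θ * dev ω)) := by
    rw [mul_add, ← Real.exp_add, ← Real.exp_add]
    rcases le_abs.1 hω with h | h
    · exact (Real.one_le_exp (by nlinarith [hθ.1])).trans (le_add_of_nonneg_right (by positivity))
    · exact (Real.one_le_exp (by nlinarith [hθ.1])).trans (le_add_of_nonneg_left (by positivity))
  have hθ1 : |θ| ≤ 1 := abs_le.2 ⟨by linarith [hθ.1], hθ.2⟩
  have hneg := sum_bitWeight_mul_exp_le hp A (θ := -θ) (by rwa [abs_neg])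
  rw [neg_sq] at hneg
  calc ∑ ω with t ≤ |dev ω|, bitWeight p ω
      ≤ ∑ ω with t ≤ |dev ω|, bitWeight p ω *
          (Real.exp (-(θ * t)) * (Real.exp (θ * dev ω) + Real.exp (-θ * dev ω))) :=
        sum_le_sum fun ω hω => le_mul_of_one_le_right (bitWeight_nonneg hp ω)
          (hmarkov ω (mem_filter.1 hω).2)
    _ ≤ ∑ ω, bitWeight p ω *
          (Real.exp (-(θ * t)) * (Real.exp (θ * dev ω) + Real.exp (-θ * dev ω))) :=
        sum_le_sum_of_subset_of_nonneg (subset_univ _) fun ω _ _ =>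
          mul_nonneg (bitWeight_nonneg hp ω) (by positivity)
    _ = Real.exp (-(θ * t)) * (∑ ω, bitWeight p ω * Real.exp (θ * dev ω)
          + ∑ ω, bitWeight p ω * Real.exp (-θ * dev ω)) := by
        rw [← sum_add_distrib, Finset.mul_sum]
        exact sum_congr rfl fun ω _ => by ring
    _ ≤ Real.exp (-(θ * t)) * (Real.exp (θ ^ 2 * ∑ e ∈ A, p e)
          + Real.exp (θ ^ 2 * ∑ e ∈ A, p e)) :=
        mul_le_mul_of_nonneg_left (add_le_add (sum_bitWeight_mul_exp_le hp A hθ1) hneg)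
          (Real.exp_pos _).le
    _ = 2 * Real.exp (θ ^ 2 * ∑ e ∈ A, p e - θ * t) := by
        rw [sub_eq_add_neg, Real.exp_add]
        ring

end Concentration

theorem sum_bitWeight_mul_exp_predictable_le_one {E ι : Type*} [Fintype E] [DecidableEq E]
    [LinearOrder ι] {r : E → ι} {p : E → ℝ} (hp : ∀ e, p e ∈ Set.Icc 0 1)
    {θ : ℝ} (hθ : θ ≤ 1) {b : E → (E → Bool) → ℝ} (hb : ∀ e ω, |b e ω| ≤ θ)
    (hpredictable : ∀ e f, r e ≤ r f → ∀ ω c, b e (update ω f c) = b e ω) :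
    ∑ ω : E → Bool, bitWeight p ω *
      Real.exp (∑ e, (b e ω * (bit (ω e) - p e) - θ ^ 2 * p e)) ≤ 1 := by
  simp only [bitWeight, Real.exp_sum, ← prod_mul_distrib]
  refine sum_prod_le_one_of_adapted (r := r) (fun e ω => ?_) (fun e f hne hef ω c => ?_)
    fun e ω => ?_
  · exact mul_nonneg (ite_bit_nonneg (hp e) _) (Real.exp_pos _).le
  · rw [hpredictable e f hef, update_of_ne hne]
  · simpa [hpredictable e e le_rfl ω, bit] using bernoulli_exp_sub_le_one (hp e).1 (hb e ω) hθ

theorem prod_sub_prod_ordered {E ι R : Type*} [CommRing R] [LinearOrder ι] {r : E → ι}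
    (hr : Injective r) (F : Finset E) (x p : E → R) :
    ∏ e ∈ F, x e - ∏ e ∈ F, p e = ∑ e ∈ F, (x e - p e) *
      ((∏ f ∈ F with r f < r e, x f) * ∏ f ∈ F with r e < r f, p f) := by
  classical
  let : LinearOrder E := LinearOrder.lift' r hr
  have h := Finset.prod_add_ordered F p (fun e => x e - p e)
  simp only [add_sub_cancel] at h
  rw [h, add_sub_cancel_left]
  exact sum_congr rfl fun e _ => mul_assoc _ _ _

/-- The entropy inequality of Donsker and Varadhan, for the uniform measure on `A` against the
weights `P`. -/
theorem average_le_of_sum_exp_le {Ω : Type*} [Fintype Ω] {A : Finset Ω} (hA : A.Nonempty)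
    {P f : Ω → ℝ} (hP : ∀ ω, 0 ≤ P ω) {K : ℝ}
    (hK : ∀ ω ∈ A, 1 / (#A : ℝ) ≤ Real.exp K * P ω)
    (hf : ∑ ω, P ω * Real.exp (f ω) ≤ 1) :
    (∑ ω ∈ A, f ω) / #A ≤ K := by
  have hc : (0 : ℝ) < #A := by exact_mod_cast hA.card_pos
  have hJensen := convexOn_exp.map_sum_le (t := A) (w := fun _ => 1 / (#A : ℝ)) (p := f)
    (fun _ _ => by positivity) (by simp [hc.ne']) (fun _ _ => Set.mem_univ _)
  simp only [smul_eq_mul] at hJensen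
  rw [div_eq_inv_mul, ← one_div, Finset.mul_sum, ← Real.exp_le_exp]
  calc Real.exp (∑ ω ∈ A, 1 / (#A : ℝ) * f ω)
      ≤ ∑ ω ∈ A, 1 / (#A : ℝ) * Real.exp (f ω) := hJensen
    _ ≤ ∑ ω ∈ A, Real.exp K * (P ω * Real.exp (f ω)) := by
        refine sum_le_sum fun ω hω => ?_
        rw [← mul_assoc]
        exact mul_le_mul_of_nonneg_right (hK ω hω) (Real.exp_pos _).le
    _ ≤ ∑ ω, Real.exp K * (P ω * Real.exp (f ω)) :=
        sum_le_sum_of_subset_of_nonneg (subset_univ _) fun ω _ _ =>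
          mul_nonneg (Real.exp_pos _).le (mul_nonneg (hP ω) (Real.exp_pos _).le)
    _ ≤ Real.exp K := by
        rw [← Finset.mul_sum]
        exact mul_le_of_le_one_right (Real.exp_pos _).le hf

/-- The coefficients may exceed `θ` off `A`, where they are replaced by `0`; this preserves
predictability. -/
theorem average_predictable_le {E ι : Type*} [Fintype E] [DecidableEq E] [LinearOrder ι]
    {r : E → ι} {p : E → ℝ} (hp : ∀ e, p e ∈ Set.Icc 0 1) {A : Finset (E → Bool)}
    (hA : A.Nonempty) {K : ℝ} (hK : ∀ ω ∈ A, 1 / (#A : ℝ) ≤ Real.exp K * bitWeight p ω)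
    {θ : ℝ} (hθ : θ ∈ Set.Icc 0 1) {b : E → (E → Bool) → ℝ} (hb : ∀ ω ∈ A, ∀ e, |b e ω| ≤ θ)
    (hpredictable : ∀ e f, r e ≤ r f → ∀ ω c, b e (update ω f c) = b e ω) :
    (∑ ω ∈ A, ∑ e, b e ω * (bit (ω e) - p e)) / #A ≤ K + θ ^ 2 * ∑ e, p e := by
  have hcard : (#A : ℝ) ≠ 0 := by exact_mod_cast hA.card_ne_zero
  let b' (e : E) (ω : E → Bool) : ℝ := if |b e ω| ≤ θ then b e ω else 0
  have hb' (e : E) (ω : E → Bool) : |b' e ω| ≤ θ := by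
    unfold b'
    split_ifs with hle
    exacts [hle, abs_zero.trans_le hθ.1]
  have haverage := average_le_of_sum_exp_le hA (bitWeight_nonneg hp) hK
    (sum_bitWeight_mul_exp_predictable_le_one (r := r) hp hθ.2 hb' fun e f hef ω c => by
      simp only [b', hpredictable e f hef])
  have hsum : ∀ ω ∈ A, ∑ e, (b' e ω * (bit (ω e) - p e) - θ ^ 2 * p e)
      = ∑ e, b e ω * (bit (ω e) - p e) - θ ^ 2 * ∑ e, p e := fun ω hω => by
    simp only [sum_sub_distrib, Finset.mul_sum, b', if_pos (hb ω hω _)]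
  rwa [sum_congr rfl hsum, sum_sub_distrib, sum_const, nsmul_eq_mul, sub_div,
    mul_div_cancel_left₀ _ hcard, sub_le_iff_le_add] at haverage

section StrictErdosGallai

open MeasureTheory

variable {n : ℕ}

theorem card_filter_top {m : ℕ} (hm : m ≤ n) : #{i : Fin n | n - m ≤ (i : ℕ)} = m := by
  have h := card_filter_add_card_filter_not (s := (univ : Finset (Fin n)))
    fun i : Fin n => (i : ℕ) < n - m
  rw [Fin.card_filter_val_lt] at h
  simp only [not_lt, card_univ, Fintype.card_fin] at h
  omega

theorem sum_mul_le_sum_top {h w : Fin n → ℝ} (hh : Monotone h) (hw : ∀ i, w i ∈ Set.Icc 0 1)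
    {m : ℕ} (hs : ∑ i, w i = m) :
    ∑ i, w i * h i ≤ ∑ i ∈ univ.filter fun i : Fin n => n - m ≤ (i : ℕ), h i := by
  have hm : m ≤ n := by
    have : (m : ℝ) ≤ ∑ _i : Fin n, 1 := hs ▸ sum_le_sum fun i _ => (hw i).2
    simpa using this
  rcases Nat.eq_zero_or_pos m with rfl | hpos
  · have hw0 (i) : w i = 0 :=
      (sum_eq_zero_iff_of_nonneg fun i _ => (hw i).1).1 (by simpa using hs) i (mem_univ i)
    have hempty : ({i : Fin n | n - 0 ≤ (i : ℕ)} : Finset (Fin n)) = ∅ := by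
      simp [filter_eq_empty_iff]
    rw [hempty]
    simp [hw0]
  · set c := h ⟨n - m, by omega⟩
    have hterm (i : Fin n) : w i * h i - (if n - m ≤ (i : ℕ) then h i else 0)
        ≤ c * (w i - if n - m ≤ (i : ℕ) then 1 else 0) := by
      obtain ⟨hw0, hw1⟩ := hw i
      split_ifs with hi
      · have : c ≤ h i := hh (by simpa [Fin.le_def] using hi)
        nlinarith
      · have : h i ≤ c := hh (by simp only [Fin.le_def]; omega)
        nlinarith
    have hsum := sum_le_sum fun i (_ : i ∈ univ) => hterm i
    rw [sum_sub_distrib, ← Finset.mul_sum, sum_sub_distrib, hs, ← sum_filter, ← sum_filter,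
      sum_const, card_filter_top hm] at hsum
    simpa using hsum

theorem sum_le_sum_top {h : Fin n → ℝ} (hh : Monotone h) (A : Finset (Fin n)) :
    ∑ i ∈ A, h i ≤ ∑ i ∈ univ.filter fun i : Fin n => n - #A ≤ (i : ℕ), h i := by
  have hA := sum_mul_le_sum_top hh (w := fun i => if i ∈ A then 1 else 0)
    (fun i => by split_ifs <;> simp) (m := #A) (by simp)
  simpa using hA

variable {D : Fin n → ℕ}

theorem StrictErdosGallai.sum_add_one_le (hD : StrictErdosGallai D) (hmono : Monotone D)
    {A : Finset (Fin n)} (hA : A.Nonempty) :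
    (∑ i ∈ A, (D i : ℝ)) + 1 ≤ #A * ((#A : ℝ) - 1) + ∑ i ∈ Aᶜ, min (#A : ℝ) (D i) := by
  set m := #A
  have hm : 1 ≤ m := hA.card_pos
  set top : Finset (Fin n) := {i | n - m ≤ (i : ℕ)}
  have htop : (∑ i ∈ top, (D i : ℝ)) + 1
      ≤ m * ((m : ℝ) - 1) + ∑ i ∈ topᶜ, min (m : ℝ) (D i) := by
    have hlt := hD m hm (by simpa using card_le_univ A)
    have hcompl : ({i : Fin n | (i : ℕ) < n - m} : Finset (Fin n)) = topᶜ := by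
      ext i; simp only [top, mem_filter_univ, mem_compl, not_le]
    rw [hcompl, Nat.lt_iff_add_one_le, ← Nat.cast_le (α := ℝ)] at hlt
    push_cast [Nat.cast_sub hm] at hlt
    exact hlt
  have hmin_mono : Monotone fun i => (D i : ℝ) + min (m : ℝ) (D i) := fun i j hij => by
    have : (D i : ℝ) ≤ D j := by exact_mod_cast hmono hij
    dsimp only
    gcongr
  have hA_top : ∑ i ∈ A, ((D i : ℝ) + min (m : ℝ) (D i))
      ≤ ∑ i ∈ top, ((D i : ℝ) + min (m : ℝ) (D i)) := sum_le_sum_top hmin_mono A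
  rw [sum_add_distrib, sum_add_distrib] at hA_top
  linarith [sum_add_sum_compl A fun i => min (m : ℝ) (D i),
    sum_add_sum_compl top fun i => min (m : ℝ) (D i)]

theorem StrictErdosGallai.cut_inequality (hD : StrictErdosGallai D) (hmono : Monotone D)
    (hpos : ∀ i, 1 ≤ D i) {A B : Finset (Fin n)} (hAB : Disjoint A B) (hne : (A ∪ B).Nonempty) :
    (∑ i ∈ A, (D i : ℝ)) + 1 ≤ #A * ((#Bᶜ : ℝ) - 1) + ∑ i ∈ B, (D i : ℝ) := by
  rcases A.eq_empty_or_nonempty with rfl | hA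
  · rw [empty_union] at hne
    obtain ⟨b, hb⟩ := hne
    have hDb : (1 : ℝ) ≤ D b := by exact_mod_cast hpos b
    simpa using hDb.trans (single_le_sum (f := fun i => (D i : ℝ)) (fun i _ => by positivity) hb)
  · have hsub : B ⊆ Aᶜ := subset_compl_iff_disjoint_left.2 hAB
    have hcard : (#(Aᶜ \ B) : ℝ) = #Bᶜ - #A := by
      rw [show Aᶜ \ B = Bᶜ \ A by ext; simp [and_comm],
        cast_card_sdiff (subset_compl_iff_disjoint_right.2 hAB)]
    have hrest : ∑ i ∈ Aᶜ \ B, min (#A : ℝ) (D i) ≤ (#Bᶜ - #A) * #A := by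
      rw [← hcard, ← nsmul_eq_mul]
      exact sum_le_card_nsmul _ _ _ fun i _ => min_le_left _ _
    have hB : ∑ i ∈ B, min (#A : ℝ) (D i) ≤ ∑ i ∈ B, (D i : ℝ) :=
      sum_le_sum fun i _ => min_le_right _ _
    have hEG := hD.sum_add_one_le hmono hA
    rw [← sum_sdiff hsub] at hEG
    linarith

theorem sum_offDiag_ite_mem {V : Type*} [Fintype V] [DecidableEq V] {A C : Finset V}
    (hAC : A ⊆ C) :
    ∑ i, ∑ j with j ≠ i, (if i ∈ A ∧ j ∈ C then (1 : ℝ) else 0) = #A * ((#C : ℝ) - 1) := by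
  have hrow (i : V) : ∑ j with j ≠ i, (if i ∈ A ∧ j ∈ C then (1 : ℝ) else 0)
      = if i ∈ A then (#C : ℝ) - 1 else 0 := by
    by_cases hi : i ∈ A
    · have hfilter : ({j | j ≠ i ∧ j ∈ C} : Finset V) = C.erase i := by ext j; simp
      simp only [hi, true_and, if_true]
      rw [sum_boole, filter_filter, hfilter, cast_card_erase_of_mem (hAC hi)]
    · simp [hi]
  simp only [hrow, sum_ite_mem, univ_inter, sum_const, nsmul_eq_mul]

/-- The level-`t` slice of `StrictErdosGallai.two_mul_abs_le`: the cut inequality for the sets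
`{i | t < l i}` and `{i | l i ≤ -t}`. -/
theorem StrictErdosGallai.indicator_le (hD : StrictErdosGallai D) (hmono : Monotone D)
    (hpos : ∀ i, 1 ≤ D i) (l : Fin n → ℝ) (o : Fin n) (t : ℝ) :
    (Set.Ioo 0 |l o|).indicator (1 : ℝ → ℝ) t ≤
      (∑ i, ∑ j with j ≠ i, (Set.Ioo (max (-l j) 0) (l i)).indicator (1 : ℝ → ℝ) t)
      - ∑ i, (D i : ℝ) * ((Set.Ioo 0 (l i)).indicator (1 : ℝ → ℝ) t
          - (Set.Ioc 0 (-l i)).indicator (1 : ℝ → ℝ) t) := by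
  rcases le_or_gt t 0 with ht | ht
  · simp [ht.not_gt]
  set A : Finset (Fin n) := {i | t < l i}
  set B : Finset (Fin n) := {i | l i ≤ -t}
  have hdisj : Disjoint A B := disjoint_filter.2 fun i _ hA hB => by linarith
  have hpair (i j) : (Set.Ioo (max (-l j) 0) (l i)).indicator (1 : ℝ → ℝ) t
      = if i ∈ A ∧ j ∈ Bᶜ then 1 else 0 := by
    simp [A, B, Set.indicator_apply, ht, neg_lt, and_comm]
  have hplus (i) : (Set.Ioo 0 (l i)).indicator (1 : ℝ → ℝ) t = if i ∈ A then 1 else 0 := by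
    simp [A, Set.indicator_apply, ht]
  have hminus (i) : (Set.Ioc 0 (-l i)).indicator (1 : ℝ → ℝ) t = if i ∈ B then 1 else 0 := by
    simp [B, Set.indicator_apply, ht, le_neg]
  have habs : (Set.Ioo 0 |l o|).indicator (1 : ℝ → ℝ) t ≤ if o ∈ A ∪ B then 1 else 0 := by
    by_cases h : t < |l o|
    · have hmem : o ∈ A ∪ B := by
        simp only [A, B, mem_union, mem_filter_univ]
        exact (lt_abs.1 h).imp_right fun h => by linarith
      simp [ht, h, hmem]
    · simp only [Set.indicator_apply, Set.mem_Ioo, h, and_false, if_false]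
      split_ifs <;> norm_num
  simp only [hpair, hplus, hminus, sum_offDiag_ite_mem (subset_compl_iff_disjoint_right.2 hdisj),
    mul_sub, mul_ite, mul_one, mul_zero, sum_sub_distrib, sum_ite_mem, univ_inter]
  refine habs.trans ?_
  split_ifs with ho
  · linarith [hD.cut_inequality hmono hpos hdisj ⟨o, ho⟩]
  · by_cases hne : (A ∪ B).Nonempty
    · linarith [hD.cut_inequality hmono hpos hdisj hne]
    · rw [not_nonempty_iff_eq_empty, union_eq_empty] at hne
      simp [hne.1, hne.2]

theorem posPart_add_eq (x y : ℝ) :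
    max (x + y) 0 = max (x - max (-y) 0) 0 + max (y - max (-x) 0) 0 := by
  grind

theorem sum_offDiag_comm {V R : Type*} [Fintype V] [DecidableEq V] [AddCommMonoid R]
    (f : V → V → R) : ∑ i, ∑ j with j ≠ i, f i j = ∑ i, ∑ j with j ≠ i, f j i := by
  simp only [sum_filter]
  rw [sum_comm]
  simp only [ne_comm]

theorem integrable_indicator_one {s : Set ℝ} (hs : MeasurableSet s) (hfin : volume s ≠ ⊤) :
    Integrable (s.indicator (1 : ℝ → ℝ)) :=
  (integrable_indicator_iff hs).2 (integrableOn_const hfin)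

/-- The integral over `t` of `StrictErdosGallai.indicator_le`. -/
theorem StrictErdosGallai.two_mul_abs_le (hD : StrictErdosGallai D) (hmono : Monotone D)
    (hpos : ∀ i, 1 ≤ D i) (l : Fin n → ℝ) (o : Fin n) :
    2 * |l o| ≤ (∑ i, ∑ j with j ≠ i, max (l i + l j) 0) - 2 * ∑ i, (D i : ℝ) * l i := by
  have hIoo (a b : ℝ) : Integrable ((Set.Ioo a b).indicator (1 : ℝ → ℝ)) :=
    integrable_indicator_one measurableSet_Ioo (by simp)
  have hIoc (a b : ℝ) : Integrable ((Set.Ioc a b).indicator (1 : ℝ → ℝ)) :=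
    integrable_indicator_one measurableSet_Ioc (by simp)
  have hpair := integrable_finsetSum univ fun (i : Fin n) _ =>
    integrable_finsetSum {j | j ≠ i} fun j _ => hIoo (max (-l j) 0) (l i)
  have hlin (i) : Integrable fun t => (D i : ℝ) * ((Set.Ioo 0 (l i)).indicator (1 : ℝ → ℝ) t
      - (Set.Ioc 0 (-l i)).indicator (1 : ℝ → ℝ) t) :=
    ((hIoo _ _).sub (hIoc _ _)).const_mul _
  have hlin_sum := integrable_finsetSum univ fun (i : Fin n) _ => hlin i
  have hlin_integral (i) : ∫ t, (D i : ℝ) * ((Set.Ioo 0 (l i)).indicator (1 : ℝ → ℝ) t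
      - (Set.Ioc 0 (-l i)).indicator (1 : ℝ → ℝ) t) = D i * l i := by
    rw [integral_const_mul, integral_sub (hIoo _ _) (hIoc _ _),
      integral_indicator_one measurableSet_Ioo, integral_indicator_one measurableSet_Ioc,
      Real.volume_real_Ioo, Real.volume_real_Ioc, sub_zero, sub_zero,
      max_zero_sub_max_neg_zero_eq_self]
  have hslice := integral_mono (hIoo 0 |l o|) (hpair.sub hlin_sum) (hD.indicator_le hmono hpos l o)
  simp only [Pi.sub_apply] at hslice
  rw [integral_sub hpair hlin_sum, integral_finsetSum _ fun i _ => hlin i,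
    integral_finsetSum _ fun i _ => integrable_finsetSum _ fun j _ => hIoo _ _] at hslice
  simp only [hlin_integral, integral_finsetSum _ fun _ _ => hIoo _ _,
    integral_indicator_one measurableSet_Ioo, Real.volume_real_Ioo, sub_zero,
    max_eq_left (abs_nonneg (l o))] at hslice
  have hsplit : ∑ i, ∑ j with j ≠ i, max (l i + l j) 0
      = 2 * ∑ i, ∑ j with j ≠ i, max (l i - max (-l j) 0) 0 := by
    simp only [posPart_add_eq, sum_add_distrib]
    rw [sum_offDiag_comm fun i j => max (l j - max (-l i) 0) 0, two_mul]
  linarith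

end StrictErdosGallai

section Softplus

open Real InformationTheory

/-- The log-partition function of a Bernoulli variable with log-odds `t`. -/
noncomputable def softplus (t : ℝ) : ℝ := log (1 + exp t)

theorem max_zero_le_softplus (t : ℝ) : max t 0 ≤ softplus t := by
  have := exp_pos t
  apply max_le
  · rw [softplus, le_log_iff_exp_le (by positivity)]
    linarith
  · exact log_nonneg (by linarith)

theorem sigmoid_eq_exp_div (t : ℝ) : sigmoid t = exp t / (1 + exp t) := by
  rw [sigmoid_def, exp_neg]
  field_simp
  ring

theorem hasDerivAt_softplus (t : ℝ) : HasDerivAt softplus (sigmoid t) t := by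
  rw [sigmoid_eq_exp_div]
  exact ((hasDerivAt_exp t).const_add 1).log (by positivity)

theorem continuous_softplus : Continuous softplus :=
  continuous_iff_continuousAt.2 fun t => (hasDerivAt_softplus t).continuousAt

theorem log_sigmoid (t : ℝ) : log (sigmoid t) = t - softplus t := by
  rw [sigmoid_eq_exp_div, log_div (by positivity) (by positivity), log_exp, softplus]

theorem log_one_sub_sigmoid (t : ℝ) : log (1 - sigmoid t) = -softplus t := by
  rw [← sigmoid_neg, sigmoid_def, neg_neg, log_inv, softplus]

theorem negMulLog_add_mul_klFun (x : ℝ) {p : ℝ} (hp : 0 < p) :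
    negMulLog x + p * klFun (x / p) = p - x - x * log p := by
  rcases eq_or_ne x 0 with rfl | hx
  · simp [klFun_zero]
  · rw [negMulLog, klFun, log_div hx hp.ne']
    field_simp
    ring

/-- The second summand on the left is the relative entropy of a Bernoulli variable with mean `x`
with respect to one with log-odds `t`. -/
theorem binEntropy_add_klFun (x t : ℝ) :
    binEntropy x + (sigmoid t * klFun (x / sigmoid t)
      + (1 - sigmoid t) * klFun ((1 - x) / (1 - sigmoid t))) = softplus t - x * t := by
  have h := negMulLog_add_mul_klFun x (sigmoid_pos t)
  have h' := negMulLog_add_mul_klFun (1 - x) (sub_pos.2 (sigmoid_lt_one t))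
  rw [log_sigmoid] at h
  rw [log_one_sub_sigmoid] at h'
  rw [binEntropy_eq_negMulLog_add_negMulLog_one_sub]
  linarith

theorem binEntropy_le_softplus_sub {x : ℝ} (hx : x ∈ Set.Icc 0 1) (t : ℝ) :
    binEntropy x ≤ softplus t - x * t := by
  have hσ := sigmoid_pos t
  have hσ' := sub_pos.2 (sigmoid_lt_one t)
  have := mul_nonneg hσ.le (klFun_nonneg (div_nonneg hx.1 hσ.le))
  have := mul_nonneg hσ'.le (klFun_nonneg (div_nonneg (sub_nonneg.2 hx.2) hσ'.le))
  linarith [binEntropy_add_klFun x t]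

theorem eq_sigmoid_of_binEntropy_eq {x t : ℝ} (hx : x ∈ Set.Icc 0 1)
    (h : binEntropy x = softplus t - x * t) : x = sigmoid t := by
  have hσ := sigmoid_pos t
  have hσ' := sub_pos.2 (sigmoid_lt_one t)
  have h₀ := mul_nonneg hσ.le (klFun_nonneg (div_nonneg hx.1 hσ.le))
  have h₁ := mul_nonneg hσ'.le (klFun_nonneg (div_nonneg (sub_nonneg.2 hx.2) hσ'.le))
  have hzero : sigmoid t * klFun (x / sigmoid t) = 0 := by linarith [binEntropy_add_klFun x t]
  have hdiv := (klFun_eq_zero_iff (div_nonneg hx.1 hσ.le)).1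
    ((mul_eq_zero.1 hzero).resolve_left hσ.ne')
  exact (div_eq_one_iff_eq hσ.ne').1 hdiv

theorem binEntropy_sigmoid (t : ℝ) :
    binEntropy (sigmoid t) = softplus t - sigmoid t * t := by
  have h := binEntropy_add_klFun (sigmoid t) t
  rw [div_self (sigmoid_pos t).ne', div_self (sub_pos.2 (sigmoid_lt_one t)).ne', klFun_one] at h
  linarith

end Softplus

section MaximumEntropy

open Real

variable {n : ℕ} {D : Fin n → ℕ} {l : Fin n → ℝ}

/-- The vector `l` is a dual solution: the edge probabilities `sigmoid (l i + l j)` have expected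
degrees `D`. -/
def IsDual (D : Fin n → ℕ) (l : Fin n → ℝ) : Prop :=
  ∀ i, ∑ j with j ≠ i, sigmoid (l i + l j) = D i

/-- Twice the Lagrange dual of entropy maximization over the polytope of `D`. Its critical points
are the dual solutions. -/
noncomputable def dualObjective (D : Fin n → ℕ) (l : Fin n → ℝ) : ℝ :=
  (∑ i, ∑ j with j ≠ i, softplus (l i + l j)) - 2 * ∑ i, (D i : ℝ) * l i

theorem continuous_dualObjective (D : Fin n → ℕ) : Continuous (dualObjective D) := by
  have := continuous_softplus
  unfold dualObjective
  fun_prop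

theorem StrictErdosGallai.norm_le_dualObjective (hD : StrictErdosGallai D) (hmono : Monotone D)
    (hpos : ∀ i, 1 ≤ D i) (l : Fin n → ℝ) : ‖l‖ ≤ dualObjective D l := by
  have hsoft : (∑ i, ∑ j with j ≠ i, max (l i + l j) 0)
      ≤ ∑ i, ∑ j with j ≠ i, softplus (l i + l j) :=
    sum_le_sum fun i _ => sum_le_sum fun j _ => max_zero_le_softplus _
  rcases isEmpty_or_nonempty (Fin n) with _ | ⟨⟨o⟩⟩
  · simp [Subsingleton.elim l 0, dualObjective]
  · have habs (o) : |l o| ≤ dualObjective D l := by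
      have := hD.two_mul_abs_le hmono hpos l o
      have := abs_nonneg (l o)
      unfold dualObjective
      linarith
    exact (pi_norm_le_iff_of_nonneg ((abs_nonneg _).trans (habs o))).2 habs

theorem hasDerivAt_dualObjective (D : Fin n → ℕ) (l v : Fin n → ℝ) :
    HasDerivAt (fun t : ℝ => dualObjective D (l + t • v))
      (2 * ∑ i, (∑ j with j ≠ i, sigmoid (l i + l j) - D i) * v i) 0 := by
  have hline (i) : HasDerivAt (fun t : ℝ => (l + t • v) i) (v i) 0 := by
    simpa using ((hasDerivAt_id (0 : ℝ)).mul_const (v i)).const_add (l i)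
  have hsoft (i j) : HasDerivAt (fun t : ℝ => softplus ((l + t • v) i + (l + t • v) j))
      (sigmoid (l i + l j) * (v i + v j)) 0 := by
    refine HasDerivAt.comp (h₂ := softplus) (0 : ℝ) ?_ ((hline i).add (hline j))
    simpa using hasDerivAt_softplus (l i + l j)
  have hderiv := (HasDerivAt.fun_sum fun i (_ : i ∈ univ) =>
    HasDerivAt.fun_sum fun j (_ : j ∈ ({j | j ≠ i} : Finset (Fin n))) => hsoft i j).sub
      ((HasDerivAt.fun_sum fun i (_ : i ∈ univ) => (hline i).const_mul (D i : ℝ)).const_mul 2)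
  refine hderiv.congr_deriv ?_
  simp only [mul_add, sum_add_distrib, sub_mul, sum_sub_distrib, Finset.sum_mul]
  rw [sum_offDiag_comm fun i j => sigmoid (l i + l j) * v j]
  simp only [fun i j => add_comm (l i) (l j)]
  ring

theorem StrictErdosGallai.exists_isDual (hD : StrictErdosGallai D) (hmono : Monotone D)
    (hpos : ∀ i, 1 ≤ D i) : ∃ l, IsDual D l := by
  obtain ⟨l, hl⟩ := (continuous_dualObjective D).exists_forall_le
    (Filter.tendsto_atTop_mono (hD.norm_le_dualObjective hmono hpos)
      (tendsto_norm_cocompact_atTop (E := Fin n → ℝ)))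
  refine ⟨l, fun i => ?_⟩
  have hmin : IsLocalMin (fun t : ℝ => dualObjective D (l + t • Pi.single i 1)) 0 :=
    .of_forall fun t => by simpa using hl (l + t • Pi.single i 1)
  have hcrit := hmin.hasDerivAt_eq_zero (hasDerivAt_dualObjective D l (Pi.single i 1))
  simpa [Pi.single_apply, sub_eq_zero] using hcrit

theorem sum_lt_mul_add {ι : Type*} [Fintype ι] [LinearOrder ι] {x : ι → ι → ℝ}
    (hx : ∀ i j, x i j = x j i) (l : ι → ℝ) :
    ∑ i, ∑ j with i < j, x i j * (l i + l j) = ∑ i, (∑ j with j ≠ i, x i j) * l i := by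
  have hsplit (i) : (∑ j with j ≠ i, x i j) * l i
      = ∑ j with i < j, x i j * l i + ∑ j with j < i, x i j * l i := by
    rw [Finset.sum_mul, ← sum_union (disjoint_filter.2 fun _ _ h h' => h.asymm h'), ← filter_or]
    simp only [lt_or_lt_iff_ne, ne_comm]
  simp only [hsplit, sum_add_distrib, mul_add]
  congr 1
  simp only [sum_filter]
  rw [sum_comm]
  simp only [hx]

theorem sum_softplus_sub_of_mem_polytope {x : Fin n → Fin n → ℝ} (hx : x ∈ polytope D) :
    ∑ i, ∑ j with i < j, (softplus (l i + l j) - x i j * (l i + l j))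
      = (∑ i, ∑ j with i < j, softplus (l i + l j)) - ∑ i, (D i : ℝ) * l i := by
  simp only [sum_sub_distrib, sum_lt_mul_add hx.1, hx.2.2.2]

/-- The edge probabilities attached to the dual vector `l`, with zero diagonal as required in the
polytope. -/
noncomputable def dualProb (l : Fin n → ℝ) (i j : Fin n) : ℝ :=
  if i = j then 0 else sigmoid (l i + l j)

theorem dualProb_of_ne (l : Fin n → ℝ) {i j : Fin n} (h : i ≠ j) :
    dualProb l i j = sigmoid (l i + l j) :=
  if_neg h

theorem dualProb_self (l : Fin n → ℝ) (i : Fin n) : dualProb l i i = 0 :=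
  if_pos rfl

theorem dualProb_comm (l : Fin n → ℝ) (i j : Fin n) : dualProb l i j = dualProb l j i := by
  simp only [dualProb, eq_comm (a := i), add_comm (l i)]

theorem dualProb_mem_Icc (l : Fin n → ℝ) (i j : Fin n) : dualProb l i j ∈ Set.Icc 0 1 := by
  unfold dualProb
  split_ifs
  exacts [⟨le_rfl, zero_le_one⟩, ⟨sigmoid_nonneg _, sigmoid_le_one _⟩]

theorem IsDual.dualProb_mem_polytope (hl : IsDual D l) : dualProb l ∈ polytope D := by
  refine ⟨dualProb_comm l, dualProb_self l, dualProb_mem_Icc l, fun i => ?_⟩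
  rw [← hl i]
  exact sum_congr rfl fun j hj => dualProb_of_ne l (mem_filter_univ j |>.1 hj).symm

theorem entropy_dualProb (l : Fin n → ℝ) : entropy (dualProb l)
    = ∑ i, ∑ j with i < j, (softplus (l i + l j) - dualProb l i j * (l i + l j)) := by
  refine sum_congr rfl fun i _ => sum_congr rfl fun j hj => ?_
  rw [dualProb_of_ne l (mem_filter_univ j |>.1 hj).ne, binEntropy_sigmoid]

theorem IsDual.entropy_le (hl : IsDual D l) {x : Fin n → Fin n → ℝ} (hx : x ∈ polytope D) :
    entropy x ≤ entropy (dualProb l) := by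
  rw [entropy_dualProb, sum_softplus_sub_of_mem_polytope hl.dualProb_mem_polytope,
    ← sum_softplus_sub_of_mem_polytope hx]
  exact sum_le_sum fun i _ => sum_le_sum fun j _ => binEntropy_le_softplus_sub (hx.2.2.1 i j) _

theorem IsDual.eq_dualProb_of_entropy_eq (hl : IsDual D l) {x : Fin n → Fin n → ℝ}
    (hx : x ∈ polytope D) (h : entropy x = entropy (dualProb l)) : x = dualProb l := by
  have hp := hl.dualProb_mem_polytope
  rw [entropy_dualProb, sum_softplus_sub_of_mem_polytope hp,
    ← sum_softplus_sub_of_mem_polytope hx] at h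
  have hle (i j) := binEntropy_le_softplus_sub (hx.2.2.1 i j) (l i + l j)
  have hlt {i j} (hij : i < j) : x i j = dualProb l i j := by
    have hrow := (sum_eq_sum_iff_of_le fun i _ => sum_le_sum fun j _ => hle i j).1 h i (mem_univ i)
    have hentry := (sum_eq_sum_iff_of_le fun j _ => hle i j).1 hrow j (mem_filter_univ j |>.2 hij)
    rw [eq_sigmoid_of_binEntropy_eq (hx.2.2.1 i j) hentry, dualProb_of_ne l hij.ne]
  funext i j
  rcases lt_trichotomy i j with hij | rfl | hij
  · exact hlt hij
  · rw [hx.2.1, hp.2.1]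
  · rw [hx.1, hp.1, hlt hij]

theorem IsDual.maxEntropy_eq (hl : IsDual D l) : maxEntropy D = dualProb l := by
  have hp := hl.dualProb_mem_polytope
  have hex : ∃ p, IsMaxEntropy D p := ⟨dualProb l, hp, fun x hx => hl.entropy_le hx⟩
  obtain ⟨hq, hq_max⟩ := hex.choose_spec
  rw [maxEntropy, dif_pos hex]
  exact hl.eq_dualProb_of_entropy_eq hq ((hl.entropy_le hq).antisymm (hq_max _ hp))

end MaximumEntropy

section DualBound

open Real

theorem sigmoid_le_exp (t : ℝ) : sigmoid t ≤ exp t := by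
  rw [sigmoid_eq_exp_div]
  have := exp_pos t
  exact div_le_self this.le (by linarith)

theorem one_sub_sigmoid_le_exp_neg (t : ℝ) : 1 - sigmoid t ≤ exp (-t) := by
  rw [← sigmoid_neg]
  exact sigmoid_le_exp _

theorem neg_mul_log_le_of_le_sigmoid {x t : ℝ} {k : ℕ} (hx : 0 < x)
    (h : 1 / x ^ k ≤ sigmoid t) : -(k * log x) ≤ t := by
  have hexp := h.trans (sigmoid_le_exp t)
  rw [← log_le_iff_le_exp (by positivity)] at hexp
  simpa [log_pow] using hexp

theorem le_mul_log_of_le_one_sub_sigmoid {x t : ℝ} {k : ℕ} (hx : 0 < x)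
    (h : 1 / x ^ k ≤ 1 - sigmoid t) : t ≤ k * log x := by
  rw [← sigmoid_neg] at h
  linarith [neg_mul_log_le_of_le_sigmoid hx h]

variable {n : ℕ} {D : Fin n → ℕ} {l : Fin n → ℝ}

theorem IsDual.sum_dualProb (hl : IsDual D l) (i : Fin n) : ∑ j, dualProb l i j = D i := by
  rw [← hl i, sum_filter]
  exact sum_congr rfl fun j _ => by simp only [dualProb, ne_comm (a := j), ite_not]

theorem IsDual.add_one_le (hl : IsDual D l) (i : Fin n) : D i + 1 ≤ n := by
  have hle : (D i : ℝ) ≤ #(univ.erase i) := by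
    rw [← hl i, filter_ne']
    simpa using sum_le_card_nsmul (univ.erase i) _ 1 fun j _ => sigmoid_le_one (l i + l j)
  rw [Nat.cast_le, card_erase_of_mem (mem_univ i), card_fin] at hle
  have := i.pos
  omega

theorem IsDual.exists_inv_le (hl : IsDual D l) (hpos : ∀ i, 1 ≤ D i) (i : Fin n) :
    ∃ j, j ≠ i ∧ 1 / (n : ℝ) ≤ sigmoid (l i + l j) := by
  have hn : (0 : ℝ) < n := by exact_mod_cast i.pos
  have hsum : ∑ _j : Fin n, 1 / (n : ℝ) ≤ ∑ j, dualProb l i j := by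
    rw [hl.sum_dualProb, sum_const, card_fin, nsmul_eq_mul, mul_one_div_cancel hn.ne']
    exact_mod_cast hpos i
  obtain ⟨j, -, hj⟩ := exists_le_of_sum_le ⟨i, mem_univ i⟩ hsum
  have hji : j ≠ i := by
    rintro rfl
    rw [dualProb_self] at hj
    exact hj.not_gt (by positivity)
  exact ⟨j, hji, dualProb_of_ne l hji.symm ▸ hj⟩

/-- Rows `e` and `h` of the dual probabilities are compared entry by entry after exchanging the
coordinates `e` and `h`, which aligns their zero entries. -/
theorem IsDual.sub_eq_sum_swap (hl : IsDual D l) (h e : Fin n) :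
    (D h : ℝ) - D e = ∑ v, (dualProb l h (Equiv.swap h e v) - dualProb l e v) := by
  rw [sum_sub_distrib, hl.sum_dualProb, Equiv.sum_comp (Equiv.swap h e), hl.sum_dualProb]

theorem dualProb_le_dualProb_swap {e h : Fin n} (hle : l e ≤ l h) (v : Fin n) :
    dualProb l e v ≤ dualProb l h (Equiv.swap h e v) := by
  rcases eq_or_ne v e with rfl | hve
  · rw [Equiv.swap_apply_right, dualProb_self, dualProb_self]
  rcases eq_or_ne v h with rfl | hvh
  · rw [Equiv.swap_apply_left, dualProb_comm]
  rw [Equiv.swap_apply_of_ne_of_ne hvh hve, dualProb_of_ne l hve.symm, dualProb_of_ne l hvh.symm]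
  exact sigmoid_le (by linarith)

theorem IsDual.mono (hl : IsDual D l) {i j : Fin n} (h : l i ≤ l j) : D i ≤ D j := by
  have hsum := sum_nonneg fun v (_ : v ∈ univ) => sub_nonneg.2 (dualProb_le_dualProb_swap h v)
  rw [← hl.sub_eq_sum_swap, sub_nonneg] at hsum
  exact_mod_cast hsum

theorem sum_mul_one_sub_mul_one_sub {V : Type*} [Fintype V] {P : V → V → ℝ}
    (hP : ∀ u v, P u v = P v u) (w : V → ℝ) :
    ∑ u, ∑ v, P u v * (1 - w u) * (1 - w v)
      = ∑ u, ∑ v, P u v - 2 * ∑ u, w u * ∑ v, P u v + ∑ u, ∑ v, P u v * w u * w v := by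
  have hleft : ∑ u, ∑ v, P u v * w u = ∑ u, w u * ∑ v, P u v := by
    simp only [Finset.mul_sum, mul_comm]
  have hright : ∑ u, ∑ v, P u v * w v = ∑ u, w u * ∑ v, P u v := by
    rw [sum_comm, ← hleft]
    simp only [hP]
  have hexpand (u v) : P u v * (1 - w u) * (1 - w v)
      = P u v - P u v * w u - P u v * w v + P u v * w u * w v := by ring
  simp only [hexpand, sum_add_distrib, sum_sub_distrib, hleft, hright]
  ring

theorem le_and_le_and_le_of_le_mul_mul {x a b c : ℝ} (ha : a ∈ Set.Icc 0 1)
    (hb : b ∈ Set.Icc 0 1) (hc : c ∈ Set.Icc 0 1) (h : x ≤ a * b * c) :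
    x ≤ a ∧ x ≤ b ∧ x ≤ c := by
  have hab := mul_le_of_le_one_right (mul_nonneg ha.1 hb.1) hc.2
  exact ⟨h.trans (hab.trans (mul_le_of_le_one_right ha.1 hb.2)),
    h.trans (hab.trans (mul_le_of_le_one_left hb.1 ha.2)),
    h.trans (mul_le_of_le_one_left hc.1 (mul_le_one₀ ha.2 hb.1 hb.2))⟩

theorem update_dualProb_mem_Icc (l : Fin n → ℝ) (e u : Fin n) :
    update (dualProb l e) e 1 u ∈ Set.Icc 0 1 := by
  rw [update_apply]
  split_ifs
  exacts [⟨zero_le_one, le_rfl⟩, dualProb_mem_Icc l e u]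

theorem IsDual.sum_update_mul_le_upperSum (hl : IsDual D l) (hmono : Monotone D) (e : Fin n) :
    ∑ u, update (dualProb l e) e 1 u * D u ≤ upperSum D e := by
  have hmass : ∑ u, update (dualProb l e) e 1 u = ((D e + 1 : ℕ) : ℝ) := by
    rw [sum_update_of_mem (mem_univ e), ← erase_eq]
    have := add_sum_erase univ (dualProb l e) (mem_univ e)
    rw [dualProb_self, hl.sum_dualProb] at this
    push_cast
    linarith
  refine (sum_mul_le_sum_top (fun i j hij => Nat.cast_le.2 (hmono hij))
    (update_dualProb_mem_Icc l e) hmass).trans_eq ?_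
  rw [upperSum, Nat.cast_sum]
  refine sum_congr ?_ fun _ _ => rfl
  ext i
  simp only [mem_filter_univ]
  omega

/-- The weight `w`, which extends row `e` of the dual probabilities by `w e = 1`, carries at most
half of the total degree, so edges avoiding `w` are not negligible. -/
theorem IsDual.exists_inv_pow_le_mul_mul (hl : IsDual D l) (hmono : Monotone D)
    (hpos : ∀ i, 1 ≤ D i) {e : Fin n} (he : (upperSum D e : ℝ) ≤ (total D : ℝ) / 2) :
    let w := update (dualProb l e) e 1
    ∃ u v, 1 / (n : ℝ) ^ 4 ≤ dualProb l u v * (1 - w u) * (1 - w v) := by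
  intro w
  have hn : (0 : ℝ) < n := by exact_mod_cast e.pos
  have hnonneg (u v) : 0 ≤ dualProb l u v * w u * w v :=
    mul_nonneg (mul_nonneg (dualProb_mem_Icc l u v).1 (update_dualProb_mem_Icc l e u).1)
      (update_dualProb_mem_Icc l e v).1
  obtain ⟨o, hoe, ho⟩ := hl.exists_inv_le hpos e
  have hlow : 1 / (n : ℝ) ^ 2 ≤ ∑ u, ∑ v, dualProb l u v * w u * w v :=
    calc 1 / (n : ℝ) ^ 2 = 1 / (n : ℝ) * 1 * (1 / (n : ℝ)) := by field_simp
      _ ≤ dualProb l e o * w e * w o := by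
        rw [show w e = 1 from update_self .., show w o = _ from update_of_ne hoe ..,
          dualProb_of_ne l hoe.symm]
        simp only [mul_one]
        gcongr
        exact Real.sigmoid_nonneg _
      _ ≤ ∑ v, dualProb l e v * w e * w v :=
        single_le_sum (f := fun v => dualProb l e v * w e * w v) (fun v _ => hnonneg e v)
          (mem_univ o)
      _ ≤ _ := single_le_sum (f := fun u => ∑ v, dualProb l u v * w u * w v)
        (fun u _ => sum_nonneg fun v _ => hnonneg u v) (mem_univ e)
  have hsum := sum_mul_one_sub_mul_one_sub (dualProb_comm l) w
  simp only [hl.sum_dualProb] at hsum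
  have hw := hl.sum_update_mul_le_upperSum hmono e
  have hpigeon : ∑ _u : Fin n, ∑ _v : Fin n, 1 / (n : ℝ) ^ 4
      ≤ ∑ u, ∑ v, dualProb l u v * (1 - w u) * (1 - w v) := by
    have hconst : ∑ _u : Fin n, ∑ _v : Fin n, 1 / (n : ℝ) ^ 4 = 1 / (n : ℝ) ^ 2 := by
      simp only [sum_const, card_fin, nsmul_eq_mul]
      field_simp
    rw [total, Nat.cast_sum] at he
    linarith
  obtain ⟨u, -, hu⟩ := exists_le_of_sum_le ⟨e, mem_univ e⟩ hpigeon
  obtain ⟨v, -, hv⟩ := exists_le_of_sum_le ⟨e, mem_univ e⟩ hu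
  exact ⟨u, v, hv⟩

theorem IsDual.apply_le_of_upperSum_le (hl : IsDual D l) (hmono : Monotone D)
    (hpos : ∀ i, 1 ≤ D i) {e : Fin n} (he : (upperSum D e : ℝ) ≤ (total D : ℝ) / 2) :
    l e ≤ 6 * log n := by
  have hn : (0 : ℝ) < n := by exact_mod_cast e.pos
  have hinv : 0 < 1 / (n : ℝ) ^ 4 := by positivity
  obtain ⟨u, v, huv⟩ := hl.exists_inv_pow_le_mul_mul hmono hpos he
  set w := update (dualProb l e) e 1
  have hcompl (u) : 1 - w u ∈ Set.Icc 0 1 :=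
    Set.Icc.mem_iff_one_sub_mem.1 (update_dualProb_mem_Icc l e u)
  obtain ⟨hp, hu, hv⟩ :=
    le_and_le_and_le_of_le_mul_mul (dualProb_mem_Icc l u v) (hcompl u) (hcompl v) huv
  have hne : u ≠ v := by
    rintro rfl
    rw [dualProb_self] at hp
    exact hp.not_gt hinv
  have hbound {u} (hu : 1 / (n : ℝ) ^ 4 ≤ 1 - w u) : l e + l u ≤ (4 : ℕ) * log n := by
    have hue : u ≠ e := by
      rintro rfl
      rw [show w u = 1 from update_self .., sub_self] at hu
      exact hu.not_gt hinv
    rw [show w u = _ from update_of_ne hue .., dualProb_of_ne l hue.symm] at hu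
    exact le_mul_log_of_le_one_sub_sigmoid hn hu
  have hlow := neg_mul_log_le_of_le_sigmoid hn (dualProb_of_ne l hne ▸ hp)
  have := hbound hu
  have := hbound hv
  push_cast at *
  linarith

theorem IsDual.card_between_le (hl : IsDual D l) {e h : Fin n} (hh : l e ≤ l h) {c : ℝ}
    (hc : sigmoid (l e - c) ≤ 1 / 4) (hpos : 0 < l h) (hc0 : 0 ≤ c) :
    (#{v | -l h ≤ l v ∧ l v ≤ -c} : ℝ) ≤ 4 * ((D h : ℝ) - D e) + 1 := by
  set N : Finset (Fin n) := {v | -l h ≤ l v ∧ l v ≤ -c}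
  have hquarter {v} (hv : v ∈ N.erase e) :
      1 / 4 ≤ dualProb l h (Equiv.swap h e v) - dualProb l e v := by
    simp only [N, mem_erase, mem_filter_univ] at hv
    obtain ⟨hve, hlow, hupp⟩ := hv
    have hvh : v ≠ h := by
      rintro rfl
      linarith
    rw [Equiv.swap_apply_of_ne_of_ne hvh hve, dualProb_of_ne l hvh.symm,
      dualProb_of_ne l hve.symm]
    have hh2 : sigmoid 0 ≤ sigmoid (l h + l v) := sigmoid_le (by linarith)
    have he4 : sigmoid (l e + l v) ≤ sigmoid (l e - c) := sigmoid_le (by linarith)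
    rw [sigmoid_zero] at hh2
    linarith
  have hsum : #(N.erase e) • (1 / 4 : ℝ) ≤ D h - D e := by
    rw [hl.sub_eq_sum_swap]
    exact (card_nsmul_le_sum _ _ _ fun v hv => hquarter hv).trans
      (sum_le_univ_sum_of_nonneg fun v => sub_nonneg.2 (dualProb_le_dualProb_swap hh v))
  have hcard : (#N : ℝ) ≤ #(N.erase e) + 1 := by
    exact_mod_cast Nat.le_add_of_sub_le pred_card_le_card_erase
  rw [nsmul_eq_mul] at hsum
  linarith

/-- Up to the error term, this is the reverse of `StrictErdosGallai.cut_inequality`. -/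
theorem IsDual.cut_le (hl : IsDual D l) {A B : Finset (Fin n)} (hAB : Disjoint A B) {δ : ℝ}
    (hδ : 0 ≤ δ) (hA : ∀ u ∈ A, ∀ v ∉ B, 1 - δ ≤ sigmoid (l u + l v))
    (hB : ∀ u ∈ B, ∀ v ∉ A, sigmoid (l u + l v) ≤ δ) :
    #A * ((#Bᶜ : ℝ) - 1) + ∑ i ∈ B, (D i : ℝ) ≤ ∑ i ∈ A, (D i : ℝ) + 2 * (n ^ 2 * δ) := by
  have hcard (S : Finset (Fin n)) : #S ≤ n := card_finset_fin_le S
  have hrow {u} (hu : u ∈ A) : ((#Bᶜ : ℝ) - 1) * (1 - δ) ≤ ∑ v ∈ Bᶜ, dualProb l u v := by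
    have huB : u ∈ Bᶜ := mem_compl.2 (disjoint_left.1 hAB hu)
    rw [← add_sum_erase _ _ huB, dualProb_self, zero_add, ← cast_card_erase_of_mem huB,
      ← nsmul_eq_mul]
    refine card_nsmul_le_sum _ _ _ fun v hv => ?_
    obtain ⟨hvu, hvB⟩ := mem_erase.1 hv
    rw [dualProb_of_ne l hvu.symm]
    exact hA u hu v (mem_compl.1 hvB)
  have hrow' {u} (hu : u ∈ B) : ∑ v ∈ Aᶜ, dualProb l u v ≤ #Aᶜ * δ := by
    rw [← nsmul_eq_mul]
    refine sum_le_card_nsmul _ _ _ fun v hv => ?_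
    unfold dualProb
    split_ifs
    exacts [hδ, hB u hu v (mem_compl.1 hv)]
  have hsumA : ∑ u ∈ A, (D u : ℝ)
      = ∑ u ∈ A, ∑ v ∈ B, dualProb l u v + ∑ u ∈ A, ∑ v ∈ Bᶜ, dualProb l u v := by
    simp only [← hl.sum_dualProb, ← sum_add_distrib, sum_add_sum_compl]
  have hsumB : ∑ u ∈ B, (D u : ℝ)
      = ∑ u ∈ A, ∑ v ∈ B, dualProb l u v + ∑ u ∈ B, ∑ v ∈ Aᶜ, dualProb l u v := by
    rw [sum_comm]
    simp only [← hl.sum_dualProb, dualProb_comm l, ← sum_add_distrib, sum_add_sum_compl]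
  have hA_sum := card_nsmul_le_sum A _ _ fun u hu => hrow hu
  have hB_sum := sum_le_card_nsmul B _ _ fun u hu => hrow' hu
  rw [nsmul_eq_mul] at hA_sum hB_sum
  have hAn : (#A : ℝ) * #Bᶜ * δ ≤ n ^ 2 * δ := by
    rw [sq]
    gcongr <;> exact hcard _
  have hBn : (#B : ℝ) * #Aᶜ * δ ≤ n ^ 2 * δ := by
    rw [sq]
    gcongr <;> exact hcard _
  have hAδ : 0 ≤ #A * δ := by positivity
  linarith

/-- A window free of dual values would give a nearly tight Erdős–Gallai cut. -/
theorem IsDual.exists_mem_window (hl : IsDual D l) (hD : StrictErdosGallai D) (hmono : Monotone D)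
    (hpos : ∀ i, 1 ≤ D i) (hn : 3 ≤ n) {t : ℝ} (ht : 0 ≤ t) {h : Fin n}
    (hh : t + 3 * log n ≤ l h) :
    ∃ v, -(t + 6 * log n) ≤ l v ∧ l v < -t := by
  by_contra! hwindow
  have hn3 : (3 : ℝ) ≤ n := by exact_mod_cast hn
  have hlog : 0 ≤ log n := log_nonneg (by linarith)
  set A : Finset (Fin n) := {v | t + 3 * log n ≤ l v}
  set B : Finset (Fin n) := {v | l v < -(t + 6 * log n)}
  have hdisj : Disjoint A B := disjoint_filter.2 fun v _ hA hB => by linarith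
  have hexp : exp (-(3 * log n)) = 1 / (n : ℝ) ^ 3 := by
    rw [exp_neg, one_div, ← exp_log (show (0 : ℝ) < n by linarith), ← exp_nat_mul, log_exp]
    norm_num
  have hcut := hD.cut_inequality hmono hpos hdisj ⟨h, by simp [A, hh]⟩
  have hcut' := hl.cut_le hdisj (δ := 1 / (n : ℝ) ^ 3) (by positivity)
    (fun u hu v hv => by
      simp only [A, B, mem_filter_univ, not_lt] at hu hv
      have := one_sub_sigmoid_le_exp_neg (l u + l v)
      have : exp (-(l u + l v)) ≤ exp (-(3 * log n)) :=
        exp_le_exp.2 (by linarith [hwindow v hv])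
      linarith)
    (fun u hu v hv => by
      simp only [A, B, mem_filter_univ, not_le] at hu hv
      have := sigmoid_le_exp (l u + l v)
      have : exp (l u + l v) ≤ exp (-(3 * log n)) := exp_le_exp.2 (by linarith)
      linarith)
  have hsmall : (n : ℝ) ^ 2 * (1 / n ^ 3) ≤ 1 / 3 := by
    rw [show (n : ℝ) ^ 2 * (1 / n ^ 3) = 1 / n by field_simp]
    exact one_div_le_one_div_of_le (by norm_num) hn3
  linarith

theorem IsDual.le_card_between (hl : IsDual D l) (hD : StrictErdosGallai D) (hmono : Monotone D)
    (hpos : ∀ i, 1 ≤ D i) (hn : 3 ≤ n) {t : ℝ} (ht : 0 ≤ t) {h : Fin n} {m : ℕ}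
    (hm : t + m * (6 * log n) ≤ l h) :
    m ≤ #{v | -l h ≤ l v ∧ l v ≤ -t} := by
  have hlog : 0 ≤ log n := log_natCast_nonneg n
  have hj (j : Fin m) : ((j : ℕ) : ℝ) + 1 ≤ m := by exact_mod_cast j.2
  have hwindow (j : Fin m) := hl.exists_mem_window hD hmono hpos hn
    (t := t + (j : ℕ) * (6 * log n)) (by positivity) (h := h) (by nlinarith [hj j])
  choose f hlow hupp using hwindow
  have hanti : StrictAnti fun j => l (f j) := fun i j hij => by
    have : ((i : ℕ) : ℝ) + 1 ≤ (j : ℕ) := by exact_mod_cast hij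
    nlinarith [hlow i, hupp j]
  have hinj : Injective f := Injective.of_comp hanti.injective
  have hcard := card_le_card_of_injOn (s := univ) (t := {v | -l h ≤ l v ∧ l v ≤ -t}) f
    (fun j _ => by
      have : 0 ≤ ((j : ℕ) : ℝ) * (6 * log n) := by positivity
      rw [mem_coe, mem_filter_univ]
      constructor <;> nlinarith [hlow j, hupp j, hj j])
    hinj.injOn
  simpa using hcard

theorem one_le_log_of_four_le {x : ℝ} (hx : 4 ≤ x) : 1 ≤ log x := by
  rw [le_log_iff_exp_le (by linarith)]
  linarith [exp_one_lt_d9]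

theorem IsDual.apply_le (hl : IsDual D l) (hD : StrictErdosGallai D) (hmono : Monotone D)
    (hpos : ∀ i, 1 ≤ D i) (hn : 4 ≤ n) {e h : Fin n} (heh : l e ≤ l h)
    (he : (upperSum D e : ℝ) ≤ (total D : ℝ) / 2) :
    l h ≤ (19 + 24 * ((D h : ℝ) - D e)) * log n := by
  have hn4 : (4 : ℝ) ≤ n := by exact_mod_cast hn
  have hlog := one_le_log_of_four_le hn4
  obtain ⟨γ, hγ⟩ := Nat.exists_eq_add_of_le (hl.mono heh)
  have hsub : (D h : ℝ) - D e = γ := by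
    rw [hγ]
    push_cast
    ring
  rw [hsub]
  by_contra! hcon
  have hle := hl.le_card_between hD hmono hpos (by omega) (t := 7 * log n) (by positivity)
    (h := h) (m := 4 * γ + 2) (by push_cast; linarith)
  have hsmall : sigmoid (l e - 7 * log n) ≤ 1 / 4 :=
    calc sigmoid (l e - 7 * log n) ≤ sigmoid (-log n) :=
          sigmoid_le (by linarith [hl.apply_le_of_upperSum_le hmono hpos he])
      _ ≤ exp (-log n) := sigmoid_le_exp _
      _ = 1 / n := by rw [exp_neg, exp_log (by linarith), one_div]
      _ ≤ 1 / 4 := one_div_le_one_div_of_le (by norm_num) hn4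
  have hub := hl.card_between_le heh hsmall
    (lt_of_le_of_lt (by positivity) hcon) (by positivity)
  rw [hsub] at hub
  have : ((4 * γ + 2 : ℕ) : ℝ) ≤ (#{v | -l h ≤ l v ∧ l v ≤ -(7 * log n)} : ℝ) :=
    Nat.cast_le.2 hle
  push_cast at *
  linarith

theorem IsDual.abs_le (hl : IsDual D l) (hD : StrictErdosGallai D) (hmono : Monotone D)
    (hpos : ∀ i, 1 ≤ D i) (hn : 4 ≤ n) {e last : Fin n} (hlast : (last : ℕ) + 1 = n)
    (he : (upperSum D e : ℝ) ≤ (total D : ℝ) / 2) (i : Fin n) :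
    |l i| ≤ 38 * ((D last : ℝ) - D e + 1) * log n := by
  have hn0 : (0 : ℝ) < n := by exact_mod_cast i.pos
  have hlog := one_le_log_of_four_le (x := n) (by exact_mod_cast hn)
  have : Nonempty (Fin n) := ⟨i⟩
  obtain ⟨h, hh⟩ := Finite.exists_max l
  have hDh : D h = D last := by
    refine (hmono ?_).antisymm (hl.mono (hh last))
    rw [Fin.le_def]
    omega
  have hmax := hl.apply_le hD hmono hpos hn (hh e) he
  have hDe : (D e : ℝ) ≤ D last := by exact_mod_cast hDh ▸ hl.mono (hh e)
  obtain ⟨j, -, hj⟩ := hl.exists_inv_le hpos i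
  have hmin := neg_mul_log_le_of_le_sigmoid (k := 1) hn0 (by simpa using hj)
  rw [Nat.cast_one, one_mul] at hmin
  rw [hDh] at hmax
  rw [_root_.abs_le]
  constructor <;> nlinarith [hh i, hh j]

end DualBound

section Rounding

theorem exists_exit {α : Type*} {W : Finset α} {x z : α → ℝ} (hx : ∀ e ∈ W, x e ∈ Set.Icc 0 1)
    (hz : ∃ e ∈ W, z e ≠ 0) :
    ∃ t : ℝ, (∀ e ∈ W, x e + t * z e ∈ Set.Icc 0 1) ∧
      ∃ e ∈ W, (0 < z e ∧ x e + t * z e = 1) ∨ (z e < 0 ∧ x e + t * z e = 0) := by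
  let exitTime (e : α) : ℝ := if 0 < z e then (1 - x e) / z e else x e / -z e
  have exitTime_of_pos {e} (h : 0 < z e) : exitTime e = (1 - x e) / z e := if_pos h
  have exitTime_of_neg {e} (h : z e < 0) : exitTime e = x e / -z e := if_neg h.not_gt
  obtain ⟨e, he, hmin⟩ := (W.filter fun e => z e ≠ 0).exists_min_image exitTime
    (hz.imp fun _ => mem_filter.2)
  obtain ⟨heW, hze⟩ := mem_filter.1 he
  have hnonneg : 0 ≤ exitTime e := by
    rcases lt_or_gt_of_ne hze with h | h
    · rw [exitTime_of_neg h]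
      exact div_nonneg (hx e heW).1 (by linarith)
    · rw [exitTime_of_pos h]
      exact div_nonneg (by linarith [(hx e heW).2]) h.le
  refine ⟨exitTime e, fun f hf => ?_, e, heW, ?_⟩
  · obtain ⟨hf0, hf1⟩ := hx f hf
    rcases lt_trichotomy (z f) 0 with h | h | h
    · have hle := hmin f (mem_filter.2 ⟨hf, h.ne⟩)
      rw [exitTime_of_neg h, le_div_iff₀ (by linarith)] at hle
      constructor <;> nlinarith
    · simpa [h] using hx f hf
    · have hle := hmin f (mem_filter.2 ⟨hf, h.ne'⟩)
      rw [exitTime_of_pos h, le_div_iff₀ h] at hle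
      constructor <;> nlinarith
  · rcases lt_or_gt_of_ne hze with h | h
    · exact Or.inr ⟨h, by rw [exitTime_of_neg h]; field_simp; ring⟩
    · exact Or.inl ⟨h, by rw [exitTime_of_pos h]; field_simp; ring⟩

variable {V : Type*} [DecidableEq V]

theorem exists_kernel_vector {W : Finset (Sym2 V)} {A : Finset V} (h : #A < #W) :
    ∃ z : Sym2 V → ℝ, (∀ e ∉ W, z e = 0) ∧ (∃ e ∈ W, z e ≠ 0) ∧
      ∀ v ∈ A, ∑ e ∈ W with v ∈ e, z e = 0 := by
  let L := Matrix.mulVecLin (Matrix.of fun (v : A) (e : W) => if (v : V) ∈ (e : Sym2 V) then (1 : ℝ)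
    else 0)
  have hker : LinearMap.ker L ≠ ⊥ := LinearMap.ker_ne_bot_of_finrank_lt (by simpa using h)
  obtain ⟨c, hc, hc0⟩ := (Submodule.ne_bot_iff _).1 hker
  refine ⟨fun e => if h : e ∈ W then c ⟨e, h⟩ else 0, fun e he => by simp [he], ?_, ?_⟩
  · obtain ⟨e, he⟩ := ne_iff.1 hc0
    exact ⟨e, e.2, by simpa using he⟩
  · intro v hv
    have hrow := congrFun (LinearMap.mem_ker.1 hc) ⟨v, hv⟩
    simp only [L, Matrix.mulVecLin_apply, Matrix.mulVec, dotProduct, Matrix.of_apply,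
      Pi.zero_apply, ite_mul, one_mul, zero_mul] at hrow
    rw [← hrow, sum_filter, ← sum_coe_sort W]
    exact sum_congr rfl fun e _ => by simp

theorem exists_kernel_vector_mul_nonneg {W : Finset (Sym2 V)} {A : Finset V} (h : #A < #W)
    (σ : ℝ) (e : Sym2 V) :
    ∃ z : Sym2 V → ℝ, (∀ f ∉ W, z f = 0) ∧ (∃ f ∈ W, z f ≠ 0) ∧
      (∀ v ∈ A, ∑ f ∈ W with v ∈ f, z f = 0) ∧ 0 ≤ σ * z e := by
  obtain ⟨z, hz0, ⟨f, hf, hzf⟩, hzA⟩ := exists_kernel_vector h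
  rcases le_total 0 (σ * z e) with he | he
  · exact ⟨z, hz0, ⟨f, hf, hzf⟩, hzA, he⟩
  · exact ⟨-z, fun f hf => by simp [hz0 f hf], ⟨f, hf, by simpa using hzf⟩,
      fun v hv => by simp [hzA v hv], by simpa using he⟩

variable [Fintype V]

/-- The edges of the complete graph that meet `S`. -/
def meeting (S : Finset V) : Finset (Sym2 V) := {e | ¬ e.IsDiag ∧ ∃ i ∈ S, i ∈ e}

/-- The weighted degree of `v`, counting only the edges that meet `S`. -/
def wdeg (S : Finset V) (x : Sym2 V → ℝ) (v : V) : ℝ := ∑ e ∈ meeting S with v ∈ e, x e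

/-- The edges of fractional weight that meet `S`. -/
noncomputable def fracEdges (S : Finset V) (x : Sym2 V → ℝ) : Finset (Sym2 V) :=
  open Classical in (meeting S).filter fun e => x e ∈ Set.Ioo 0 1

/-- The edges of fractional weight at `v` that meet `S`. -/
noncomputable def fracAt (S : Finset V) (x : Sym2 V → ℝ) (v : V) : Finset (Sym2 V) :=
  (fracEdges S x).filter fun e => v ∈ e

variable {S A W : Finset V} {x x' y : Sym2 V → ℝ} {e : Sym2 V} {v : V}

theorem mem_meeting : e ∈ meeting S ↔ ¬ e.IsDiag ∧ ∃ i ∈ S, i ∈ e := by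
  simp [meeting]

theorem mk_mem_meeting {i u : V} (hi : i ∈ S) (hiu : i ≠ u) : s(i, u) ∈ meeting S :=
  mem_meeting.2 ⟨by simpa using hiu, i, hi, Sym2.mem_mk_left i u⟩

theorem mem_fracEdges : e ∈ fracEdges S x ↔ e ∈ meeting S ∧ x e ∈ Set.Ioo 0 1 := by
  simp [fracEdges]

theorem mem_fracAt : e ∈ fracAt S x v ↔ e ∈ fracEdges S x ∧ v ∈ e := by
  simp [fracAt]

theorem fracEdges_subset : fracEdges S x ⊆ meeting S := fun _ he => (mem_fracEdges.1 he).1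

theorem not_isDiag_of_mem_fracEdges (he : e ∈ fracEdges S x) : ¬ e.IsDiag :=
  (mem_meeting.1 (fracEdges_subset he)).1

theorem notMem_fracEdges_of_eq (h : x e = 0 ∨ x e = 1) : e ∉ fracEdges S x := fun he => by
  have hfrac := (mem_fracEdges.1 he).2
  rcases h with h | h <;> simp [h] at hfrac

theorem eq_zero_or_one_of_notMem_fracEdges (hx : ∀ e ∈ meeting S, x e ∈ Set.Icc 0 1)
    (he : e ∈ meeting S) (h : e ∉ fracEdges S x) : x e = 0 ∨ x e = 1 := by
  have := Set.eq_endpoints_or_mem_Ioo_of_mem_Icc (hx e he)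
  have hfrac : x e ∉ Set.Ioo 0 1 := fun hxe => h (mem_fracEdges.2 ⟨he, hxe⟩)
  tauto

theorem fracEdges_subset_of_eq {W : Finset (Sym2 V)} (hW : fracEdges S x ⊆ W)
    (h : ∀ f ∉ W, x' f = x f) : fracEdges S x' ⊆ W := fun f hf => by
  by_contra hfW
  rw [mem_fracEdges, h f hfW] at hf
  exact hfW (hW (mem_fracEdges.2 hf))

theorem wdeg_congr (h : ∀ e ∈ meeting S, v ∈ e → y e = x e) : wdeg S y v = wdeg S x v :=
  sum_congr rfl fun e he => h e (mem_filter.1 he).1 (mem_filter.1 he).2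

theorem wdeg_sub_eq_sum {W : Finset (Sym2 V)} (hW : W ⊆ meeting S) (h : ∀ e ∉ W, y e = x e)
    (v : V) : wdeg S y v - wdeg S x v = ∑ e ∈ W with v ∈ e, (y e - x e) := by
  rw [wdeg, wdeg, ← sum_sub_distrib]
  refine (sum_subset (filter_subset_filter _ hW) fun e he heW => ?_).symm
  rw [h e fun h => heW (mem_filter.2 ⟨h, (mem_filter.1 he).2⟩), sub_self]

theorem exists_int_sum_of_eq_zero_or_one {α : Type*} {T : Finset α} {x : α → ℝ}
    (h : ∀ e ∈ T, x e = 0 ∨ x e = 1) : ∃ c : ℤ, ∑ e ∈ T, x e = c := by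
  classical
  refine ⟨∑ e ∈ T, if x e = 1 then 1 else 0, ?_⟩
  push_cast
  exact sum_congr rfl fun e he => by rcases h e he with h | h <;> simp [h]

theorem exists_int_sum_fracAt (hx : ∀ e ∈ meeting S, x e ∈ Set.Icc 0 1)
    (hv : ∃ d : ℤ, wdeg S x v = d) : ∃ d : ℤ, ∑ e ∈ fracAt S x v, x e = d := by
  obtain ⟨d, hd⟩ := hv
  have hsub : fracAt S x v ⊆ (meeting S).filter fun e => v ∈ e :=
    filter_subset_filter _ fracEdges_subset
  obtain ⟨c, hc⟩ : ∃ c : ℤ, ∑ e ∈ (meeting S).filter (v ∈ ·) \ fracAt S x v, x e = c :=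
    exists_int_sum_of_eq_zero_or_one fun e he => by
      simp only [mem_sdiff, mem_filter, mem_fracAt, not_and] at he
      exact eq_zero_or_one_of_notMem_fracEdges hx he.1.1 fun h => he.2 h he.1.2
  rw [wdeg, ← sum_sdiff hsub] at hd
  exact ⟨d - c, by push_cast; linarith⟩

theorem card_fracAt_ne_one (hx : ∀ e ∈ meeting S, x e ∈ Set.Icc 0 1)
    (hv : ∃ d : ℤ, wdeg S x v = d) : #(fracAt S x v) ≠ 1 := by
  intro h
  obtain ⟨d, hd⟩ := exists_int_sum_fracAt hx hv
  obtain ⟨e, he⟩ := card_eq_one.1 h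
  obtain ⟨hpos, hlt⟩ := (mem_fracEdges.1 (mem_fracAt.1 (he ▸ mem_singleton_self e)).1).2
  rw [he, sum_singleton] at hd
  rw [hd] at hpos hlt
  have hpos' : (0 : ℤ) < d := by exact_mod_cast hpos
  have hlt' : d < (1 : ℤ) := by exact_mod_cast hlt
  omega

theorem sum_fracAt_eq_one (hx : ∀ e ∈ meeting S, x e ∈ Set.Icc 0 1)
    (hv : ∃ d : ℤ, wdeg S x v = d) (hcard : #(fracAt S x v) = 2) :
    ∑ e ∈ fracAt S x v, x e = 1 := by
  obtain ⟨d, hd⟩ := exists_int_sum_fracAt hx hv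
  have hne : (fracAt S x v).Nonempty := card_pos.1 (by omega)
  have hfrac (e) (he : e ∈ fracAt S x v) : x e ∈ Set.Ioo 0 1 :=
    (mem_fracEdges.1 (mem_fracAt.1 he).1).2
  have hpos : 0 < ∑ e ∈ fracAt S x v, x e := sum_pos (fun e he => (hfrac e he).1) hne
  have hlt : ∑ e ∈ fracAt S x v, x e < ∑ _e ∈ fracAt S x v, (1 : ℝ) :=
    sum_lt_sum_of_nonempty hne fun e he => (hfrac e he).2
  simp only [sum_const, hcard, hd] at hpos hlt
  norm_num at hlt
  have hpos' : (0 : ℤ) < d := by exact_mod_cast hpos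
  have hlt' : d < (2 : ℤ) := by exact_mod_cast hlt
  rw [hd, show d = 1 by omega, Int.cast_one]

theorem abs_wdeg_sub_le (hx : ∀ e ∈ meeting S, x e ∈ Set.Icc 0 1)
    (hy : ∀ e ∈ meeting S, y e ∈ Set.Icc 0 1) {e₀ : Sym2 V}
    (h : ∀ e ∈ meeting S, v ∈ e → e ≠ e₀ → (x e = 0 ∨ x e = 1) → y e = x e) :
    |wdeg S y v - wdeg S x v| ≤ #(fracAt S x v) + 1 := by
  rw [wdeg, wdeg, ← sum_sub_distrib]
  calc |∑ e ∈ meeting S with v ∈ e, (y e - x e)|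
      ≤ ∑ e ∈ meeting S with v ∈ e, |y e - x e| := abs_sum_le_sum_abs _ _
    _ ≤ ∑ e ∈ meeting S with v ∈ e, if e ∈ insert e₀ (fracAt S x v) then (1 : ℝ) else 0 := by
        refine sum_le_sum fun e he => ?_
        obtain ⟨he, hve⟩ := mem_filter.1 he
        split_ifs with hmem
        · simpa using abs_sub_le_of_le_of_le (hy e he).1 (hy e he).2 (hx e he).1 (hx e he).2
        · rw [mem_insert, not_or, mem_fracAt] at hmem
          have hfrac : e ∉ fracEdges S x := fun h' => hmem.2 ⟨h', hve⟩
          simp [h e he hve hmem.1 (eq_zero_or_one_of_notMem_fracEdges hx he hfrac)]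
    _ ≤ (#(insert e₀ (fracAt S x v)) : ℝ) := by
        rw [sum_boole]
        exact_mod_cast card_le_card fun e he => (mem_filter.1 he).2
    _ ≤ _ := by exact_mod_cast card_insert_le _ _

theorem sum_card_fracAt : ∑ v, #(fracAt S x v) = 2 * #(fracEdges S x) := by
  have hends (e) (he : e ∈ fracEdges S x) : #{v | v ∈ e} = 2 := by
    rw [← Sym2.card_toFinset_of_not_isDiag e (not_isDiag_of_mem_fracEdges he)]
    congr 1
    ext v
    simp
  have hcount := sum_card_bipartiteAbove_eq_sum_card_bipartiteBelow (s := fracEdges S x)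
    (t := univ) (fun e v => v ∈ e)
  simp only [bipartiteAbove, bipartiteBelow] at hcount
  simp only [fracAt]
  rw [← hcount, sum_congr rfl hends, sum_const, smul_eq_mul, mul_comm]

/-- `y` is an integral rounding of `x` on the edges meeting `S` that keeps the degrees in `S` and
moves every other degree by at most `3`. The last field lets rounding steps be composed: at a vertex
outside `S`, all but one of the edges that are already integral are left alone. -/
structure IsRounding (S : Finset V) (x y : Sym2 V → ℝ) : Prop where
  integral : ∀ e ∈ meeting S, y e = 0 ∨ y e = 1
  wdeg_eq : ∀ i ∈ S, wdeg S y i = wdeg S x i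
  abs_wdeg_sub_le : ∀ v ∉ S, |wdeg S y v - wdeg S x v| ≤ 3
  eq_of_integral : ∀ v ∉ S, ∃ e₀, ∀ e ∈ meeting S, v ∈ e → e ≠ e₀ → (x e = 0 ∨ x e = 1) → y e = x e

theorem IsRounding.mem_Icc (h : IsRounding S x y) : ∀ e ∈ meeting S, y e ∈ Set.Icc 0 1 :=
  fun e he => by rcases h.integral e he with h | h <;> simp [h]

/-- `x'` has fewer fractional edges than `x` and the same degrees in `S`. -/
structure IsReduction (S : Finset V) (x x' : Sym2 V → ℝ) : Prop where
  mem_Icc : ∀ e ∈ meeting S, x' e ∈ Set.Icc 0 1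
  card_lt : #(fracEdges S x') < #(fracEdges S x)
  wdeg_eq : ∀ i ∈ S, wdeg S x' i = wdeg S x i

/-- A vertex outside `S` stops being constrained once it has at most two fractional edges left, and
from then on its degree moves by at most `2 + 1`. -/
theorem IsReduction.isRounding (hx : ∀ e ∈ meeting S, x e ∈ Set.Icc 0 1)
    (hstep : IsReduction S x x')
    (hlarge : ∀ v ∉ S, 3 ≤ #(fracAt S x v) → wdeg S x' v = wdeg S x v)
    (hfix : ∀ v ∉ S, ∀ e ∈ meeting S, v ∈ e → (x e = 0 ∨ x e = 1) → x' e = x e)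
    (hy : IsRounding S x' y) : IsRounding S x y := by
  have heq (v) (hv : v ∉ S) :
      ∃ e₀, ∀ e ∈ meeting S, v ∈ e → e ≠ e₀ → (x e = 0 ∨ x e = 1) → y e = x e := by
    obtain ⟨e₀, he₀⟩ := hy.eq_of_integral v hv
    refine ⟨e₀, fun e he hve hne hxe => ?_⟩
    have hx'e := hfix v hv e he hve hxe
    rw [he₀ e he hve hne (by rwa [hx'e]), hx'e]
  refine ⟨hy.integral, fun i hi => (hy.wdeg_eq i hi).trans (hstep.wdeg_eq i hi),
    fun v hv => ?_, heq⟩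
  rcases le_or_gt 3 #(fracAt S x v) with hc | hc
  · rw [← hlarge v hv hc]
    exact hy.abs_wdeg_sub_le v hv
  · obtain ⟨e₀, he₀⟩ := heq v hv
    have hcard : (#(fracAt S x v) : ℝ) ≤ 2 := by exact_mod_cast Nat.lt_succ_iff.1 hc
    linarith [AlmostDegree.abs_wdeg_sub_le hx hy.mem_Icc he₀]

/-- Move along a kernel vector of the incidence matrix until a weight becomes integral. The sign of
the kernel vector is chosen so that the edge `e`, if it starts at an endpoint of `[0, 1]`, can only
exit at the other one. -/
theorem exists_move {W : Finset (Sym2 V)} (hx : ∀ e ∈ meeting S, x e ∈ Set.Icc 0 1)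
    (hW : W ⊆ meeting S) (hfrac : ∀ f ∈ W, f ≠ e → f ∈ fracEdges S x) (hcard : #A < #W) :
    ∃ x' : Sym2 V → ℝ, (∀ f ∈ meeting S, x' f ∈ Set.Icc 0 1) ∧ (∀ f ∉ W, x' f = x f) ∧
      (∀ v ∈ A, wdeg S x' v = wdeg S x v) ∧ ∃ g ∈ W, x' g ≠ x g ∧ (x' g = 0 ∨ x' g = 1) := by
  obtain ⟨z, hz0, hzne, hzA, hze⟩ := exists_kernel_vector_mul_nonneg hcard (1 - 2 * x e) e
  obtain ⟨t, ht, g, hg, hexit⟩ := exists_exit (fun f hf => hx f (hW hf)) hzne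
  have hkeep (f) (hf : f ∉ W) : x f + t * z f = x f := by rw [hz0 f hf, mul_zero, add_zero]
  refine ⟨fun f => x f + t * z f, fun f hf => ?_, hkeep, fun v hv => ?_, g, hg, ?_, ?_⟩
  · by_cases h : f ∈ W
    · exact ht f h
    · simpa only [hkeep f h] using hx f hf
  · have hsum := wdeg_sub_eq_sum hW hkeep v
    simp only [add_sub_cancel_left, ← Finset.mul_sum, hzA v hv, mul_zero] at hsum
    exact sub_eq_zero.1 hsum
  · intro hgx
    by_cases hge : g = e
    · subst hge
      simp only at hgx
      rcases hexit with ⟨hz, h⟩ | ⟨hz, h⟩ <;> rw [← hgx, h] at hze <;> linarith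
    · have := (mem_fracEdges.1 (hfrac g hg hge)).2
      simp only at hgx
      rcases hexit with ⟨-, h⟩ | ⟨-, h⟩ <;> linarith [this.1, this.2]
  · exact hexit.symm.imp And.right And.right

theorem exists_isReduction_of_card_lt (hx : ∀ e ∈ meeting S, x e ∈ Set.Icc 0 1)
    (hAS : ∀ i ∈ S, i ∉ A → fracAt S x i = ∅)
    (hAc : ∀ v ∉ S, 3 ≤ #(fracAt S x v) → v ∈ A) (hcard : #A < #(fracEdges S x)) :
    ∃ x', IsReduction S x x' ∧ ∀ y, IsRounding S x' y → IsRounding S x y := by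
  obtain ⟨e, -⟩ : (fracEdges S x).Nonempty := card_pos.1 (by omega)
  obtain ⟨x', hx', hkeep, hdeg, g, hg, -, hgx'⟩ :=
    exists_move (e := e) hx fracEdges_subset (fun f hf _ => hf) hcard
  have hred : IsReduction S x x' := by
    refine ⟨hx', card_lt_card ?_, fun i hi => ?_⟩
    · exact (ssubset_iff_of_subset (fracEdges_subset_of_eq Subset.rfl hkeep)).2
        ⟨g, hg, notMem_fracEdges_of_eq hgx'⟩
    · by_cases hiA : i ∈ A
      · exact hdeg i hiA
      · refine wdeg_congr fun f _ hif => hkeep f fun hf => ?_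
        simpa [hAS i hi hiA] using mem_fracAt.2 ⟨hf, hif⟩
  exact ⟨x', hred, fun y => hred.isRounding hx (fun v hv hc => hdeg v (hAc v hv hc))
    fun v _ f _ _ hxf => hkeep f (notMem_fracEdges_of_eq hxf)⟩

/-- The fractional edges form a `2`-regular graph on the vertex set `A ⊆ S`. This is the only
situation in which there are not enough fractional edges to move along a kernel vector. -/
structure IsFracTwoRegular (S : Finset V) (x : Sym2 V → ℝ) (A : Finset V) : Prop where
  subset : A ⊆ S
  card_fracAt : ∀ v ∈ A, #(fracAt S x v) = 2
  fracAt_eq_empty : ∀ v ∉ A, fracAt S x v = ∅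

theorem IsFracTwoRegular.card_fracEdges (h : IsFracTwoRegular S x A) : #(fracEdges S x) = #A := by
  have hsum := sum_card_fracAt (S := S) (x := x)
  rw [← sum_subset (subset_univ A) fun v _ hv => by simp [h.fracAt_eq_empty v hv],
    sum_congr rfl h.card_fracAt, sum_const, smul_eq_mul] at hsum
  omega

theorem IsFracTwoRegular.mem_of_mem (h : IsFracTwoRegular S x A) (he : e ∈ fracEdges S x)
    (hv : v ∈ e) : v ∈ A := by
  by_contra hvA
  simpa [h.fracAt_eq_empty v hvA] using mem_fracAt.2 ⟨he, hv⟩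

theorem isFracTwoRegular_of_card_le (hx : ∀ e ∈ meeting S, x e ∈ Set.Icc 0 1)
    (hint : ∀ i ∈ S, ∃ d : ℤ, wdeg S x i = d)
    (hA : ∀ v, v ∈ A ↔ (v ∈ S ∧ fracAt S x v ≠ ∅) ∨ (v ∉ S ∧ 3 ≤ #(fracAt S x v)))
    (hle : #(fracEdges S x) ≤ #A) : IsFracTwoRegular S x A := by
  have hlow (v) (_ : v ∈ univ) : (if v ∈ A then 2 else 0) ≤ #(fracAt S x v) := by
    split_ifs with h
    · rcases (hA v).1 h with ⟨hS, hne⟩ | ⟨_, h3⟩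
      · have hne_one := card_fracAt_ne_one hx (hint v hS)
        have hne_zero := card_ne_zero.2 (nonempty_iff_ne_empty.2 hne)
        omega
      · omega
    · exact Nat.zero_le _
  have hconst : (∑ v : V, if v ∈ A then 2 else 0) = 2 * #A := by simp [mul_comm]
  have hall := (sum_eq_sum_iff_of_le hlow).1 (le_antisymm (sum_le_sum hlow)
    (by rw [hconst, sum_card_fracAt]; omega))
  refine ⟨fun v hv => ?_, fun v hv => ?_, fun v hv => ?_⟩ <;> have := hall v (mem_univ v)
  · rw [if_pos hv] at this
    rcases (hA v).1 hv with h | h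
    · exact h.1
    · omega
  · rw [← this, if_pos hv]
  · rw [if_neg hv] at this
    exact card_eq_zero.1 this.symm

/-- If the fractional edge `f` disappears, then so does the other fractional edge at an endpoint of
`f` not covered by the newly opened edge `e`, because a vertex of `S` cannot have a single one. -/
theorem IsFracTwoRegular.card_fracEdges_lt (hA : IsFracTwoRegular S x A)
    (hx' : ∀ f ∈ meeting S, x' f ∈ Set.Icc 0 1) (hint : ∀ i ∈ S, ∃ d : ℤ, wdeg S x' i = d)
    (he : e ∉ fracEdges S x) (hsub : fracEdges S x' ⊆ insert e (fracEdges S x)) {f : Sym2 V}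
    (hf : f ∈ fracEdges S x) (hf' : f ∉ fracEdges S x') :
    #(fracEdges S x') < #(fracEdges S x) := by
  obtain ⟨w, hwf, hwe⟩ : ∃ w ∈ f, w ∉ e := by
    by_contra! hcon
    induction f using Sym2.ind with
    | _ a b =>
      have hab : a ≠ b := by simpa using not_isDiag_of_mem_fracEdges hf
      have hfe : e = s(a, b) := (Sym2.mem_and_mem_iff hab).1 ⟨hcon a (by simp), hcon b (by simp)⟩
      exact he (hfe ▸ hf)
  have hwA := hA.mem_of_mem hf hwf
  have hfw : f ∈ fracAt S x w := mem_fracAt.2 ⟨hf, hwf⟩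
  have hw_subset : fracAt S x' w ⊆ (fracAt S x w).erase f := fun f' hmem => by
    obtain ⟨hmem', hw⟩ := mem_fracAt.1 hmem
    have hne : f' ≠ e := fun h => hwe (h ▸ hw)
    exact mem_erase.2 ⟨fun h => hf' (h ▸ hmem'),
      mem_fracAt.2 ⟨mem_of_mem_insert_of_ne (hsub hmem') hne, hw⟩⟩
  have hw_empty : fracAt S x' w = ∅ := by
    have hle := card_le_card hw_subset
    have hne_one := card_fracAt_ne_one hx' (hint w (hA.subset hwA))
    rw [card_erase_of_mem hfw, hA.card_fracAt w hwA] at hle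
    rw [← card_eq_zero]
    omega
  have hsub' : fracEdges S x' ⊆ insert e (fracEdges S x \ fracAt S x w) := fun f' hmem => by
    refine mem_insert.2 ((mem_insert.1 (hsub hmem)).imp_right fun h =>
      mem_sdiff.2 ⟨h, fun hw => ?_⟩)
    simpa [hw_empty] using mem_fracAt.2 ⟨hmem, (mem_fracAt.1 hw).2⟩
  have hcard := (card_le_card hsub').trans (card_insert_le _ _)
  have hcompl := card_sdiff_add_card_eq_card (filter_subset (w ∈ ·) (fracEdges S x))
  rw [← fracAt, hA.card_fracAt w hwA] at hcompl
  omega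

/-- When the fractional edges are `2`-regular, opening one further edge `s(i, u)` restores a
kernel vector. -/
theorem IsFracTwoRegular.exists_isReduction (hA : IsFracTwoRegular S x A)
    (hx : ∀ e ∈ meeting S, x e ∈ Set.Icc 0 1) (hint : ∀ i ∈ S, ∃ d : ℤ, wdeg S x i = d)
    {i u : V} (hi : i ∈ A) (hu : u ∈ A ∨ u ∉ S) (hiu : i ≠ u) (hfr : s(i, u) ∉ fracEdges S x) :
    ∃ x', IsReduction S x x' ∧ ∀ f ∉ insert s(i, u) (fracEdges S x), x' f = x f := by
  have hW : insert s(i, u) (fracEdges S x) ⊆ meeting S :=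
    insert_subset (mk_mem_meeting (hA.subset hi) hiu) fracEdges_subset
  obtain ⟨x', hx', hkeep, hdegA, g, hg, hgx, hgx'⟩ := exists_move (e := s(i, u)) (A := A) hx hW
    (fun f hf hne => mem_of_mem_insert_of_ne hf hne)
    (by rw [card_insert_of_notMem hfr, hA.card_fracEdges]; omega)
  have hdeg (v) (hv : v ∈ S) : wdeg S x' v = wdeg S x v := by
    by_cases hvA : v ∈ A
    · exact hdegA v hvA
    · refine wdeg_congr fun f _ hvf => hkeep f fun hf => ?_
      rcases mem_insert.1 hf with rfl | hf
      · rcases Sym2.mem_iff.1 hvf with rfl | rfl <;> tauto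
      · exact hvA (hA.mem_of_mem hf hvf)
  have hint' (v) (hv : v ∈ S) : ∃ d : ℤ, wdeg S x' v = d := by rw [hdeg v hv]; exact hint v hv
  have hsub := fracEdges_subset_of_eq (subset_insert _ _) hkeep
  obtain ⟨f, hf, hf'⟩ : ∃ f ∈ fracEdges S x, f ∉ fracEdges S x' := by
    by_contra! hall
    have hge : g = s(i, u) := (mem_insert.1 hg).resolve_right fun h =>
      notMem_fracEdges_of_eq hgx' (hall g h)
    have hsame : fracEdges S x' = fracEdges S x := by
      refine Subset.antisymm (fun f hf => mem_of_mem_insert_of_ne (hsub hf) ?_) hall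
      rintro rfl
      exact notMem_fracEdges_of_eq (hge ▸ hgx') hf
    have hat : fracAt S x' i = fracAt S x i := by rw [fracAt, hsame, fracAt]
    have hsum := wdeg_sub_eq_sum hW hkeep i
    rw [hdeg i (hA.subset hi), sub_self, filter_insert, if_pos (Sym2.mem_mk_left i u), ← fracAt,
      sum_insert fun h => hfr (mem_fracAt.1 h).1, sum_sub_distrib,
      sum_fracAt_eq_one hx (hint i (hA.subset hi)) (hA.card_fracAt i hi), ← hat,
      sum_fracAt_eq_one hx' (hint' i (hA.subset hi)) (hat ▸ hA.card_fracAt i hi)] at hsum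
    exact hgx (by rw [hge]; linarith)
  exact ⟨x', ⟨hx', hA.card_fracEdges_lt hx' hint' hfr hsub hf hf', hdeg⟩, hkeep⟩

theorem exists_mem_fracEdges_ne (hx : ∀ e ∈ meeting S, x e ∈ Set.Icc 0 1)
    (hv : ∃ d : ℤ, wdeg S x v = d) (he : e ∈ fracEdges S x) (hve : v ∈ e) :
    ∃ f ∈ fracEdges S x, v ∈ f ∧ f ≠ e := by
  have hmem : e ∈ fracAt S x v := mem_fracAt.2 ⟨he, hve⟩
  have hone : 1 < #(fracAt S x v) := by
    have := card_fracAt_ne_one hx hv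
    have := card_pos.2 ⟨e, hmem⟩
    omega
  obtain ⟨f, hf, hne⟩ := exists_mem_ne hone e
  exact ⟨f, (mem_fracAt.1 hf).1, (mem_fracAt.1 hf).2, hne⟩

theorem fracEdges_eq_empty_of_card_le_two (hx : ∀ e ∈ meeting S, x e ∈ Set.Icc 0 1)
    (hint : ∀ i ∈ S, ∃ d : ℤ, wdeg S x i = d) (hcard : #(fracEdges S x) ≤ 2)
    (he : ∃ i ∈ S, i ∈ e) (hS : ∀ f ∈ fracEdges S x, f ≠ e → ∀ v ∈ f, v ∈ S) :
    fracEdges S x = ∅ := by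
  by_contra hne
  obtain ⟨g, hg, hge⟩ : ∃ g ∈ fracEdges S x, g ≠ e := by
    obtain ⟨g, hg⟩ := nonempty_iff_ne_empty.2 hne
    by_cases h : g = e
    · subst h
      obtain ⟨i, hi, hig⟩ := he
      obtain ⟨f, hf, -, hfg⟩ := exists_mem_fracEdges_ne hx (hint i hi) hg hig
      exact ⟨f, hf, hfg⟩
    · exact ⟨g, hg, h⟩
  have hgd := not_isDiag_of_mem_fracEdges hg
  induction g using Sym2.ind with
  | _ a b =>
    rw [Sym2.mk_isDiag_iff] at hgd
    obtain ⟨ga, hga, ha, hga_ne⟩ :=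
      exists_mem_fracEdges_ne hx (hint a (hS _ hg hge a (by simp))) hg (by simp)
    obtain ⟨gb, hgb, hb, hgb_ne⟩ :=
      exists_mem_fracEdges_ne hx (hint b (hS _ hg hge b (by simp))) hg (by simp)
    have hab : ga ≠ gb := by
      rintro rfl
      exact hga_ne ((Sym2.mem_and_mem_iff hgd).1 ⟨ha, hb⟩)
    have hthree : #{s(a, b), ga, gb} ≤ #(fracEdges S x) :=
      card_le_card (by simp [insert_subset_iff, *])
    rw [card_eq_three.2 ⟨_, _, _, hga_ne.symm, hgb_ne.symm, hab, rfl⟩] at hthree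
    omega

theorem IsFracTwoRegular.card_le_three (hA : IsFracTwoRegular S x A) {i : V} (hi : i ∈ A)
    (hclique : ∀ u ∈ A, i ≠ u → s(i, u) ∈ fracEdges S x) : #A ≤ 3 := by
  have hle : #(A.erase i) ≤ #(fracAt S x i) := by
    refine card_le_card_of_injOn (fun u => s(i, u)) (fun u hu => ?_)
      (fun u _ u' _ h => Sym2.congr_right.1 h)
    obtain ⟨hne, huA⟩ := mem_erase.1 (mem_coe.1 hu)
    exact mem_coe.2 (mem_fracAt.2 ⟨hclique u huA hne.symm, by simp⟩)
  rw [hA.card_fracAt i hi, card_erase_of_mem hi] at hle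
  omega

/-- The last case of the rounding: the fractional edges form a triangle, whose half-integral
degrees are repaired at the expense of a vertex outside `S`. -/
theorem IsFracTwoRegular.exists_isRounding_of_clique (hA : IsFracTwoRegular S x A)
    (hx : ∀ e ∈ meeting S, x e ∈ Set.Icc 0 1) (hint : ∀ i ∈ S, ∃ d : ℤ, wdeg S x i = d)
    {i star : V} (hi : i ∈ A) (hstar : star ∉ S)
    (hclique : ∀ u ∈ A, i ≠ u → s(i, u) ∈ fracEdges S x) : ∃ y, IsRounding S x y := by
  have hne : i ≠ star := fun h => hstar (h ▸ hA.subset hi)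
  have hfr : s(i, star) ∉ fracEdges S x := fun h =>
    hstar (hA.subset (hA.mem_of_mem h (Sym2.mem_mk_right i star)))
  obtain ⟨y, hred, hkeep⟩ := hA.exists_isReduction hx hint hi (Or.inr hstar) hne hfr
  have hempty : fracEdges S y = ∅ := by
    refine fracEdges_eq_empty_of_card_le_two hred.mem_Icc
      (fun j hj => by rw [hred.wdeg_eq j hj]; exact hint j hj) ?_ (e := s(i, star))
      ⟨i, hA.subset hi, by simp⟩ fun f hf hfe v hv => ?_
    · have := hred.card_lt
      have := hA.card_fracEdges
      have := hA.card_le_three hi hclique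
      omega
    · have hfx := mem_of_mem_insert_of_ne
        (fracEdges_subset_of_eq (subset_insert _ _) hkeep hf) hfe
      exact hA.subset (hA.mem_of_mem hfx hv)
  have hfix (e) (hne : e ≠ s(i, star)) (hxe : x e = 0 ∨ x e = 1) : y e = x e :=
    hkeep e (by simp [hne, notMem_fracEdges_of_eq hxe])
  refine ⟨y, fun e he => eq_zero_or_one_of_notMem_fracEdges hred.mem_Icc he (by simp [hempty]),
    hred.wdeg_eq, fun v hv => ?_, fun _ _ => ⟨s(i, star), fun e _ _ => hfix e⟩⟩
  have hle := abs_wdeg_sub_le hx hred.mem_Icc (v := v) fun e _ _ => hfix e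
  rw [hA.fracAt_eq_empty v fun h => hv (hA.subset h), card_empty] at hle
  norm_num at hle
  linarith

/-- A version of the Beck–Fiala argument: as long as there are more fractional edges than
constraints, move along a kernel vector. -/
theorem exists_isRounding {star : V} (hstar : star ∉ S)
    (hx : ∀ e ∈ meeting S, x e ∈ Set.Icc 0 1) (hint : ∀ i ∈ S, ∃ d : ℤ, wdeg S x i = d) :
    ∃ y, IsRounding S x y := by
  classical
  induction hN : #(fracEdges S x) using Nat.strong_induction_on generalizing x with
  | _ N ih =>
    subst hN
    have descend {x'} (hred : IsReduction S x x')
        (hcomp : ∀ y, IsRounding S x' y → IsRounding S x y) : ∃ y, IsRounding S x y := by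
      obtain ⟨y, hy⟩ := ih _ hred.card_lt hred.mem_Icc
        (fun i hi => by rw [hred.wdeg_eq i hi]; exact hint i hi) rfl
      exact ⟨y, hcomp y hy⟩
    by_cases hempty : fracEdges S x = ∅
    · exact ⟨x, fun e he => eq_zero_or_one_of_notMem_fracEdges hx he (by simp [hempty]),
        fun _ _ => rfl, fun v _ => by simp, fun v _ => ⟨s(v, v), fun _ _ _ _ _ => rfl⟩⟩
    let A : Finset V := {v | (v ∈ S ∧ fracAt S x v ≠ ∅) ∨ (v ∉ S ∧ 3 ≤ #(fracAt S x v))}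
    have hAmem (v) : v ∈ A ↔ (v ∈ S ∧ fracAt S x v ≠ ∅) ∨ (v ∉ S ∧ 3 ≤ #(fracAt S x v)) := by
      simp [A]
    rcases lt_or_ge #A #(fracEdges S x) with hlt | hle
    · obtain ⟨x', hred, hcomp⟩ := exists_isReduction_of_card_lt hx
        (fun i hi hiA => by_contra fun h => hiA ((hAmem i).2 (Or.inl ⟨hi, h⟩)))
        (fun v hv hc => (hAmem v).2 (Or.inr ⟨hv, hc⟩)) hlt
      exact descend hred hcomp
    have hA := isFracTwoRegular_of_card_le hx hint hAmem hle
    obtain ⟨i, hi⟩ : A.Nonempty := card_pos.1 <| hA.card_fracEdges ▸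
      card_pos.2 (nonempty_iff_ne_empty.2 hempty)
    by_cases hclique : ∀ u ∈ A, i ≠ u → s(i, u) ∈ fracEdges S x
    · exact hA.exists_isRounding_of_clique hx hint hi hstar hclique
    push Not at hclique
    obtain ⟨u, hu, hiu, hfr⟩ := hclique
    obtain ⟨x', hred, hkeep⟩ := hA.exists_isReduction hx hint hi (Or.inl hu) hiu hfr
    refine descend hred fun y => hred.isRounding hx (fun v hv hc => ?_) fun v hv e _ hve _ => ?_
    · exact absurd (hA.subset ((hAmem v).2 (Or.inr ⟨hv, hc⟩))) hv
    · refine hkeep e fun he => hv (hA.subset ?_)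
      rcases mem_insert.1 he with rfl | he
      · rcases Sym2.mem_iff.1 hve with rfl | rfl <;> assumption
      · exact hA.mem_of_mem he hve

end Rounding

theorem sum_extensions_le {V X : Type*} [Fintype V] [DecidableEq V] [Fintype X] [DecidableEq X]
    [Nonempty X] {m : X → X → ℝ} (hm : ∀ a b, 0 ≤ m a b) (hrow : ∀ a, ∑ b, m a b ≤ 1)
    {par : V → V} {r : V → ℕ} {Y : Finset V} (hY : ∀ y ∈ Y, r (par y) < r y) (s₀ : V → X) :
    ∑ s : V → X with ∀ x ∉ Y, s x = s₀ x, ∏ y ∈ Y, m (s (par y)) (s y) ≤ 1 := by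
  let g (x : V) (s : V → X) : ℝ :=
    if x ∈ Y then m (s (par x)) (s x) else if s x = s₀ x then 1 else 0
  have hprod (s : V → X) : ∏ x, g x s
      = if ∀ x ∉ Y, s x = s₀ x then ∏ y ∈ Y, m (s (par y)) (s y) else 0 := by
    rw [prod_ite, prod_boole, filter_mem_eq_inter, univ_inter]
    simp only [mem_filter_univ, mul_ite, mul_one, mul_zero]
  have hsum : ∑ s : V → X with ∀ x ∉ Y, s x = s₀ x, ∏ y ∈ Y, m (s (par y)) (s y)
      = ∑ s, ∏ x, g x s := by
    rw [sum_filter]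
    exact sum_congr rfl fun s _ => (hprod s).symm
  rw [hsum]
  refine sum_prod_le_one_of_adapted (r := r) (fun x s => ?_) (fun x y hxy hr s c => ?_)
    fun x s => ?_
  · dsimp only [g]
    split_ifs
    exacts [hm _ _, zero_le_one, le_rfl]
  · simp only [g, update_of_ne hxy]
    refine if_ctx_congr Iff.rfl (fun hx => ?_) fun _ => rfl
    have hpar : par x ≠ y := ne_of_apply_ne r ((hY x hx).trans_le hr).ne
    rw [update_of_ne hpar]
  · by_cases hx : x ∈ Y
    · have hpar : par x ≠ x := ne_of_apply_ne r (hY x hx).ne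
      simpa [g, hx, hpar] using hrow (s (par x))
    · simp [g, hx]

section ParentMap

variable {V : Type*} {T : SimpleGraph V} {u : V} {par : V → V}

/-- `par` is a parent map of the graph `T` rooted at `u`: every vertex other than `u` is sent to a
neighbour that is closer to `u`. Its value at `u` is arbitrary. -/
structure IsParentMap (T : SimpleGraph V) (u : V) (par : V → V) : Prop where
  adj : ∀ y ≠ u, T.Adj y (par y)
  dist_lt : ∀ y ≠ u, T.dist (par y) u < T.dist y u

theorem exists_isParentMap (hT : T.Connected) (u : V) : ∃ par, IsParentMap T u par := by
  have hex (y : V) : ∃ z, y ≠ u → T.Adj y z ∧ T.dist z u < T.dist y u := by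
    obtain ⟨p, hp⟩ := hT.exists_walk_length_eq_dist y u
    cases p with
    | nil => exact ⟨u, fun h => absurd rfl h⟩
    | @cons _ z _ hadj q =>
      rw [SimpleGraph.Walk.length_cons] at hp
      exact ⟨z, fun _ => ⟨hadj, by have := SimpleGraph.dist_le q; omega⟩⟩
  choose par hpar using hex
  exact ⟨par, fun y hy => (hpar y hy).1, fun y hy => (hpar y hy).2⟩

theorem IsParentMap.par_eq_of_adj (hpar : IsParentMap T u par) (hT : T.Connected) {v : V}
    (huv : T.Adj u v) : par v = u := by
  have hlt := hpar.dist_lt v huv.ne'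
  rw [SimpleGraph.dist_eq_one_iff_adj.2 huv.symm] at hlt
  exact hT.dist_eq_zero_iff.1 (by omega)

theorem IsParentMap.injOn (hpar : IsParentMap T u par) :
    Set.InjOn (fun y => s(y, par y)) {u}ᶜ := by
  intro y hy z hz h
  rcases Sym2.eq_iff.1 h with ⟨hyz, -⟩ | ⟨hyz, hzy⟩
  · exact hyz
  · have hy_lt := hpar.dist_lt y hy
    have hz_lt := hpar.dist_lt z hz
    rw [hzy] at hy_lt
    rw [← hyz] at hz_lt
    exact absurd hy_lt hz_lt.asymm

variable [Fintype V] [DecidableEq V] [DecidableRel T.Adj]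

theorem IsParentMap.image_eq_edgeFinset (hpar : IsParentMap T u par) (hT : T.IsTree) :
    (univ.erase u).image (fun y => s(y, par y)) = T.edgeFinset := by
  refine eq_of_subset_of_card_le ?_ ?_
  · simp only [image_subset_iff, mem_erase, SimpleGraph.mem_edgeFinset, SimpleGraph.mem_edgeSet]
    exact fun y hy => hpar.adj y hy.1
  · rw [card_image_of_injOn (hpar.injOn.mono (by simp)), card_erase_of_mem (mem_univ u), card_univ]
    exact Nat.le_pred_of_lt hT.card_edgeFinset.le

theorem IsParentMap.image_eq_edgeFinset_erase (hpar : IsParentMap T u par) (hT : T.IsTree) {v : V}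
    (huv : T.Adj u v) :
    ((univ.erase u).erase v).image (fun y => s(y, par y)) = T.edgeFinset.erase s(u, v) := by
  have hv : s(u, v) = s(v, par v) := by rw [hpar.par_eq_of_adj hT.1 huv, Sym2.eq_swap]
  rw [← hpar.image_eq_edgeFinset hT, hv]
  ext e
  simp only [mem_image, mem_erase, mem_univ, and_true]
  constructor
  · rintro ⟨y, ⟨hyv, hyu⟩, rfl⟩
    exact ⟨fun h => hyv (hpar.injOn hyu huv.ne' h), y, hyu, rfl⟩
  · rintro ⟨hev, y, hyu, rfl⟩
    exact ⟨y, ⟨fun h => hev (h ▸ rfl), hyu⟩, rfl⟩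

theorem prod_pow_degree {R : Type*} [CommMonoid R] (T : SimpleGraph V) [DecidableRel T.Adj]
    (c : V → R) : ∏ x, c x ^ T.degree x = ∏ e ∈ T.edgeFinset, ∏ x with x ∈ e, c x := by
  simp only [prod_filter]
  rw [prod_comm]
  refine prod_congr rfl fun x _ => ?_
  rw [← T.card_incidenceFinset_eq_degree x, T.incidenceFinset_eq_filter, prod_ite,
    prod_const, prod_const_one, mul_one]

theorem IsParentMap.prod_pow_degree (hpar : IsParentMap T u par) (hT : T.IsTree) {R : Type*}
    [CommMonoid R] (c : V → R) :
    ∏ x, c x ^ T.degree x = (∏ y ∈ univ.erase u, c y) * ∏ y ∈ univ.erase u, c (par y) := by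
  rw [AlmostDegree.prod_pow_degree, ← hpar.image_eq_edgeFinset hT,
    prod_image (hpar.injOn.mono (by simp)), ← prod_mul_distrib]
  refine prod_congr rfl fun y hy => ?_
  have hpair : ({x | x ∈ s(y, par y)} : Finset V) = {y, par y} := by ext x; simp
  rw [hpair, prod_pair (hpar.adj y (ne_of_mem_erase hy)).ne]

end ParentMap

section Embeddings

variable {n k : ℕ} {T : SimpleGraph (Fin k)} {D : Fin n → ℕ}

open Classical in
theorem bFunction_eq (hT : T.IsTree) (hD : ∀ i, 1 ≤ D i) {u v : Fin k} (huv : T.Adj u v)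
    {par : Fin k → Fin k} (hpar : IsParentMap T u par) (s : Fin k ↪ Fin n) :
    bFunction s T D = ∏ y ∈ (univ.erase u).erase v, (D (s (par y)) : ℝ) := by
  have hpos (x) : (0 : ℝ) < D (s x) := by exact_mod_cast hD (s x)
  have hmul : bFunction s T D * ∏ x, (D (s x) : ℝ) = ∏ x, (D (s x) : ℝ) ^ T.degree x := by
    rw [bFunction, ← prod_mul_distrib]
    refine prod_congr rfl fun x _ => ?_
    rw [zpow_sub₀ (hpos x).ne', zpow_one, zpow_natCast, div_mul_cancel₀ _ (hpos x).ne']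
  rw [hpar.prod_pow_degree hT, ← mul_prod_erase univ _ (mem_univ u),
    ← mul_prod_erase (univ.erase u) (fun y => (D (s (par y)) : ℝ)) (a := v) (by simp [huv.ne']),
    hpar.par_eq_of_adj hT.1 huv] at hmul
  have hprod : (0 : ℝ) < D (s u) * ∏ y ∈ univ.erase u, (D (s y) : ℝ) :=
    mul_pos (hpos u) (prod_pos fun y _ => hpos y)
  exact mul_right_cancel₀ hprod.ne' (hmul.trans (by ring))

open Classical in
theorem sum_embedding_le {W : Sym2 (Fin n) → ℝ} (hT : T.IsTree) (hD : ∀ i, 1 ≤ D i)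
    (hW : ∀ e, 0 ≤ W e) (hrow : ∀ i, ∑ j, W s(i, j) ≤ 3 * D i) {u v : Fin k} (huv : T.Adj u v)
    (i j : Fin n) :
    ∑ s : Fin k ↪ Fin n with s u = i ∧ s v = j,
      1 / bFunction s T D * ∏ f ∈ T.edgeFinset.erase s(u, v), W (f.map s) ≤ 3 ^ k := by
  obtain ⟨par, hpar⟩ := exists_isParentMap hT.1 u
  have : Nonempty (Fin n) := ⟨i⟩
  set Y := (univ.erase u).erase v
  have hYu {y} (hy : y ∈ Y) : y ≠ u := ne_of_mem_erase (mem_of_mem_erase hy)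
  have hDpos (a) : (0 : ℝ) < 3 * D a := mul_pos three_pos (by exact_mod_cast hD a)
  let m (a b : Fin n) : ℝ := W s(b, a) / (3 * D a)
  have hm (a b) : 0 ≤ m a b := div_nonneg (hW _) (hDpos a).le
  have hm_row (a) : ∑ b, m a b ≤ 1 := by
    rw [← Finset.sum_div, div_le_one (hDpos a)]
    simpa only [Sym2.eq_swap] using hrow a
  have hterm (s : Fin k ↪ Fin n) :
      1 / bFunction s T D * ∏ f ∈ T.edgeFinset.erase s(u, v), W (f.map s)
        = 3 ^ #Y * ∏ y ∈ Y, m (s (par y)) (s y) := by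
    rw [← hpar.image_eq_edgeFinset_erase hT huv,
      prod_image (hpar.injOn.mono fun y hy => hYu hy), bFunction_eq hT hD huv hpar s]
    simp only [m, prod_div_distrib, prod_mul_distrib, prod_const, Sym2.map_mk]
    field_simp
    rfl
  let s₀ (x : Fin k) : Fin n := if x = u then i else j
  have hs₀ (s : Fin k ↪ Fin n) (hs : s u = i ∧ s v = j) (x : Fin k) (hx : x ∉ Y) : s x = s₀ x := by
    grind
  have hYk : #Y ≤ k := by simpa using card_le_univ Y
  simp only [hterm]
  rw [← Finset.mul_sum]
  calc (3 : ℝ) ^ #Y * ∑ s : Fin k ↪ Fin n with s u = i ∧ s v = j, ∏ y ∈ Y, m (s (par y)) (s y)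
      ≤ 3 ^ #Y * ∑ s : Fin k → Fin n with ∀ x ∉ Y, s x = s₀ x, ∏ y ∈ Y, m (s (par y)) (s y) := by
        gcongr
        refine (sum_map _ ⟨fun s : Fin k ↪ Fin n => ⇑s, DFunLike.coe_injective⟩
          fun s => ∏ y ∈ Y, m (s (par y)) (s y)).symm.trans_le ?_
        refine sum_le_sum_of_subset_of_nonneg (fun f hf => ?_) fun f _ _ =>
          prod_nonneg fun y _ => hm _ _
        obtain ⟨s, hs, rfl⟩ := mem_map.1 hf
        exact (mem_filter_univ _).2 (hs₀ s (mem_filter.1 hs).2)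
    _ ≤ 3 ^ k := by
        refine (mul_le_of_le_one_right (by positivity) ?_).trans
          (pow_le_pow_right₀ (by norm_num) hYk)
        have hext := sum_extensions_le hm hm_row (r := fun y => T.dist y u)
          (fun y hy => hpar.dist_lt y (hYu hy)) s₀
        exact (sum_congr (by congr) fun _ _ => rfl).trans_le hext

end Embeddings

section Encoding

open Real

variable {n k : ℕ}

/-- The edges of the complete graph on `Fin n`. -/
abbrev Edge (n : ℕ) : Type := {e : Sym2 (Fin n) // ¬ e.IsDiag}

open Classical in
/-- The encoding of a graph by its adjacency bits, one for each edge of the complete graph. -/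
noncomputable def graphBits (n : ℕ) : SimpleGraph (Fin n) ≃ (Edge n → Bool) where
  toFun G e := decide (e.1 ∈ G.edgeSet)
  invFun ω := SimpleGraph.fromEdgeSet {e | ∃ h : ¬ e.IsDiag, ω ⟨e, h⟩ = true}
  left_inv G := by
    ext i j
    simp only [SimpleGraph.fromEdgeSet_adj, Set.mem_ofPred_eq, Sym2.mk_isDiag_iff,
      decide_eq_true_eq, SimpleGraph.mem_edgeSet, exists_prop]
    exact ⟨fun h => h.1.2, fun h => ⟨⟨h.ne, h⟩, h.ne⟩⟩
  right_inv ω := by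
    funext ⟨e, he⟩
    apply Bool.eq_iff_iff.2
    simp only [decide_eq_true_eq, SimpleGraph.edgeSet_fromEdgeSet,
      Set.mem_sdiff, Set.mem_ofPred_eq]
    exact ⟨fun h => h.1.2, fun h => ⟨⟨he, h⟩, he⟩⟩

theorem bit_graphBits (G : SimpleGraph (Fin n)) (e : Edge n) :
    bit (graphBits n G e) = G.edgeSet.indicator 1 e.1 := by
  classical
  simp [bit, graphBits, Set.indicator_apply]

theorem indicator_edgeSet_of_isDiag (G : SimpleGraph (Fin n)) {e : Sym2 (Fin n)} (he : e.IsDiag) :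
    G.edgeSet.indicator (1 : Sym2 (Fin n) → ℝ) e = 0 :=
  Set.indicator_of_notMem (fun h => G.not_isDiag_of_mem_edgeSet h he) _

open Classical in
theorem sum_indicator_edgeSet (G : SimpleGraph (Fin n)) (i : Fin n) :
    ∑ j, G.edgeSet.indicator (1 : Sym2 (Fin n) → ℝ) s(i, j) = G.degree i := by
  simp only [Set.indicator_apply, SimpleGraph.mem_edgeSet, Pi.one_apply]
  rw [sum_boole, ← G.card_neighborFinset_eq_degree, G.neighborFinset_eq_filter]

theorem sum_filter_mem (g : Sym2 (Fin n) → ℝ) (v : Fin n) :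
    ∑ e : Sym2 (Fin n) with v ∈ e, g e = ∑ j, g s(v, j) := by
  have himage : ({e | v ∈ e} : Finset (Sym2 (Fin n))) = univ.image fun j => s(v, j) := by
    ext e
    simp [Sym2.mem_iff_exists, eq_comm]
  rw [himage, sum_image fun _ _ _ _ h => Sym2.congr_right.1 h]

theorem sum_edge (g : Sym2 (Fin n) → ℝ) :
    ∑ e : Edge n, g e.1 = ∑ e : Sym2 (Fin n) with ¬ e.IsDiag, g e :=
  (sum_subtype _ (by simp) g).symm

theorem prod_edge (g : Sym2 (Fin n) → ℝ) :
    ∏ e : Edge n, g e.1 = ∏ i, ∏ j with i < j, g s(i, j) := by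
  have hsym2 : ∏ e : Sym2 (Fin n) with ¬ e.IsDiag, g e
      = ∏ q ∈ univ.offDiag with q.1 < q.2, g s(q.1, q.2) :=
    sum_sym2_filter_not_isDiag (M := Additive ℝ) univ g
  have hfilter : ({q ∈ univ.offDiag | q.1 < q.2} : Finset (Fin n × Fin n))
      = ({q | q.1 < q.2} : Finset (Fin n × Fin n)) := by
    ext q
    simpa using ne_of_lt
  rw [← prod_subtype {e | ¬ e.IsDiag} (by simp) g, hsym2, hfilter, prod_filter,
    ← univ_product_univ, prod_product]
  simp only [prod_filter]

/-- The edge probabilities `sigmoid (l i + l j)` of a dual solution `l`, as a function of the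
unordered pair `{i, j}`. Unlike `dualProb`, it does not vanish on the diagonal, which is never
used. -/
noncomputable def edgeProb (l : Fin n → ℝ) : Sym2 (Fin n) → ℝ :=
  Sym2.lift ⟨fun i j => sigmoid (l i + l j), fun i j => by simp only [add_comm]⟩

theorem edgeProb_mk (l : Fin n → ℝ) (i j : Fin n) :
    edgeProb l s(i, j) = sigmoid (l i + l j) := rfl

theorem edgeProb_mem_Ioo (l : Fin n → ℝ) (e : Sym2 (Fin n)) : edgeProb l e ∈ Set.Ioo 0 1 := by
  induction e using Sym2.ind with
  | _ i j => exact ⟨sigmoid_pos _, sigmoid_lt_one _⟩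

theorem edgeProb_mem_Icc (l : Fin n → ℝ) (e : Sym2 (Fin n)) : edgeProb l e ∈ Set.Icc 0 1 :=
  Set.Ioo_subset_Icc_self (edgeProb_mem_Ioo l e)

variable {D : Fin n → ℕ} {l : Fin n → ℝ}

theorem IsDual.bernoulliProb_eq (hl : IsDual D l) (G : SimpleGraph (Fin n)) :
    bernoulliProb (maxEntropy D) G
      = bitWeight (fun e : Edge n => edgeProb l e.1) (graphBits n G) := by
  classical
  have hprod := prod_edge fun e => if e ∈ G.edgeSet then edgeProb l e else 1 - edgeProb l e
  rw [bernoulliProb, bitWeight, hl.maxEntropy_eq]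
  simp only [graphBits, Equiv.coe_fn_mk, decide_eq_true_eq]
  rw [hprod]
  refine prod_congr rfl fun i _ => prod_congr rfl fun j hj => ?_
  have hij : i < j := (mem_filter_univ _).1 hj
  simp only [SimpleGraph.mem_edgeSet, edgeProb_mk, dualProb_of_ne l hij.ne]

open Classical in
theorem IsDual.bernoulliProb_eq_exp (hl : IsDual D l) (G : SimpleGraph (Fin n)) :
    bernoulliProb (maxEntropy D) G = exp ((∑ i, (G.degree i : ℝ) * l i)
      - ∑ i, ∑ j with i < j, softplus (l i + l j)) := by
  have hdeg (i) : ∑ j with j ≠ i, G.edgeSet.indicator (1 : Sym2 (Fin n) → ℝ) s(i, j)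
      = G.degree i := by
    rw [← sum_indicator_edgeSet, sum_filter_of_ne]
    rintro j - hj rfl
    exact hj (indicator_edgeSet_of_isDiag G (Sym2.mk_isDiag_iff.2 rfl))
  simp only [← hdeg]
  rw [← sum_lt_mul_add (fun i j => by rw [Sym2.eq_swap]) l, ← sum_sub_distrib,
    exp_sum, bernoulliProb, hl.maxEntropy_eq]
  refine prod_congr rfl fun i _ => ?_
  rw [← sum_sub_distrib, exp_sum]
  refine prod_congr rfl fun j hj => ?_
  have hij : i < j := (mem_filter_univ _).1 hj
  simp only [dualProb_of_ne l hij.ne, Set.indicator_apply, SimpleGraph.mem_edgeSet, Pi.one_apply]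
  split_ifs
  · rw [one_mul, ← log_sigmoid, exp_log (sigmoid_pos _)]
  · rw [zero_mul, zero_sub, ← log_one_sub_sigmoid, exp_log (sub_pos.2 (sigmoid_lt_one _))]

theorem IsDual.sum_bernoulliProb_mul (hl : IsDual D l) (f : SimpleGraph (Fin n) → ℝ) :
    ∑ G, bernoulliProb (maxEntropy D) G * f G
      = ∑ ω : Edge n → Bool, bitWeight (fun e : Edge n => edgeProb l e.1) ω
          * f ((graphBits n).symm ω) :=
  Fintype.sum_equiv (graphBits n) _ _ fun G => by
    rw [hl.bernoulliProb_eq, Equiv.symm_apply_apply]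

open Classical in
/-- The edges of the image of `T` under `s`. -/
noncomputable def treeEdges (s : Fin k ↪ Fin n) (T : SimpleGraph (Fin k)) : Finset (Edge n) :=
  {e | e.1 ∈ T.edgeFinset.image (Sym2.map s)}

theorem not_isDiag_map (s : Fin k ↪ Fin n) {f : Sym2 (Fin k)} (hf : ¬ f.IsDiag) :
    ¬ (f.map s).IsDiag := by
  induction f using Sym2.ind with
  | _ a b => simpa using hf

open Classical in
theorem prod_treeEdges (s : Fin k ↪ Fin n) (T : SimpleGraph (Fin k)) (g : Sym2 (Fin n) → ℝ) :
    ∏ e ∈ treeEdges s T, g e.1 = ∏ f ∈ T.edgeFinset, g (f.map s) := by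
  rw [← prod_image (f := g) (g := Sym2.map s) fun _ _ _ _ h => Sym2.map.injective s.injective h]
  refine prod_nbij Subtype.val (fun e he => (mem_filter.1 he).2) Subtype.val_injective.injOn
    (fun e he => ?_) fun _ _ => rfl
  obtain ⟨f, hf, rfl⟩ := mem_image.1 (mem_coe.1 he)
  exact ⟨⟨f.map s, not_isDiag_map s (SimpleGraph.not_isDiag_of_mem_edgeFinset hf)⟩,
    (mem_filter_univ _).2 he, rfl⟩

theorem treeIndicator_eq (s : Fin k ↪ Fin n) (T : SimpleGraph (Fin k)) (G : SimpleGraph (Fin n)) :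
    treeIndicator s T G = ∏ e ∈ treeEdges s T, bit (graphBits n G e) := by
  classical
  simp only [bit_graphBits]
  rw [prod_treeEdges s T (G.edgeSet.indicator 1), treeIndicator]
  simp only [Set.indicator_apply, Pi.one_apply]

theorem IsDual.probIndep_eq (hl : IsDual D l) (s : Fin k ↪ Fin n) (T : SimpleGraph (Fin k)) :
    probIndep D s T = ∏ e ∈ treeEdges s T, edgeProb l e.1 := by
  classical
  rw [probIndep, hl.sum_bernoulliProb_mul]
  have hprod := sum_bitWeight_mul_prod (fun e : Edge n => edgeProb l e.1)
    (fun e b => if e ∈ treeEdges s T then bit b else 1)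
  simp only [prod_ite_mem, univ_inter] at hprod
  simp only [treeIndicator_eq, Equiv.apply_symm_apply]
  rw [hprod, ← prod_subset (subset_univ (treeEdges s T)) fun e _ he => by simp [he]]
  exact prod_congr rfl fun e he => by simp [he, bit]

end Encoding

section LowerBound

open Real

variable {n : ℕ} {D : Fin n → ℕ} {l : Fin n → ℝ} {S : Finset (Fin n)}

open Classical in
theorem mem_almostGraphs {a : ℝ} {G : SimpleGraph (Fin n)} :
    G ∈ almostGraphs a D ↔ ∀ i, |(D i : ℝ) - G.degree i| < (D i : ℝ) ^ a := by
  simp only [almostGraphs, graphsWithDegrees, Set.mem_iUnion]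
  refine ⟨?_, fun h => ⟨fun i => G.degree i, h, fun i => rfl⟩⟩
  rintro ⟨D', hD', hG⟩ i
  rw [hG i]
  exact hD' i

theorem sum_edge_mem (g : Sym2 (Fin n) → ℝ) (v : Fin n) :
    ∑ e : Edge n with v ∈ e.1, g e.1 = ∑ j with j ≠ v, g s(v, j) := by
  have hedge := sum_edge fun e => if v ∈ e then g e else 0
  have hmem := sum_filter_mem (fun e => if ¬ e.IsDiag then g e else 0) v
  simp only [← sum_filter, Sym2.mk_isDiag_iff] at hedge hmem
  rw [hedge, filter_filter]
  simpa only [filter_filter, and_comm, ne_comm] using hmem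

open Classical in
theorem degree_eq_sum_bit (G : SimpleGraph (Fin n)) (v : Fin n) :
    (G.degree v : ℝ) = ∑ e : Edge n with v ∈ e.1, bit (graphBits n G e) := by
  simp only [bit_graphBits]
  rw [sum_edge_mem (G.edgeSet.indicator 1), ← sum_indicator_edgeSet, sum_filter_of_ne]
  rintro j - hj rfl
  exact hj (indicator_edgeSet_of_isDiag G (Sym2.mk_isDiag_iff.2 rfl))

theorem IsDual.sum_edgeProb (hl : IsDual D l) (v : Fin n) :
    ∑ e : Edge n with v ∈ e.1, edgeProb l e.1 = D v :=
  (sum_edge_mem _ v).trans (hl v)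

theorem wdeg_eq_of_mem (g : Sym2 (Fin n) → ℝ) {v : Fin n} (hv : v ∈ S) :
    wdeg S g v = ∑ e : Edge n with v ∈ e.1, g e.1 := by
  have hedge := sum_edge fun e => if v ∈ e then g e else 0
  simp only [← sum_filter, filter_filter] at hedge
  rw [hedge, wdeg]
  congr 1
  ext e
  simp only [mem_filter, mem_univ, true_and, mem_meeting]
  exact ⟨fun h => ⟨h.1.1, h.2⟩, fun h => ⟨⟨h.1, v, hv, h.2⟩, h.2⟩⟩

theorem IsDual.wdeg_edgeProb (hl : IsDual D l) {v : Fin n} (hv : v ∈ S) :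
    wdeg S (edgeProb l) v = D v := by
  rw [wdeg_eq_of_mem _ hv, hl.sum_edgeProb]

theorem sum_meeting_le {V : Type*} [DecidableEq V] [Fintype V] (S : Finset V) {g : Sym2 V → ℝ}
    (hg : ∀ e ∈ meeting S, 0 ≤ g e) : ∑ e ∈ meeting S, g e ≤ ∑ i ∈ S, wdeg S g i := by
  simp only [wdeg, sum_filter]
  rw [sum_comm]
  refine sum_le_sum fun e he => ?_
  obtain ⟨-, i, hi, hie⟩ := mem_meeting.1 he
  calc g e = if i ∈ e then g e else 0 := (if_pos hie).symm
    _ ≤ ∑ j ∈ S, if j ∈ e then g e else 0 :=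
      single_le_sum (f := fun j => if j ∈ e then g e else 0)
        (fun j _ => by split_ifs; exacts [hg e he, le_rfl]) hi

/-- The edge probabilities of a dual solution, with the edges meeting `S` frozen in the
configuration `y`. -/
noncomputable def pinnedProb (l : Fin n → ℝ) (S : Finset (Fin n)) (y : Sym2 (Fin n) → ℝ) :
    Sym2 (Fin n) → ℝ :=
  (meeting S).piecewise y (edgeProb l)

section Pinned

variable {y : Sym2 (Fin n) → ℝ}

theorem pinnedProb_mem_Icc (hy : IsRounding S (edgeProb l) y) (e : Sym2 (Fin n)) :
    pinnedProb l S y e ∈ Set.Icc 0 1 := by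
  by_cases he : e ∈ meeting S
  · rw [pinnedProb, piecewise_eq_of_mem _ _ _ he]
    exact hy.mem_Icc e he
  · rw [pinnedProb, piecewise_eq_of_notMem _ _ _ he]
    exact edgeProb_mem_Icc l e

theorem sum_pinnedProb_sub (l : Fin n → ℝ) (y : Sym2 (Fin n) → ℝ) (v : Fin n) :
    ∑ e : Edge n with v ∈ e.1, pinnedProb l S y e.1 - ∑ e : Edge n with v ∈ e.1, edgeProb l e.1
      = wdeg S y v - wdeg S (edgeProb l) v := by
  have hedge := sum_edge fun e =>
    if v ∈ e then pinnedProb l S y e - edgeProb l e else 0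
  rw [← sum_sub_distrib, sum_filter, hedge, wdeg, wdeg, ← sum_sub_distrib, ← sum_filter,
    filter_filter]
  symm
  refine sum_subset_zero_on_sdiff (fun e he => ?_) (fun e he => ?_) fun e he => ?_
  · obtain ⟨he, hv⟩ := mem_filter.1 he
    exact (mem_filter_univ _).2 ⟨(mem_meeting.1 he).1, hv⟩
  · have hS : e ∉ meeting S := by
      simp only [mem_sdiff, mem_filter, mem_univ, true_and, not_and] at he
      exact fun h => he.2 h he.1.2
    rw [pinnedProb, piecewise_eq_of_notMem _ _ _ hS, sub_self]
  · rw [pinnedProb, piecewise_eq_of_mem _ _ _ (mem_filter.1 he).1]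

theorem IsDual.sum_pinnedProb_of_mem (hl : IsDual D l) (hy : IsRounding S (edgeProb l) y)
    {v : Fin n} (hv : v ∈ S) : ∑ e : Edge n with v ∈ e.1, pinnedProb l S y e.1 = D v := by
  have hsub := sum_pinnedProb_sub (S := S) l y v
  rw [hl.sum_edgeProb, hy.wdeg_eq v hv, sub_self] at hsub
  exact sub_eq_zero.1 hsub

theorem IsDual.abs_sum_pinnedProb_sub_le (hl : IsDual D l) (hy : IsRounding S (edgeProb l) y)
    {v : Fin n} (hv : v ∉ S) : |∑ e : Edge n with v ∈ e.1, pinnedProb l S y e.1 - D v| ≤ 3 := by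
  rw [← hl.sum_edgeProb v, sum_pinnedProb_sub]
  exact hy.abs_wdeg_sub_le v hv

theorem IsDual.mem_almostGraphs_of_pinned (hl : IsDual D l) (hpos : ∀ i, 1 ≤ D i)
    (hy : IsRounding S (edgeProb l) y) {a : ℝ} (hsix : ∀ v ∉ S, 6 ≤ (D v : ℝ) ^ a)
    {ω : Edge n → Bool} (hω : bitWeight (fun e : Edge n => pinnedProb l S y e.1) ω ≠ 0)
    (hdev : ∀ v ∉ S, |∑ e : Edge n with v ∈ e.1, (bit (ω e) - pinnedProb l S y e.1)|
      < (D v : ℝ) ^ a / 2) :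
    (graphBits n).symm ω ∈ almostGraphs a D := by
  classical
  refine mem_almostGraphs.2 fun v => ?_
  rw [degree_eq_sum_bit, Equiv.apply_symm_apply, abs_sub_comm]
  by_cases hv : v ∈ S
  · have hpinned : ∑ e : Edge n with v ∈ e.1, bit (ω e) = D v := by
      rw [← hl.sum_pinnedProb_of_mem hy hv]
      refine sum_congr rfl fun e he => bit_eq_of_bitWeight_ne_zero hω ?_
      have hmeet : e.1 ∈ meeting S := mem_meeting.2 ⟨e.2, v, hv, (mem_filter.1 he).2⟩
      simpa only [pinnedProb, piecewise_eq_of_mem _ _ _ hmeet] using hy.integral e.1 hmeet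
    rw [hpinned, sub_self, abs_zero]
    exact rpow_pos_of_pos (by exact_mod_cast hpos v) a
  · have hmean := hl.abs_sum_pinnedProb_sub_le hy hv
    have hdevv := hdev v hv
    rw [sum_sub_distrib] at hdevv
    calc |∑ e : Edge n with v ∈ e.1, bit (ω e) - D v|
        ≤ |∑ e : Edge n with v ∈ e.1, bit (ω e) - ∑ e : Edge n with v ∈ e.1, pinnedProb l S y e.1|
          + |∑ e : Edge n with v ∈ e.1, pinnedProb l S y e.1 - D v| := abs_sub_le _ _ _
      _ < (D v : ℝ) ^ a := by linarith [hsix v hv]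

theorem IsDual.prob_large_deviation_le (hl : IsDual D l) (hpos : ∀ i, 1 ≤ D i)
    (hy : IsRounding S (edgeProb l) y) {a : ℝ} (ha : a ≤ 1) {v : Fin n} (hv : v ∉ S) :
    ∑ ω : Edge n → Bool with
        (D v : ℝ) ^ a / 2 ≤ |∑ e : Edge n with v ∈ e.1, (bit (ω e) - pinnedProb l S y e.1)|,
      bitWeight (fun e : Edge n => pinnedProb l S y e.1) ω
      ≤ 2 * exp (-((D v : ℝ) ^ (2 * a - 1) / 64)) := by
  have hD : (1 : ℝ) ≤ D v := by exact_mod_cast hpos v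
  have hD0 : (0 : ℝ) < D v := by linarith
  set θ : ℝ := (D v : ℝ) ^ (a - 1) / 16 with hθ_def
  have hθ : θ ∈ Set.Icc 0 1 := by
    have hle := rpow_le_one_of_one_le_of_nonpos hD (sub_nonpos.2 ha)
    exact ⟨by positivity, by linarith⟩
  have hmean : ∑ e : Edge n with v ∈ e.1, pinnedProb l S y e.1 ≤ 4 * D v := by
    linarith [(_root_.abs_le.1 (hl.abs_sum_pinnedProb_sub_le hy hv)).2]
  have hfirst : θ * ((D v : ℝ) ^ a / 2) = (D v : ℝ) ^ (2 * a - 1) / 32 := by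
    rw [hθ_def, show 2 * a - 1 = (a - 1) + a by ring, rpow_add hD0]
    ring
  have hsecond : θ ^ 2 * (4 * D v) = (D v : ℝ) ^ (2 * a - 1) / 64 := by
    rw [hθ_def, show 2 * a - 1 = (a - 1) + (a - 1) + 1 by ring, rpow_add hD0, rpow_add hD0,
      rpow_one]
    ring
  have hchernoff := sum_bitWeight_le_of_le_abs (p := fun e : Edge n => pinnedProb l S y e.1)
    (fun e => pinnedProb_mem_Icc hy e.1) {e | v ∈ e.1} hθ ((D v : ℝ) ^ a / 2)
  refine hchernoff.trans (mul_le_mul_of_nonneg_left (exp_le_exp.2 ?_) two_pos.le)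
  linarith [mul_le_mul_of_nonneg_left hmean (sq_nonneg θ)]

open Classical in
theorem IsDual.half_le_pinned_prob_almostGraphs (hl : IsDual D l) (hpos : ∀ i, 1 ≤ D i)
    (hy : IsRounding S (edgeProb l) y) {a : ℝ} (ha : a ≤ 1) (hsix : ∀ v ∉ S, 6 ≤ (D v : ℝ) ^ a)
    (hexp : ∀ v ∉ S, 2 * exp (-((D v : ℝ) ^ (2 * a - 1) / 64)) ≤ 1 / (2 * n)) :
    1 / 2 ≤ ∑ ω : Edge n → Bool with (graphBits n).symm ω ∈ almostGraphs a D,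
      bitWeight (fun e : Edge n => pinnedProb l S y e.1) ω := by
  let q (e : Edge n) : ℝ := pinnedProb l S y e.1
  have hq (ω) : 0 ≤ bitWeight q ω := bitWeight_nonneg (fun e => pinnedProb_mem_Icc hy e.1) ω
  let bad (v : Fin n) : Finset (Edge n → Bool) :=
    {ω | (D v : ℝ) ^ a / 2 ≤ |∑ e : Edge n with v ∈ e.1, (bit (ω e) - q e)|}
  have hunion : ∑ ω, bitWeight q ω
      ≤ ∑ ω with (graphBits n).symm ω ∈ almostGraphs a D, bitWeight q ω
        + ∑ v ∈ Sᶜ, ∑ ω ∈ bad v, bitWeight q ω := by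
    rw [sum_comm' (t' := univ) (s' := fun ω => {v ∈ Sᶜ | ω ∈ bad v}) (by simp [and_comm]),
      sum_filter, ← sum_add_distrib]
    refine sum_le_sum fun ω _ => ?_
    have hbad_nonneg : 0 ≤ ∑ v ∈ Sᶜ with ω ∈ bad v, bitWeight q ω := sum_nonneg fun _ _ => hq ω
    by_cases hmem : (graphBits n).symm ω ∈ almostGraphs a D
    · simpa [hmem] using hbad_nonneg
    by_cases hω : bitWeight q ω = 0
    · simp [hω]
    · obtain ⟨v, hv, hdev⟩ : ∃ v ∉ S, ω ∈ bad v := by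
        by_contra! hall
        exact hmem (hl.mem_almostGraphs_of_pinned hpos hy hsix hω fun v hv =>
          not_le.1 fun h => hall v hv ((mem_filter_univ _).2 h))
      rw [if_neg hmem, zero_add]
      exact single_le_sum (f := fun _ => bitWeight q ω) (fun _ _ => hq ω)
        (mem_filter.2 ⟨mem_compl.2 hv, hdev⟩)
  have hsum : ∑ v ∈ Sᶜ, ∑ ω ∈ bad v, bitWeight q ω ≤ 1 / 2 := by
    calc ∑ v ∈ Sᶜ, ∑ ω ∈ bad v, bitWeight q ω
        ≤ #Sᶜ • (1 / (2 * n) : ℝ) := sum_le_card_nsmul _ _ _ fun v hv =>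
          (hl.prob_large_deviation_le hpos hy ha (mem_compl.1 hv)).trans (hexp v (mem_compl.1 hv))
      _ ≤ n * (1 / (2 * n)) := by
          rw [nsmul_eq_mul]
          gcongr
          exact (card_le_univ _).trans_eq (Fintype.card_fin n)
      _ ≤ 1 / 2 := by
          rcases n.eq_zero_or_pos with rfl | hn
          · simp
          · exact le_of_eq (by field_simp)
  rw [sum_bitWeight] at hunion
  linarith

end Pinned

theorem exp_neg_le_sigmoid {Λ t : ℝ} (ht : |t| ≤ 2 * Λ) : exp (-(2 * Λ + 1)) ≤ sigmoid t := by
  have hexp : exp (-t) ≤ exp (2 * Λ) := exp_le_exp.2 (by linarith [(abs_le.1 ht).1])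
  have hone : 1 ≤ exp (2 * Λ) := one_le_exp ((abs_nonneg t).trans ht)
  have htwo : 2 ≤ exp 1 := by linarith [add_one_le_exp (1 : ℝ)]
  rw [sigmoid_def, exp_neg, exp_add]
  exact inv_anti₀ (by positivity) (by nlinarith)

theorem exp_neg_le_edgeProb {Λ : ℝ} (hΛ : ∀ i, |l i| ≤ Λ) (e : Sym2 (Fin n)) :
    exp (-(2 * Λ + 1)) ≤ edgeProb l e ∧ exp (-(2 * Λ + 1)) ≤ 1 - edgeProb l e := by
  induction e using Sym2.ind with
  | _ i j =>
    have hij : |l i + l j| ≤ 2 * Λ := (abs_add_le _ _).trans (by linarith [hΛ i, hΛ j])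
    rw [edgeProb_mk, ← sigmoid_neg]
    exact ⟨exp_neg_le_sigmoid hij, exp_neg_le_sigmoid (by rwa [abs_neg])⟩

theorem exp_neg_mul_le_one_sub {c p : ℝ} (hc : 1 ≤ c) (hp : 0 ≤ p) (h : exp (-c) ≤ 1 - p) :
    exp (-(c * (2 * p))) ≤ 1 - p := by
  rcases le_total p (1 / 2) with hp2 | hp2
  · calc exp (-(c * (2 * p))) ≤ exp (-(2 * p)) := exp_le_exp.2 (by nlinarith)
      _ ≤ (1 + 2 * p)⁻¹ := by
        rw [exp_neg]
        exact inv_anti₀ (by positivity) (by linarith [add_one_le_exp (2 * p)])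
      _ ≤ 1 - p := by
        rw [inv_le_iff_one_le_mul₀ (by linarith)]
        nlinarith
  · exact (exp_le_exp.2 (by nlinarith)).trans h

/-- The density of a point mass at `y` against a Bernoulli measure. For `y = 0` the cost is of
order `p`, which keeps the total cost of freezing edges proportional to the degrees. -/
theorem exp_neg_mul_ite_le_ite {c p y : ℝ} (hc : 1 ≤ c) (hp : 0 ≤ p) (hcp : exp (-c) ≤ p)
    (hcp' : exp (-c) ≤ 1 - p) (hy : y = 0 ∨ y = 1) (b : Bool) :
    exp (-(c * (y + 2 * p))) * (if b then y else 1 - y) ≤ if b then p else 1 - p := by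
  have hp1 : 0 ≤ 1 - p := (exp_pos _).le.trans hcp'
  rcases hy with rfl | rfl <;> cases b
  · simpa using exp_neg_mul_le_one_sub hc hp hcp'
  · simpa using hp
  · simpa using hp1
  · simpa using (exp_le_exp.2 (by nlinarith)).trans hcp

theorem exp_neg_mul_bitWeight_pinnedProb_le {Λ : ℝ} (hΛ0 : 0 ≤ Λ) (hΛ : ∀ i, |l i| ≤ Λ)
    {y : Sym2 (Fin n) → ℝ} (hy : IsRounding S (edgeProb l) y) (ω : Edge n → Bool) :
    exp (-((2 * Λ + 1) * ∑ e ∈ meeting S, (y e + 2 * edgeProb l e)))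
        * bitWeight (fun e : Edge n => pinnedProb l S y e.1) ω
      ≤ bitWeight (fun e : Edge n => edgeProb l e.1) ω := by
  have hmeeting : ∑ e ∈ meeting S, (y e + 2 * edgeProb l e)
      = ∑ e : Edge n, if e.1 ∈ meeting S then y e.1 + 2 * edgeProb l e.1 else 0 := by
    rw [sum_edge fun e => if e ∈ meeting S then y e + 2 * edgeProb l e else 0, ← sum_filter,
      filter_filter]
    congr 1
    ext e
    simpa using fun he => (mem_meeting.1 he).1
  rw [hmeeting, Finset.mul_sum, ← sum_neg_distrib, exp_sum, bitWeight, ← prod_mul_distrib]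
  refine prod_le_prod (fun e _ => mul_nonneg (exp_pos _).le
    (ite_bit_nonneg (pinnedProb_mem_Icc hy e.1) _)) fun e _ => ?_
  by_cases he : e.1 ∈ meeting S
  · rw [if_pos he, pinnedProb, piecewise_eq_of_mem _ _ _ he]
    have hp := exp_neg_le_edgeProb hΛ e.1
    exact exp_neg_mul_ite_le_ite (by linarith) (edgeProb_mem_Icc l e.1).1 hp.1 hp.2
      (hy.integral e.1 he) (ω e)
  · rw [if_neg he, pinnedProb, piecewise_eq_of_notMem _ _ _ he, mul_zero, neg_zero, exp_zero,
      one_mul]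

theorem IsDual.sum_meeting_add_le (hl : IsDual D l) {y : Sym2 (Fin n) → ℝ}
    (hy : IsRounding S (edgeProb l) y) :
    ∑ e ∈ meeting S, (y e + 2 * edgeProb l e) ≤ 3 * ∑ i ∈ S, (D i : ℝ) := by
  have hrounded := sum_meeting_le S fun e he => (hy.mem_Icc e he).1
  have hdual := sum_meeting_le S fun e _ => (edgeProb_mem_Icc l e).1
  rw [sum_congr rfl fun i hi => (hy.wdeg_eq i hi).trans (hl.wdeg_edgeProb hi)] at hrounded
  rw [sum_congr rfl fun i hi => hl.wdeg_edgeProb hi] at hdual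
  rw [sum_add_distrib, ← Finset.mul_sum]
  linarith

open Classical in
theorem IsDual.prob_almostGraphs_ge (hl : IsDual D l) (hpos : ∀ i, 1 ≤ D i) {Λ : ℝ}
    (hΛ : ∀ i, |l i| ≤ Λ) {L a : ℝ} (hL0 : 0 ≤ L) (hL : ∃ v, L ≤ D v) (ha : a ≤ 1)
    (hsix : ∀ v, L ≤ D v → 6 ≤ (D v : ℝ) ^ a)
    (hexp : ∀ v, L ≤ D v → 2 * exp (-((D v : ℝ) ^ (2 * a - 1) / 64)) ≤ 1 / (2 * n)) :
    1 / 2 * exp (-((2 * Λ + 1) * (3 * (n * L))))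
      ≤ ∑ G : SimpleGraph (Fin n) with G ∈ almostGraphs a D, bernoulliProb (maxEntropy D) G := by
  obtain ⟨star, hstar⟩ := hL
  have hΛ0 : 0 ≤ Λ := (abs_nonneg _).trans (hΛ star)
  let S : Finset (Fin n) := {i | (D i : ℝ) < L}
  have hS {v} (hv : v ∉ S) : L ≤ D v := by simpa [S] using hv
  obtain ⟨y, hy⟩ := exists_isRounding (S := S) (x := edgeProb l) (star := star)
    (by simpa [S] using hstar) (fun e _ => edgeProb_mem_Icc l e)
    fun i hi => ⟨D i, by rw [hl.wdeg_edgeProb hi, Int.cast_natCast]⟩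
  have hDS : ∑ i ∈ S, (D i : ℝ) ≤ n * L := by
    calc ∑ i ∈ S, (D i : ℝ) ≤ #S • L :=
          sum_le_card_nsmul _ _ _ fun i hi => (mem_filter.1 hi).2.le
      _ ≤ n * L := by
          rw [nsmul_eq_mul]
          gcongr
          exact (card_le_univ _).trans_eq (Fintype.card_fin n)
  have hcost := (hl.sum_meeting_add_le hy).trans (mul_le_mul_of_nonneg_left hDS three_pos.le)
  calc 1 / 2 * exp (-((2 * Λ + 1) * (3 * (n * L))))
      ≤ (∑ ω : Edge n → Bool with (graphBits n).symm ω ∈ almostGraphs a D,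
          bitWeight (fun e : Edge n => pinnedProb l S y e.1) ω)
        * exp (-((2 * Λ + 1) * ∑ e ∈ meeting S, (y e + 2 * edgeProb l e))) := by
        refine mul_le_mul (hl.half_le_pinned_prob_almostGraphs hpos hy ha
          (fun v hv => hsix v (hS hv)) fun v hv => hexp v (hS hv)) (exp_le_exp.2 ?_)
          (exp_pos _).le (sum_nonneg fun ω _ =>
            bitWeight_nonneg (fun e => pinnedProb_mem_Icc hy e.1) ω)
        exact neg_le_neg (mul_le_mul_of_nonneg_left hcost (by linarith))
    _ ≤ ∑ ω : Edge n → Bool with (graphBits n).symm ω ∈ almostGraphs a D,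
          bitWeight (fun e : Edge n => edgeProb l e.1) ω := by
        rw [mul_comm, Finset.mul_sum]
        exact sum_le_sum fun ω _ => exp_neg_mul_bitWeight_pinnedProb_le hΛ0 hΛ hy ω
    _ = ∑ G : SimpleGraph (Fin n) with G ∈ almostGraphs a D, bernoulliProb (maxEntropy D) G := by
        simpa [sum_filter] using
          (hl.sum_bernoulliProb_mul fun G => if G ∈ almostGraphs a D then 1 else 0).symm

end LowerBound

section ExpansionCoefficients

variable {n k : ℕ} {D : Fin n → ℕ} {l : Fin n → ℝ}

theorem bFunction_nonneg (s : Fin k ↪ Fin n) (T : SimpleGraph (Fin k)) : 0 ≤ bFunction s T D :=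
  prod_nonneg fun _ _ => zpow_nonneg (Nat.cast_nonneg _) _

open Classical in
/-- The sum of `F` over all ordered trees `(s, T)` with `k` vertices, weighted by the inverse of
the B-function. -/
noncomputable def treeSum (D : Fin n → ℕ) (F : (Fin k ↪ Fin n) → SimpleGraph (Fin k) → ℝ) : ℝ :=
  ∑ s : Fin k ↪ Fin n, ∑ T : SimpleGraph (Fin k) with T.IsTree, 1 / bFunction s T D * F s T

theorem treeError_eq (a : ℝ) (k : ℕ) (D : Fin n → ℕ) :
    treeError a k D
      = 1 / total D * treeSum (k := k) D fun s T => |probAlmost a D s T - probIndep D s T| :=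
  rfl

theorem abs_treeSum_le {F F' : (Fin k ↪ Fin n) → SimpleGraph (Fin k) → ℝ}
    (h : ∀ s T, |F s T| ≤ F' s T) : |treeSum D F| ≤ treeSum D F' := by
  refine (abs_sum_le_sum_abs _ _).trans (sum_le_sum fun s _ => ?_)
  refine (abs_sum_le_sum_abs _ _).trans (sum_le_sum fun T _ => ?_)
  rw [abs_mul, abs_of_nonneg (one_div_nonneg.2 (bFunction_nonneg s T))]
  exact mul_le_mul_of_nonneg_left (h s T) (one_div_nonneg.2 (bFunction_nonneg s T))

theorem sum_treeSum {ι : Type*} (A : Finset ι) (F : ι → (Fin k ↪ Fin n) → SimpleGraph (Fin k) → ℝ) :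
    ∑ i ∈ A, treeSum D (F i) = treeSum D fun s T => ∑ i ∈ A, F i s T := by
  simp only [treeSum, Finset.mul_sum]
  rw [sum_comm]
  exact sum_congr rfl fun s _ => sum_comm

theorem treeSum_mul (F : (Fin k ↪ Fin n) → SimpleGraph (Fin k) → ℝ) (c : ℝ) :
    treeSum D F * c = treeSum D fun s T => F s T * c := by
  simp only [treeSum, Finset.sum_mul, mul_assoc]

/-- The coefficient of `x e - p e`, for the bits `x` and the edge probabilities `p`, when in a
signed sum over ordered trees each difference of the product of `x` and the product of `p` over the
tree is telescoped along the order of the edges given by `r`. It depends only on the bits of the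
edges that precede `e`. -/
noncomputable def edgeCoeff {ι : Type*} [LinearOrder ι] (r : Edge n → ι) (D : Fin n → ℕ)
    (l : Fin n → ℝ) (σ : (Fin k ↪ Fin n) → SimpleGraph (Fin k) → ℝ) (e : Edge n)
    (ω : Edge n → Bool) : ℝ :=
  treeSum D fun s T => if e ∈ treeEdges s T then σ s T *
    ((∏ f ∈ treeEdges s T with r f < r e, bit (ω f)) *
      ∏ f ∈ treeEdges s T with r e < r f, edgeProb l f.1) else 0

variable {ι : Type*} [LinearOrder ι] {r : Edge n → ι}
  {σ : (Fin k ↪ Fin n) → SimpleGraph (Fin k) → ℝ}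

theorem edgeCoeff_update {e f : Edge n} (hef : r e ≤ r f) (ω : Edge n → Bool) (c : Bool) :
    edgeCoeff r D l σ e (update ω f c) = edgeCoeff r D l σ e ω := by
  refine congrArg (treeSum D) (funext₂ fun s T => ?_)
  rw [prod_congr rfl fun g hg => ?_]
  rw [update_of_ne]
  rintro rfl
  exact hef.not_gt (mem_filter.1 hg).2

theorem sum_edgeCoeff_mul (hr : Injective r) (ω : Edge n → Bool) :
    ∑ e, edgeCoeff r D l σ e ω * (bit (ω e) - edgeProb l e.1) = treeSum D fun s T => σ s T *
      (∏ e ∈ treeEdges s T, bit (ω e) - ∏ e ∈ treeEdges s T, edgeProb l e.1) := by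
  simp only [edgeCoeff, treeSum_mul, sum_treeSum]
  refine congrArg (treeSum D) (funext₂ fun s T => ?_)
  rw [prod_sub_prod_ordered hr (treeEdges s T) (fun e => bit (ω e)) fun e => edgeProb l e.1]
  simp only [ite_mul, zero_mul, sum_ite_mem, univ_inter, Finset.mul_sum]
  exact sum_congr rfl fun e _ => by ring

theorem exists_adj_of_mem_treeEdges {s : Fin k ↪ Fin n} {T : SimpleGraph (Fin k)} {e : Edge n}
    {i j : Fin n} (he : e.1 = s(i, j)) (hmem : e ∈ treeEdges s T) :
    ∃ q : Fin k × Fin k, T.Adj q.1 q.2 ∧ s q.1 = i ∧ s q.2 = j := by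
  obtain ⟨f, hf, hfe⟩ := mem_image.1 (mem_filter.1 hmem).2
  rw [he] at hfe
  induction f using Sym2.ind with
  | _ u v =>
    have hadj : T.Adj u v := by simpa using hf
    rw [Sym2.map_mk, Sym2.eq_iff] at hfe
    rcases hfe with ⟨hu, hv⟩ | ⟨hu, hv⟩
    · exact ⟨(u, v), hadj, hu, hv⟩
    · exact ⟨(v, u), hadj.symm, hv, hu⟩

open Classical in
theorem prod_erase_treeEdges {s : Fin k ↪ Fin n} {T : SimpleGraph (Fin k)} {e : Edge n}
    {u v : Fin k} (he : e.1 = s(s u, s v)) (W : Sym2 (Fin n) → ℝ) :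
    ∏ f ∈ (treeEdges s T).erase e, W f.1 = ∏ f ∈ T.edgeFinset.erase s(u, v), W (f.map s) := by
  have hprod := prod_treeEdges s T fun x => if x = e.1 then 1 else W x
  rw [← prod_erase (a := e) _ (by simp), ← prod_erase (s := T.edgeFinset) (a := s(u, v))
    (by simp [he])] at hprod
  calc ∏ f ∈ (treeEdges s T).erase e, W f.1
      = ∏ f ∈ (treeEdges s T).erase e, if f.1 = e.1 then 1 else W f.1 :=
        prod_congr rfl fun f hf => (if_neg fun h => (mem_erase.1 hf).1 (Subtype.ext h)).symm
    _ = ∏ f ∈ T.edgeFinset.erase s(u, v), if f.map s = e.1 then 1 else W (f.map s) := hprod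
    _ = ∏ f ∈ T.edgeFinset.erase s(u, v), W (f.map s) := prod_congr rfl fun f hf => by
        refine if_neg fun h => (mem_erase.1 hf).1 (Sym2.map.injective s.injective ?_)
        rw [h, he, Sym2.map_mk]

theorem sum_mem_treeEdges_le {T : SimpleGraph (Fin k)} (hT : T.IsTree) (hD : ∀ i, 1 ≤ D i)
    {W : Sym2 (Fin n) → ℝ} (hW : ∀ e, 0 ≤ W e) (hrow : ∀ i, ∑ j, W s(i, j) ≤ 3 * D i)
    (e : Edge n) :
    ∑ s : Fin k ↪ Fin n with e ∈ treeEdges s T,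
      1 / bFunction s T D * ∏ f ∈ (treeEdges s T).erase e, W f.1 ≤ k ^ 2 * 3 ^ k := by
  classical
  obtain ⟨i, j, he⟩ : ∃ i j, e.1 = s(i, j) := by
    obtain ⟨e, -⟩ := e
    induction e using Sym2.ind with
    | _ i j => exact ⟨i, j, rfl⟩
  have : Nonempty (Fin k) := hT.1.nonempty
  choose! q hadj hi hj using fun s : Fin k ↪ Fin n => exists_adj_of_mem_treeEdges (T := T) he
  rw [← sum_fiberwise_of_maps_to (t := {q : Fin k × Fin k | T.Adj q.1 q.2}) (g := q)
    fun s hs => (mem_filter_univ _).2 (hadj s (mem_filter.1 hs).2)]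
  have hfiber (p : Fin k × Fin k) (hp : T.Adj p.1 p.2) :
      ∑ s : Fin k ↪ Fin n with e ∈ treeEdges s T ∧ q s = p,
        1 / bFunction s T D * ∏ f ∈ (treeEdges s T).erase e, W f.1 ≤ 3 ^ k := by
    calc _ = ∑ s : Fin k ↪ Fin n with e ∈ treeEdges s T ∧ q s = p,
          1 / bFunction s T D * ∏ f ∈ T.edgeFinset.erase s(p.1, p.2), W (f.map s) := by
          refine sum_congr rfl fun s hs => ?_
          obtain ⟨hmem, rfl⟩ := (mem_filter_univ _).1 hs
          rw [prod_erase_treeEdges (u := (q s).1) (v := (q s).2)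
            (by rw [he, hi s hmem, hj s hmem])]
      _ ≤ ∑ s : Fin k ↪ Fin n with s p.1 = i ∧ s p.2 = j,
          1 / bFunction s T D * ∏ f ∈ T.edgeFinset.erase s(p.1, p.2), W (f.map s) := by
          refine sum_le_sum_of_subset_of_nonneg (fun s hs => ?_) fun s _ _ =>
            mul_nonneg (one_div_nonneg.2 (bFunction_nonneg s T)) (prod_nonneg fun _ _ => hW _)
          obtain ⟨hmem, rfl⟩ := (mem_filter_univ _).1 hs
          exact (mem_filter_univ _).2 ⟨hi s hmem, hj s hmem⟩
      _ ≤ 3 ^ k := sum_embedding_le hT hD hW hrow hp i j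
  simp only [filter_filter]
  calc _ ≤ ∑ q : Fin k × Fin k with T.Adj q.1 q.2, (3 : ℝ) ^ k :=
        sum_le_sum fun p hp => hfiber p (mem_filter.1 hp).2
    _ = #{q : Fin k × Fin k | T.Adj q.1 q.2} * 3 ^ k := by rw [sum_const, nsmul_eq_mul]
    _ ≤ k ^ 2 * 3 ^ k := by
        gcongr
        exact_mod_cast (card_le_univ _).trans_eq (by simp [sq])

/-- A bound for the coefficients `edgeCoeff` that depends only on the size `k` of the trees. The
summand `1` makes it positive for all `k`. -/
noncomputable def coeffBound (k : ℕ) : ℝ :=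
  Fintype.card (SimpleGraph (Fin k)) * (k ^ 2 * 3 ^ k) + 1

theorem coeffBound_pos (k : ℕ) : 0 < coeffBound k := by
  unfold coeffBound
  positivity

theorem treeSum_mem_treeEdges_le (hD : ∀ i, 1 ≤ D i) {W : Sym2 (Fin n) → ℝ} (hW : ∀ e, 0 ≤ W e)
    (hrow : ∀ i, ∑ j, W s(i, j) ≤ 3 * D i) (e : Edge n) :
    treeSum D (fun (s : Fin k ↪ Fin n) T =>
      if e ∈ treeEdges s T then ∏ f ∈ (treeEdges s T).erase e, W f.1 else 0) ≤ coeffBound k := by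
  classical
  rw [treeSum, sum_comm]
  simp only [mul_ite, mul_zero, ← sum_filter]
  calc _ ≤ ∑ T : SimpleGraph (Fin k) with T.IsTree, (k ^ 2 * 3 ^ k : ℝ) :=
        sum_le_sum fun T hT => sum_mem_treeEdges_le (mem_filter.1 hT).2 hD hW hrow e
    _ ≤ Fintype.card (SimpleGraph (Fin k)) * (k ^ 2 * 3 ^ k) := by
        rw [sum_const, nsmul_eq_mul]
        gcongr
        exact card_le_univ _
    _ ≤ coeffBound k := (lt_add_one _).le

theorem prod_mul_prod_le_prod_erase {E : Type*} [DecidableEq E] {r : E → ι} (hr : Injective r)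
    (F : Finset E) (e : E) {x p W : E → ℝ} (hx : ∀ f, x f ∈ Set.Icc 0 (W f))
    (hp : ∀ f, p f ∈ Set.Icc 0 (W f)) :
    (∏ f ∈ F with r f < r e, x f) * ∏ f ∈ F with r e < r f, p f ≤ ∏ f ∈ F.erase e, W f := by
  have hdisj : Disjoint ({f ∈ F | r f < r e}) ({f ∈ F | r e < r f}) :=
    disjoint_filter.2 fun f _ hlt => hlt.asymm
  have herase : F.erase e = {f ∈ F | r f < r e} ∪ {f ∈ F | r e < r f} := by
    ext f
    rw [← filter_or, mem_erase, mem_filter, ← ne_iff_lt_or_gt, hr.ne_iff, and_comm]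
  rw [herase, prod_union hdisj]
  exact mul_le_mul (prod_le_prod (fun f _ => (hx f).1) fun f _ => (hx f).2)
    (prod_le_prod (fun f _ => (hp f).1) fun f _ => (hp f).2) (prod_nonneg fun f _ => (hp f).1)
    (prod_nonneg fun f _ => (hx f).1.trans (hx f).2)

open Classical in
theorem degree_le_two_mul (hD : ∀ i, 1 ≤ D i) {a : ℝ} (ha : a ≤ 1) {G : SimpleGraph (Fin n)}
    (hG : G ∈ almostGraphs a D) (i : Fin n) : (G.degree i : ℝ) ≤ 2 * D i := by
  have hdeg := (abs_lt.1 (mem_almostGraphs.1 hG i)).1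
  have hpow : (D i : ℝ) ^ a ≤ D i := Real.rpow_le_self_of_one_le (by exact_mod_cast hD i) ha
  linarith

/-- A common upper bound for the bits of `G` and the edge probabilities, set to `0` on the
diagonal so that its row sums are those of the two. -/
noncomputable def edgeEnvelope (G : SimpleGraph (Fin n)) (l : Fin n → ℝ) (e : Sym2 (Fin n)) : ℝ :=
  open Classical in if e.IsDiag then 0 else G.edgeSet.indicator 1 e + edgeProb l e

theorem indicator_edgeSet_nonneg (G : SimpleGraph (Fin n)) (e : Sym2 (Fin n)) :
    0 ≤ G.edgeSet.indicator (1 : Sym2 (Fin n) → ℝ) e :=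
  Set.indicator_nonneg (fun _ _ => zero_le_one) e

theorem edgeEnvelope_nonneg (G : SimpleGraph (Fin n)) (l : Fin n → ℝ) (e : Sym2 (Fin n)) :
    0 ≤ edgeEnvelope G l e := by
  unfold edgeEnvelope
  split_ifs
  exacts [le_rfl, add_nonneg (indicator_edgeSet_nonneg G e) (edgeProb_mem_Icc l e).1]

theorem IsDual.sum_edgeEnvelope_le (hl : IsDual D l) (hD : ∀ i, 1 ≤ D i) {a : ℝ} (ha : a ≤ 1)
    {G : SimpleGraph (Fin n)} (hG : G ∈ almostGraphs a D) (i : Fin n) :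
    ∑ j, edgeEnvelope G l s(i, j) ≤ 3 * D i := by
  classical
  calc ∑ j, edgeEnvelope G l s(i, j)
      = ∑ j, (G.edgeSet.indicator 1 s(i, j) + if j ≠ i then edgeProb l s(i, j) else 0) := by
        refine sum_congr rfl fun j _ => ?_
        rcases eq_or_ne j i with rfl | hj
        · simp [edgeEnvelope]
        · simp [edgeEnvelope, hj, hj.symm]
    _ = G.degree i + D i := by
        rw [sum_add_distrib, sum_indicator_edgeSet, ← sum_filter]
        simp only [edgeProb_mk]
        rw [hl i]
    _ ≤ 3 * D i := by linarith [degree_le_two_mul hD ha hG i]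

theorem IsDual.abs_edgeCoeff_le (hl : IsDual D l) (hr : Injective r) (hD : ∀ i, 1 ≤ D i) {a : ℝ}
    (ha : a ≤ 1) {G : SimpleGraph (Fin n)} (hG : G ∈ almostGraphs a D)
    (hσ : ∀ s T, |σ s T| ≤ 1) (e : Edge n) :
    |edgeCoeff r D l σ e (graphBits n G)| ≤ coeffBound k := by
  have hbit (f : Edge n) : bit (graphBits n G f) ∈ Set.Icc 0 (edgeEnvelope G l f.1) := by
    rw [bit_graphBits, edgeEnvelope, if_neg f.2]
    exact ⟨indicator_edgeSet_nonneg G _, le_add_of_nonneg_right (edgeProb_mem_Icc l _).1⟩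
  have hprob (f : Edge n) : edgeProb l f.1 ∈ Set.Icc 0 (edgeEnvelope G l f.1) := by
    rw [edgeEnvelope, if_neg f.2]
    exact ⟨(edgeProb_mem_Icc l _).1, le_add_of_nonneg_left (indicator_edgeSet_nonneg G _)⟩
  refine (abs_treeSum_le fun s T => ?_).trans (treeSum_mem_treeEdges_le hD
    (edgeEnvelope_nonneg G l) (hl.sum_edgeEnvelope_le hD ha hG) e)
  split_ifs
  · have hnonneg : 0 ≤ (∏ f ∈ treeEdges s T with r f < r e, bit (graphBits n G f)) *
        ∏ f ∈ treeEdges s T with r e < r f, edgeProb l f.1 :=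
      mul_nonneg (prod_nonneg fun f _ => (hbit f).1) (prod_nonneg fun f _ => (hprob f).1)
    rw [abs_mul, abs_of_nonneg hnonneg]
    exact (mul_le_of_le_one_left hnonneg (hσ s T)).trans
      (prod_mul_prod_le_prod_erase hr _ e hbit hprob)
  · exact abs_zero.le

end ExpansionCoefficients

section Comparison

open Real

variable {n k : ℕ} {D : Fin n → ℕ} {l : Fin n → ℝ} {a : ℝ}

theorem IsDual.bernoulliProb_le_mul (hl : IsDual D l) {Λ : ℝ} (hΛ : ∀ i, |l i| ≤ Λ)
    {G G' : SimpleGraph (Fin n)} (hG : G ∈ almostGraphs a D) (hG' : G' ∈ almostGraphs a D) :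
    bernoulliProb (maxEntropy D) G'
      ≤ exp (2 * Λ * ∑ i, (D i : ℝ) ^ a) * bernoulliProb (maxEntropy D) G := by
  classical
  rw [mem_almostGraphs] at hG hG'
  have hdiff : ∑ i, (G'.degree i : ℝ) * l i - ∑ i, (G.degree i : ℝ) * l i
      ≤ 2 * Λ * ∑ i, (D i : ℝ) ^ a := by
    rw [← sum_sub_distrib, Finset.mul_sum]
    refine sum_le_sum fun i _ => ?_
    have hdeg : |(G'.degree i : ℝ) - G.degree i| ≤ 2 * (D i : ℝ) ^ a := by
      have h := _root_.abs_lt.1 (hG i)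
      have h' := _root_.abs_lt.1 (hG' i)
      exact _root_.abs_le.2 ⟨by linarith, by linarith⟩
    calc (G'.degree i : ℝ) * l i - G.degree i * l i
        ≤ |(G'.degree i : ℝ) - G.degree i| * |l i| := by
          rw [← sub_mul, ← abs_mul]
          exact le_abs_self _
      _ ≤ 2 * (D i : ℝ) ^ a * Λ := by gcongr; exact hΛ i
      _ = 2 * Λ * (D i : ℝ) ^ a := by ring
  rw [hl.bernoulliProb_eq_exp, hl.bernoulliProb_eq_exp, ← exp_add, exp_le_exp]
  linarith

open Classical in
theorem IsDual.inv_card_le (hl : IsDual D l) {Λ X : ℝ} (hΛ : ∀ i, |l i| ≤ Λ)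
    (hX : 1 / 2 * exp (-X)
      ≤ ∑ G : SimpleGraph (Fin n) with G ∈ almostGraphs a D, bernoulliProb (maxEntropy D) G)
    {G : SimpleGraph (Fin n)} (hG : G ∈ almostGraphs a D) :
    1 / (#{G : SimpleGraph (Fin n) | G ∈ almostGraphs a D} : ℝ)
      ≤ exp (2 * Λ * ∑ i, (D i : ℝ) ^ a + (1 + X)) * bernoulliProb (maxEntropy D) G := by
  set A : Finset (SimpleGraph (Fin n)) := {G | G ∈ almostGraphs a D}
  have hcard : (0 : ℝ) < #A := by exact_mod_cast card_pos.2 ⟨G, (mem_filter_univ _).2 hG⟩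
  have hsum : ∑ G ∈ A, bernoulliProb (maxEntropy D) G
      ≤ #A * (exp (2 * Λ * ∑ i, (D i : ℝ) ^ a) * bernoulliProb (maxEntropy D) G) := by
    rw [← nsmul_eq_mul]
    exact sum_le_card_nsmul _ _ _ fun G' hG' =>
      hl.bernoulliProb_le_mul hΛ hG ((mem_filter_univ _).1 hG')
  have hone : 1 ≤ exp (1 + X) * (1 / 2 * exp (-X)) := by
    rw [mul_left_comm, ← exp_add, add_neg_cancel_right]
    linarith [add_one_le_exp (1 : ℝ)]
  rw [div_le_iff₀ hcard, exp_add]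
  calc 1 ≤ exp (1 + X) * (1 / 2 * exp (-X)) := hone
    _ ≤ exp (1 + X) *
          (#A * (exp (2 * Λ * ∑ i, (D i : ℝ) ^ a) * bernoulliProb (maxEntropy D) G)) := by
        exact mul_le_mul_of_nonneg_left (hX.trans hsum) (exp_pos _).le
    _ = exp (2 * Λ * ∑ i, (D i : ℝ) ^ a) * exp (1 + X) * bernoulliProb (maxEntropy D) G * #A := by
        ring

theorem IsDual.sum_edgeProb_le_total (hl : IsDual D l) :
    ∑ e : Edge n, edgeProb l e.1 ≤ total D := by
  classical
  have hnonneg (e : Edge n) : 0 ≤ edgeProb l e.1 := (edgeProb_mem_Icc l e.1).1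
  calc ∑ e : Edge n, edgeProb l e.1
      ≤ ∑ e : Edge n, ∑ v : Fin n, if v ∈ e.1 then edgeProb l e.1 else 0 := by
        refine sum_le_sum fun e _ => ?_
        have hsingle := single_le_sum (f := fun v => if v ∈ e.1 then edgeProb l e.1 else 0)
          (fun v _ => ite_nonneg (hnonneg e) le_rfl) (mem_univ (Quot.out e.1).1)
        rwa [if_pos (Sym2.out_fst_mem e.1)] at hsingle
    _ = ∑ v, (D v : ℝ) := by
        rw [sum_comm]
        simp only [← sum_filter]
        exact sum_congr rfl fun v _ => hl.sum_edgeProb v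
    _ = total D := by rw [total, Nat.cast_sum]

open Classical in
theorem IsDual.average_treeSum_le (hl : IsDual D l) (hD : ∀ i, 1 ≤ D i) {K r : ℝ} (ha : a ≤ 1)
    (hr : r ∈ Set.Icc 0 1) (hne : (almostGraphs a D).Nonempty)
    (hK : ∀ G ∈ almostGraphs a D, 1 / (#{G : SimpleGraph (Fin n) | G ∈ almostGraphs a D} : ℝ)
      ≤ exp K * bernoulliProb (maxEntropy D) G)
    {σ : (Fin k ↪ Fin n) → SimpleGraph (Fin k) → ℝ} (hσ : ∀ s T, |σ s T| ≤ 1) :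
    r / coeffBound k * ((∑ G : SimpleGraph (Fin n) with G ∈ almostGraphs a D,
        treeSum D fun s T => σ s T * (treeIndicator s T G - probIndep D s T))
      / #{G : SimpleGraph (Fin n) | G ∈ almostGraphs a D}) ≤ K + r ^ 2 * total D := by
  set A : Finset (SimpleGraph (Fin n)) := {G | G ∈ almostGraphs a D}
  have hA : A.Nonempty := hne.imp fun G hG => (mem_filter_univ _).2 hG
  have hC := coeffBound_pos k
  let rank := Fintype.equivFin (Edge n)
  let b (e : Edge n) (ω : Edge n → Bool) : ℝ := r / coeffBound k * edgeCoeff rank D l σ e ω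
  have hb : ∀ G ∈ A, ∀ e, |b e (graphBits n G)| ≤ r := by
    intro G hG e
    have hle := hl.abs_edgeCoeff_le rank.injective hD ha ((mem_filter_univ _).1 hG) hσ e
    rw [abs_mul, abs_of_nonneg (div_nonneg hr.1 hC.le), div_mul_eq_mul_div, div_le_iff₀ hC]
    exact mul_le_mul_of_nonneg_left hle hr.1
  have hexpand (G : SimpleGraph (Fin n)) :
      ∑ e, b e (graphBits n G) * (bit (graphBits n G e) - edgeProb l e.1) = r / coeffBound k *
        treeSum D fun s T => σ s T * (treeIndicator s T G - probIndep D s T) := by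
    simp only [treeIndicator_eq, hl.probIndep_eq, b, mul_assoc]
    rw [← Finset.mul_sum, sum_edgeCoeff_mul rank.injective]
  have hweight : ∀ ω ∈ A.map (graphBits n).toEmbedding,
      1 / (#(A.map (graphBits n).toEmbedding) : ℝ)
        ≤ exp K * bitWeight (fun e : Edge n => edgeProb l e.1) ω := by
    refine forall_mem_map.2 fun G hG => ?_
    rw [card_map, Equiv.coe_toEmbedding, ← hl.bernoulliProb_eq]
    exact hK G ((mem_filter_univ _).1 hG)
  have haverage := average_predictable_le (r := rank) (p := fun e : Edge n => edgeProb l e.1)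
    (b := b) (fun e => edgeProb_mem_Icc l e.1)
    hA.map hweight hr (forall_mem_map.2 hb)
    fun e f hef ω c => by simp only [b, edgeCoeff_update hef]
  simp only [sum_map, card_map, Equiv.coe_toEmbedding, hexpand] at haverage
  rw [← Finset.mul_sum, mul_div_assoc] at haverage
  exact haverage.trans (by gcongr; exact hl.sum_edgeProb_le_total)

open Classical in
theorem average_treeSum_sign (hne : (almostGraphs a D).Nonempty) (hM : 0 < total D) :
    (∑ G : SimpleGraph (Fin n) with G ∈ almostGraphs a D, treeSum D fun (s : Fin k ↪ Fin n) T =>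
        SignType.sign (probAlmost a D s T - probIndep D s T)
          * (treeIndicator s T G - probIndep D s T))
      / #{G : SimpleGraph (Fin n) | G ∈ almostGraphs a D} = total D * treeError a k D := by
  obtain ⟨G, hG⟩ := hne
  have hcard : (#{G : SimpleGraph (Fin n) | G ∈ almostGraphs a D} : ℝ) ≠ 0 := by
    exact_mod_cast card_ne_zero_of_mem ((mem_filter_univ G).2 hG)
  rw [treeError_eq, ← mul_assoc, mul_one_div_cancel (by exact_mod_cast hM.ne'), one_mul,
    sum_treeSum, div_eq_mul_inv, treeSum_mul]
  refine congrArg (treeSum D) (funext₂ fun s T => ?_)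
  rw [← sign_mul_self, ← Finset.mul_sum, mul_assoc, ← div_eq_mul_inv, sum_sub_distrib, sub_div,
    sum_const, nsmul_eq_mul, mul_div_cancel_left₀ _ hcard]
  rfl

open Classical in
theorem IsDual.treeError_le (hl : IsDual D l) (hD : ∀ i, 1 ≤ D i) {K r : ℝ} (ha : a ≤ 1)
    (hM : 0 < total D) (hr : r ∈ Set.Ioc 0 1) (hne : (almostGraphs a D).Nonempty)
    (hK : ∀ G ∈ almostGraphs a D, 1 / (#{G : SimpleGraph (Fin n) | G ∈ almostGraphs a D} : ℝ)
      ≤ exp K * bernoulliProb (maxEntropy D) G)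
    (hKr : K ≤ total D * r ^ 2) : treeError a k D ≤ 2 * coeffBound k * r := by
  have hC := coeffBound_pos k
  have hr0 := hr.1
  have hM' : (0 : ℝ) < total D := by exact_mod_cast hM
  have haverage := hl.average_treeSum_le (k := k) hD ha (Set.Ioc_subset_Icc_self hr) hne hK
    (σ := fun s T => SignType.sign (probAlmost a D s T - probIndep D s T)) fun s T => by
      rcases SignType.sign (probAlmost a D s T - probIndep D s T) <;> simp
  rw [average_treeSum_sign hne hM] at haverage
  have hscaled : r / coeffBound k * (total D * treeError a k D)
      ≤ r / coeffBound k * (total D * (2 * coeffBound k * r)) := by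
    calc r / coeffBound k * (total D * treeError a k D) ≤ 2 * (total D * r ^ 2) := by linarith
      _ = r / coeffBound k * (total D * (2 * coeffBound k * r)) := by field_simp
  exact le_of_mul_le_mul_left (le_of_mul_le_mul_left hscaled (by positivity)) hM'

end Comparison

section Asymptotics

open Real

variable {n k : ℕ} {D : Fin n → ℕ} {l : Fin n → ℝ}

theorem sum_rpow_le (hD : ∀ i, 1 ≤ D i) (hDn : ∀ i, D i ≤ n) {a : ℝ} (ha : 1 / 2 ≤ a) :
    ∑ i, (D i : ℝ) ^ a ≤ (n : ℝ) ^ (a - 1 / 2) * √(n * total D) := by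
  have hterm (i) : (D i : ℝ) ^ a ≤ (n : ℝ) ^ (a - 1 / 2) * √(D i) := by
    have hpos : (0 : ℝ) < D i := by exact_mod_cast hD i
    calc (D i : ℝ) ^ a = (D i : ℝ) ^ (a - 1 / 2) * √(D i) := by
          rw [sqrt_eq_rpow, ← rpow_add hpos, sub_add_cancel]
      _ ≤ (n : ℝ) ^ (a - 1 / 2) * √(D i) := by
          gcongr
          exact hDn i
  calc ∑ i, (D i : ℝ) ^ a ≤ (n : ℝ) ^ (a - 1 / 2) * ∑ i, √(D i) := by
        rw [Finset.mul_sum]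
        exact sum_le_sum fun i _ => hterm i
    _ ≤ (n : ℝ) ^ (a - 1 / 2) * √(n * total D) := by
        gcongr
        apply le_sqrt_of_sq_le
        simpa [total] using sq_sum_le_card_mul_sum_sq (s := univ) (f := fun i => √(D i))

theorem sqrt_mul_mul_le {x M γ y : ℝ} (hM : 0 < M) (h : √(x / M) * γ ≤ y) :
    √(x * M) * γ ≤ M * y := by
  have hsqrt : √(x * M) = M * √(x / M) := by
    rw [← sqrt_sq hM.le, ← sqrt_mul (sq_nonneg M), sqrt_sq hM.le]
    congr 1
    field_simp
  rw [hsqrt, mul_assoc]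
  exact mul_le_mul_of_nonneg_left h hM.le

theorem mul_mul_rpow_le {x M γ ν : ℝ} (hx : 0 < x) (hM : 0 < M) (hγ : 1 ≤ γ)
    (h : √(x / M) * γ ≤ x ^ (-ν)) : x * γ * x ^ ν ≤ M * x ^ (-ν) := by
  have hsqrt : √(x / M) ≤ x ^ (-ν) := (le_mul_of_one_le_right (sqrt_nonneg _) hγ).trans h
  calc x * γ * x ^ ν = M * (√(x / M) * (√(x / M) * γ)) * x ^ ν := by
        rw [← mul_assoc √(x / M), mul_self_sqrt (by positivity)]
        field_simp
    _ ≤ M * (x ^ (-ν) * x ^ (-ν)) * x ^ ν := by gcongr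
    _ = M * x ^ (-ν) := by
        rw [mul_assoc, mul_assoc, ← rpow_add hx, neg_add_cancel, rpow_zero, mul_one]

theorem mul_rpow_sq_eq {x : ℝ} (hx : 0 < x) (M a ν : ℝ) :
    M * (x ^ (a - (ν + 1) / 2)) ^ 2 = x ^ (a - 1 / 2) * (M * x ^ (-ν) * x ^ (a - 1 / 2)) := by
  have hexp : (x ^ (a - (ν + 1) / 2)) ^ 2 = x ^ (a - 1 / 2) * x ^ (-ν) * x ^ (a - 1 / 2) := by
    rw [← rpow_mul_natCast hx.le, ← rpow_add hx, ← rpow_add hx]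
    congr 1
    push_cast
    ring
  rw [hexp]
  ring

theorem relative_entropy_le {x M γ ν a w : ℝ} (hx : 4 ≤ x) (hM : 0 < M) (hγ : 1 ≤ γ)
    (hν : 0 ≤ ν) (ha : 1 / 2 ≤ a) (h : √(x / M) * γ ≤ x ^ (-ν))
    (hw : w ≤ x ^ (a - 1 / 2) * √(x * M)) (hbig : 308 * log x ≤ x ^ (a - 1 / 2)) :
    2 * (38 * γ * log x) * w + (1 + (2 * (38 * γ * log x) + 1) * (3 * (x * x ^ ν)))
      ≤ M * (x ^ (a - (ν + 1) / 2)) ^ 2 := by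
  have hx0 : 0 < x := by linarith
  have hg : 1 ≤ log x := one_le_log_of_four_le hx
  have hsqrt := sqrt_mul_mul_le hM h
  have hlin := mul_mul_rpow_le hx0 hM hγ h
  have hY : 1 ≤ M * x ^ (-ν) := by
    refine le_trans ?_ hlin
    exact one_le_mul_of_one_le_of_one_le (one_le_mul_of_one_le_of_one_le (by linarith) hγ)
      (one_le_rpow (by linarith) hν)
  have hz : 1 ≤ x ^ (a - 1 / 2) := one_le_rpow (by linarith) (by linarith)
  rw [mul_rpow_sq_eq hx0]
  set z := x ^ (a - 1 / 2)
  set Y := M * x ^ (-ν)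
  set g := log x
  have hgY : g * Y ≤ g * Y * z := le_mul_of_one_le_right (by positivity) hz
  have hdeg : 2 * (38 * γ * g) * w ≤ 76 * (g * Y * z) := by
    calc 2 * (38 * γ * g) * w ≤ 2 * (38 * γ * g) * (z * √(x * M)) := by gcongr
      _ = 76 * (g * (√(x * M) * γ) * z) := by ring
      _ ≤ 76 * (g * Y * z) := by gcongr
  have hlow : (2 * (38 * γ * g) + 1) * (3 * (x * x ^ ν)) ≤ 231 * (g * Y * z) := by
    calc (2 * (38 * γ * g) + 1) * (3 * (x * x ^ ν)) ≤ 77 * (γ * g) * (3 * (x * x ^ ν)) := by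
          gcongr
          linarith [one_le_mul_of_one_le_of_one_le hγ hg]
      _ = 231 * (g * (x * γ * x ^ ν)) := by ring
      _ ≤ 231 * (g * Y) := by gcongr
      _ ≤ 231 * (g * Y * z) := by gcongr
  calc 2 * (38 * γ * g) * w + (1 + (2 * (38 * γ * g) + 1) * (3 * (x * x ^ ν)))
      ≤ 308 * (g * Y * z) := by linarith [one_le_mul_of_one_le_of_one_le hg hY]
    _ = 308 * g * (Y * z) := by ring
    _ ≤ z * (Y * z) := by gcongr

theorem exists_le_of_mul_le_total [Nonempty (Fin n)] {L : ℝ} (hL : n * L ≤ total D) :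
    ∃ v, L ≤ D v := by
  obtain ⟨v, -, hv⟩ := exists_le_of_sum_le (f := fun _ : Fin n => L) (g := fun v => (D v : ℝ))
    univ_nonempty (by simpa [total] using hL)
  exact ⟨v, hv⟩

theorem two_mul_exp_neg_le {x t : ℝ} (hx : 4 ≤ x) (ht : 128 * log x ≤ t) :
    2 * exp (-(t / 64)) ≤ 1 / (2 * x) := by
  have hx0 : 0 < x := by linarith
  calc 2 * exp (-(t / 64)) ≤ 2 * exp (-(log x + log x)) := by gcongr; linarith
    _ = 2 / (x * x) := by rw [exp_neg, exp_add, exp_log hx0, div_eq_mul_inv]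
    _ ≤ 1 / (2 * x) := by
        rw [div_le_div_iff₀ (by positivity) (by positivity)]
        nlinarith

theorem IsDual.total_le_sq (hl : IsDual D l) : (total D : ℝ) ≤ (n : ℝ) ^ 2 := by
  have hsum : total D ≤ n * n := by
    simpa [total] using sum_le_card_nsmul univ D n fun i _ => (hl.add_one_le i).trans' (by simp)
  rw [sq]
  exact_mod_cast hsum

theorem IsDual.two_mul_exponent_le_one (hl : IsDual D l) {γ ν : ℝ} (hn : 1 < n) (hM : 0 < total D)
    (hγ : 1 ≤ γ) (h : √(n / total D) * γ ≤ (n : ℝ) ^ (-ν)) : 2 * ν ≤ 1 := by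
  have hn' : (1 : ℝ) < n := by exact_mod_cast hn
  have hn0 : (0 : ℝ) < n := by linarith
  have hM' : (0 : ℝ) < total D := by exact_mod_cast hM
  have hpow : (n : ℝ) ^ (1 + ν) ≤ (n : ℝ) ^ (2 - ν) := by
    calc (n : ℝ) ^ (1 + ν) = n * (n : ℝ) ^ ν := by rw [rpow_add hn0, rpow_one]
      _ ≤ n * γ * (n : ℝ) ^ ν := by gcongr; exact le_mul_of_one_le_right hn0.le hγ
      _ ≤ total D * (n : ℝ) ^ (-ν) := mul_mul_rpow_le hn0 hM' hγ h
      _ ≤ (n : ℝ) ^ 2 * (n : ℝ) ^ (-ν) := by gcongr; exact hl.total_le_sq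
      _ = (n : ℝ) ^ (2 - ν) := by rw [sub_eq_add_neg, rpow_add hn0, rpow_two]
  linarith [(rpow_le_rpow_left_iff hn').1 hpow]

theorem exists_rpow_le_degree {γ ν : ℝ} (hn : 0 < n) (hM : 0 < total D) (hγ : 1 ≤ γ) (hν : 0 ≤ ν)
    (h : √(n / total D) * γ ≤ (n : ℝ) ^ (-ν)) : ∃ v, (n : ℝ) ^ ν ≤ D v := by
  have hn1 : (1 : ℝ) ≤ n := by exact_mod_cast hn
  have hM' : (0 : ℝ) < total D := by exact_mod_cast hM
  have : Nonempty (Fin n) := ⟨⟨0, hn⟩⟩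
  refine exists_le_of_mul_le_total ?_
  calc (n : ℝ) * (n : ℝ) ^ ν ≤ n * γ * (n : ℝ) ^ ν := by
        gcongr
        exact le_mul_of_one_le_right (by positivity) hγ
    _ ≤ total D * (n : ℝ) ^ (-ν) := mul_mul_rpow_le (by positivity) hM' hγ h
    _ ≤ total D := mul_le_of_le_one_right hM'.le
        (rpow_le_one_of_one_le_of_nonpos hn1 (by linarith))

open Classical in
theorem IsDual.prob_almostGraphs_ge_of_gap (hl : IsDual D l) (hpos : ∀ i, 1 ≤ D i)
    {γ ν a : ℝ} (hΛ : ∀ i, |l i| ≤ 38 * γ * log n) (hγ : 1 ≤ γ)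
    (h : √(n / total D) * γ ≤ (n : ℝ) ^ (-ν)) (hM : 0 < total D) (hn : 4 ≤ n) (hν : 0 ≤ ν)
    (ha : a ∈ Set.Icc (1 / 2) 1) (hsix : 6 ≤ (n : ℝ) ^ (ν * a))
    (hlog : 128 * log n ≤ (n : ℝ) ^ (ν * (2 * a - 1))) :
    1 / 2 * exp (-((2 * (38 * γ * log n) + 1) * (3 * (n * (n : ℝ) ^ ν))))
      ≤ ∑ G : SimpleGraph (Fin n) with G ∈ almostGraphs a D, bernoulliProb (maxEntropy D) G := by
  have hrpow {v b} (hb : 0 ≤ b) (hv : (n : ℝ) ^ ν ≤ D v) : (n : ℝ) ^ (ν * b) ≤ (D v : ℝ) ^ b := by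
    rw [rpow_mul (by positivity)]
    gcongr
  refine hl.prob_almostGraphs_ge hpos hΛ (by positivity)
    (exists_rpow_le_degree (by omega) hM hγ hν h) ha.2 (fun v hv => ?_) fun v hv => ?_
  · exact hsix.trans (hrpow (by linarith [ha.1]) hv)
  · exact two_mul_exp_neg_le (by exact_mod_cast hn)
      (hlog.trans (hrpow (by linarith [ha.1]) hv))

theorem treeError_le_of_gap {ν a : ℝ} (hpos : ∀ i, 1 ≤ D i) (hmono : Monotone D)
    (hD : StrictErdosGallai D) {ℓ last : Fin n} (hlast : (last : ℕ) + 1 = n)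
    (hℓ : (upperSum D ℓ : ℝ) ≤ (total D : ℝ) / 2)
    (hgap : √(n / total D) * ((D last : ℝ) - D ℓ + 1) ≤ (n : ℝ) ^ (-ν)) (hν : 0 < ν)
    (ha : 1 / 2 < a) (haν : a < ν / 4 + 1 / 2) (hn : 4 ≤ n)
    (hsix : 6 ≤ (n : ℝ) ^ (ν * a)) (hlog : 128 * log n ≤ (n : ℝ) ^ (ν * (2 * a - 1)))
    (hbig : 308 * log n ≤ (n : ℝ) ^ (a - 1 / 2)) :
    treeError a k D ≤ 2 * coeffBound k * (n : ℝ) ^ (a - (ν + 1) / 2) := by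
  classical
  obtain ⟨l, hl⟩ := hD.exists_isDual hmono hpos
  have hn4 : (4 : ℝ) ≤ n := by exact_mod_cast hn
  have hM : 0 < total D := (hpos last).trans (single_le_sum_of_canonicallyOrdered (mem_univ last))
  have hγ : (1 : ℝ) ≤ (D last : ℝ) - D ℓ + 1 := by
    have hle : (D ℓ : ℝ) ≤ D last := by exact_mod_cast hmono (Fin.le_def.2 (by omega))
    linarith
  have hΛ := hl.abs_le hD hmono hpos hn hlast hℓ
  have hν1 := hl.two_mul_exponent_le_one (by omega) hM hγ hgap
  have hprob := hl.prob_almostGraphs_ge_of_gap hpos hΛ hγ hgap hM hn hν.le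
    ⟨ha.le, by linarith⟩ hsix hlog
  obtain ⟨G₀, hG₀⟩ := nonempty_of_sum_ne_zero (hprob.trans_lt' (by positivity)).ne'
  refine hl.treeError_le hpos (by linarith) hM ⟨by positivity, ?_⟩ ⟨G₀, (mem_filter.1 hG₀).2⟩
    (fun G hG => hl.inv_card_le hΛ hprob hG) ?_
  · exact rpow_le_one_of_one_le_of_nonpos (by linarith) (by linarith)
  · refine relative_entropy_le hn4 (by exact_mod_cast hM) hγ hν.le ha.le hgap ?_ hbig
    exact sum_rpow_le hpos (fun i => (hl.add_one_le i).trans' (by simp)) ha.le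

theorem eventually_mul_log_le {c δ : ℝ} (hc : 0 < c) (hδ : 0 < δ) :
    ∀ᶠ n : ℕ in Filter.atTop, c * log n ≤ (n : ℝ) ^ δ := by
  have hbound := (isLittleO_log_rpow_atTop hδ).bound (inv_pos.2 hc)
  filter_upwards [(hbound.and (Filter.eventually_ge_atTop 1)).natCast_atTop] with n hn
  rw [norm_of_nonneg (log_nonneg hn.2), norm_of_nonneg (by positivity), inv_mul_eq_div,
    le_div_iff₀ hc] at hn
  linarith [hn.1]

theorem tendsto_const_mul_rpow_atTop_zero (c : ℝ) {δ : ℝ} (hδ : δ < 0) :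
    Filter.Tendsto (fun n : ℕ => c * (n : ℝ) ^ δ) Filter.atTop (nhds 0) := by
  have hlim := (tendsto_rpow_neg_atTop (neg_pos.2 hδ)).comp (tendsto_natCast_atTop_atTop (R := ℝ))
  simpa using hlim.const_mul c

end Asymptotics

end AlmostDegree

theorem mainTheorem1_general (k : ℕ) :
    ∃ c : ℝ, 0 < c ∧
      ∀ ν a : ℝ, 0 < ν → 1 / 2 < a → a < ν / 4 + 1 / 2 →
        (∃ N : ℕ, ∀ n : ℕ, N ≤ n → ∀ D : Fin n → ℕ,
          (∀ i, 1 ≤ D i) → Monotone D → AlmostDegree.StrictErdosGallai D →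
          ∀ ℓ last : Fin n, (last : ℕ) + 1 = n →
            (AlmostDegree.upperSum D ℓ : ℝ) ≤ (AlmostDegree.total D : ℝ) / 2 →
            √(n / AlmostDegree.total D) * ((D last : ℝ) - D ℓ + 1) ≤ (n : ℝ) ^ (-ν) →
            AlmostDegree.treeError a k D ≤ c * (n : ℝ) ^ (a - (ν + 1) / 2)) ∧
        Filter.Tendsto (fun n : ℕ => c * (n : ℝ) ^ (a - (ν + 1) / 2))
          Filter.atTop (nhds 0) := by
  refine ⟨2 * AlmostDegree.coeffBound k, mul_pos two_pos (AlmostDegree.coeffBound_pos k),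
    fun ν a hν ha haν => ⟨?_, AlmostDegree.tendsto_const_mul_rpow_atTop_zero _ (by linarith)⟩⟩
  have hsix : ∀ᶠ n : ℕ in Filter.atTop, 6 ≤ (n : ℝ) ^ (ν * a) :=
    ((tendsto_rpow_atTop (by positivity)).comp
      tendsto_natCast_atTop_atTop).eventually_ge_atTop 6
  have hlog := AlmostDegree.eventually_mul_log_le (c := 128) (by norm_num)
    (mul_pos hν (by linarith : 0 < 2 * a - 1))
  have hbig := AlmostDegree.eventually_mul_log_le (c := 308) (by norm_num)
    (by linarith : 0 < a - 1 / 2)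
  refine Filter.eventually_atTop.1 ?_
  filter_upwards [hsix, hlog, hbig, Filter.eventually_ge_atTop 4]
    with n hsix hlog hbig hn D hpos hmono hD ℓ last hlast hℓ hgap
  exact AlmostDegree.treeError_le_of_gap hpos hmono hD hlast hℓ hgap hν ha haν hn hsix hlog hbig

theorem mainTheorem1 (k : ℕ) :
    ∃ c : ℝ, 0 < c ∧
      ∀ ε ν a : ℝ, 0 < ε → 0 < ν → 1 / 2 < a → a < ν / 4 + 1 / 2 →
        (∃ N : ℕ, ∀ n : ℕ, N ≤ n → ∀ D : Fin n → ℕ,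
          AlmostDegree.IsStrictGraphicOfType ε ν D →
            AlmostDegree.treeError a k D ≤ c * (n : ℝ) ^ (a - (ν + 1) / 2)) ∧
        Filter.Tendsto (fun n : ℕ => c * (n : ℝ) ^ (a - (ν + 1) / 2))
          Filter.atTop (nhds 0) := by
  obtain ⟨c, hc, h⟩ := mainTheorem1_general k
  refine ⟨c, hc, fun ε ν a _ hν ha haν => ⟨?_, (h ν a hν ha haν).2⟩⟩
  obtain ⟨N, hN⟩ := (h ν a hν ha haν).1
  refine ⟨N, fun n hn D hD => ?_⟩
  obtain ⟨ℓ, last, hlast, hℓ, hgap⟩ := hD.gap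
  exact hN n hn D hD.pos hD.mono hD.strictErdosGallai ℓ last hlast hℓ.1 hgap.le
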